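/- **Setting.** Let $n\ge 1$, $d\ge 0$, $\gamma\in(0,1)$ and $r_{\max},M_g,M_h,l_2>0$. Each agent $i\in[n]$ has its own Markov decision process with measurable state and action spaces $\mathcal S_i,\mathcal A_i$, transition kernel $\mathcal P_i$, initial distribution $\rho_i$, measurable reward $r_i:\mathcal S_i\times\mathcal A_i\to[-r_{\max},r_{\max}]$, and policy densities $\pi_{i,\theta}(\cdot|s)$, $\theta\in\mathbb R^d$, with respect to a $\sigma$-finite reference measure on $\mathcal A_i$. For all $i,s,a$ the map $\theta\mapsto\pi_{i,\theta}(a|s)$ is positive and twice continuously differentiable, with $\|\nabla\log\pi_{i,\theta}(a|s)\|\le M_g$, $\|\nabla^2\log\pi_{i,\theta}(a|s)\|\le M_h$ and $\|\nabla^2\log\pi_{i,\theta}(a|s)-\nabla^2\log\pi_{i,\bar\theta}(a|s)\|\le l_2\|\theta-\bar\theta\|$ for all $\theta,\bar\theta$. The objective is $$J(\theta)=\frac1n\sum_{i=1}^nJ_i(\theta),\qquad J_i(\theta)=\mathbb E\Big[\sum_{t\ge0}\gamma^tr_i(s_{i,t},a_{i,t})\Big],$$ where $s_{i,0}\sim\rho_i$,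 $a_{i,t}\sim\pi_{i,\theta}(\cdot|s_{i,t})$, $s_{i,t+1}\sim\mathcal P_i(\cdot|s_{i,t},a_{i,t})$. For a trajectory $\tau=(s_0,a_0,\dots,s_{H-1},a_{H-1})$ of agent $i$, with law $p_i(\cdot|\pi_{i,\theta})$, put $g_{i,H}(\tau,\theta)=\sum_{t=0}^{H-1}\big(\sum_{h=t}^{H-1}\gamma^hr_i(s_h,a_h)\big)\nabla\log\pi_{i,\theta}(a_t|s_t)$. Let $\Delta=\sup_\theta J(\theta)-J(\theta_0)$. **Constants.** $L_g=\frac{r_{\max}(M_g^2+M_h)}{(1-\gamma)^2}$, $\ \sigma^2=\frac{r_{\max}^2M_g^2}{(1-\gamma)^3}$, $\ D_g=\frac{M_gr_{\max}}{1-\gamma}\sqrt{\frac1{1-\gamma}+H}$, $\ D_h=\frac{(M_h+M_g^2)r_{\max}}{1-\gamma}\big(\frac1{1-\gamma}+H\big)$, $$L_h=\tfrac{r_{\max}M_gM_h}{(1-\gamma)^2}+\tfrac{r_{\max}M_g^3(1+\gamma)}{(1-\gamma)^3}+\tfrac{r_{\max}M_g}{1-\gamma}\max\Big\{M_h,\tfrac{\gamma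 M_g^2}{1-\gamma},\tfrac{l_2}{(1-\gamma)M_g},\tfrac{M_h\gamma}{1-\gamma},\tfrac{M_g(1+\gamma)+M_h\gamma(1-\gamma)}{1-\gamma^2}\Big\}.$$ For $\varepsilon>0$ let $A=\frac{L_g\Delta}{\varepsilon^2}+\frac{\sqrt{L_h}\Delta}{\varepsilon^{3/2}}$ and $B=\frac{\sigma^2}{\varepsilon^2}+\frac{\sigma^2\sqrt{L_h}\Delta}{\varepsilon^{7/2}}$, and $M_{\rm init}=\max\{\lceil\sigma^2/\varepsilon^2\rceil,1\}$, $M=\max\{\lceil B/A\rceil,1\}$ ($M=1$ if $\Delta=0$), $\eta=\min\{\frac{M\varepsilon^2}{64\sigma^2},\frac12\}$, $\alpha=\min\{\frac{\varepsilon}{8L_g},\frac{\eta\sqrt\varepsilon}{4\sqrt{L_h}}\}$, and let $H$ be the smallest integer with $H\ge\max\{\log_\gamma\big(\frac{\varepsilon\eta}{64\max\{D_g,\alpha D_h\}}\big),1\}$ (where $D_g,D_h$ are evaluated at $H$). **Malenia NIGT.** Put $d_0=\mathrm{Agg}(\theta_0,M_{\rm init})$, $\theta_1=\theta_0+\alpha\frac{d_0}{\|d_0\|}$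 and, for $t\ge1$, $\widetilde\theta_t=\theta_t+\frac{1-\eta}{\eta}(\theta_t-\theta_{t-1})$, $g_t=\mathrm{Agg}(\widetilde\theta_t,M)$, $d_t=(1-\eta)d_{t-1}+\eta g_t$, $\theta_{t+1}=\theta_t+\alpha\frac{d_t}{\|d_t\|}$ (with $0/\|0\|=0$). In $\mathrm{Agg}(\theta,M')$ the point $\theta$ is broadcast; each agent $i$ then samples independent trajectories $\tau_{i,1},\tau_{i,2},\dots\sim p_i(\cdot|\pi_{i,\theta})$ one after the other, and computes $g_{i,H}(\tau_{i,j},\theta)$. The gradients are received in the order in which they are completed; with $M_i$ the number received so far from agent $i$, the loop stops as soon as $\big(\frac1n\sum_i\frac1{M_i}\big)^{-1}\ge\frac{M'}n$ (all $M_i\ge1$), and $\frac1n\sum_i\frac1{M_i}\sum_{j=1}^{M_i}g_{i,H}(\tau_{i,j},\theta)$ is returned. Trajectories are independent across agents and, given the past, of earlier ones; the order of arrival in a call may depend on the past but not on the trajectories sampled in that call. **Time model.** Computing one gradient $g_{i,H}$ on agent $i$ takes at most $h_i=\dot h_iH$ seconds, where $\dot h_1\le\dots\le\dot h_n$ (and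 an agent completes only finitely many gradients in bounded time); broadcasting a point to the agents takes at most $\kappa\ge0$ seconds, and so does returning the result. **Theorem.** $J$ is differentiable, and there is a universal constant $C>0$ such that for every such problem, every $\theta_0$ and every $\varepsilon>0$ there is an integer $T\ge1$, not depending on the computation and communication times, with the following property. If $\bar\theta_T$ is drawn uniformly, and independently of the run, from $\{\theta_0,\dots,\theta_{T-1}\}$, then $\mathbb E\|\nabla J(\bar\theta_T)\|\le\varepsilon$, and $\theta_0,\dots,\theta_{T-1}$ are available after at most $$C\,\Lambda\left(\kappa\Big(\frac{L_g\Delta}{\varepsilon^2}+\frac{\sqrt{L_h}\Delta}{\varepsilon^{3/2}}\Big)+\frac1{1-\gamma}\left[\dot h_n\Big(\frac{L_g\Delta}{\varepsilon^2}+\frac{\sqrt{L_h}\Delta}{\varepsilon^{3/2}}\Big)+\Big(\frac1n\sum_{i=1}^n\dot h_i\Big)\Big(\frac{\sigma^2}{n\varepsilon^2}+\frac{\sigma^2\sqrt{L_h}\Delta}{n\varepsilon^{7/2}}\Big)\right]\right)$$ seconds, where $\Lambda=\log\big(2+\frac{r_{\max}M_g}{\varepsilon}+\frac1{1-\gamma}\big)$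 is the logarithmic factor of the $\tilde{\mathcal O}$ notation. -/

import Mathlib

open MeasureTheory ProbabilityTheory
open scoped BigOperators Gradient ENNReal

noncomputable section

namespace MaleniaNIGT

/-- Parameter space `ℝ^d` with the Euclidean norm. -/
abbrev Par (d : ℕ) : Type := EuclideanSpace ℝ (Fin d)

/-! ### One agent: a Markov decision process with a parametrized policy -/

/-- The environment `(S, A, P, r, ρ)` of an agent together with its parametrized policy; the policy
is given by densities `dens θ s a` (written `π_θ(a|s)`) with respect to a σ-finite reference measure
`ref` on the action space. The discount factor is kept outside, since the agents share it. -/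
structure Agent (d : ℕ) (S A : Type*) [MeasurableSpace S] [MeasurableSpace A] where
  /-- transition kernel -/
  trans : Kernel (S × A) S
  trans_markov : IsMarkovKernel trans
  /-- reward function -/
  reward : S → A → ℝ
  reward_measurable : Measurable (Function.uncurry reward)
  /-- initial state distribution -/
  init : Measure S
  init_prob : IsProbabilityMeasure init
  /-- reference measure on actions -/
  ref : Measure A
  ref_sigmaFinite : SigmaFinite ref
  /-- policy density -/
  dens : Par d → S → A → ℝ
  dens_measurable : ∀ θ, Measurable (Function.uncurry (dens θ))
  dens_nonneg : ∀ θ s a, 0 ≤ dens θ s a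
  dens_lintegral : ∀ θ s, ∫⁻ a, ENNReal.ofReal (dens θ s a) ∂ref = 1

attribute [instance] Agent.trans_markov Agent.init_prob Agent.ref_sigmaFinite

namespace Agent

variable {d : ℕ} {S A : Type*} [MeasurableSpace S] [MeasurableSpace A] (a : Agent d S A)

/-- The policy `π_θ(·|s)` as a kernel from states to actions. -/
def policy (θ : Par d) : Kernel S A :=
  Kernel.withDensity (Kernel.const S a.ref) (fun s b => ENNReal.ofReal (a.dens θ s b))

instance policy_markov (θ : Par d) : IsMarkovKernel (a.policy θ) := by
  refine ⟨fun s => ⟨?_⟩⟩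
  have hm : Measurable (Function.uncurry (fun s b => ENNReal.ofReal (a.dens θ s b))) :=
    (a.dens_measurable θ).ennreal_ofReal
  rw [policy, Kernel.withDensity_apply' _ hm]
  simpa using a.dens_lintegral θ s

/-- One step of the state-action chain: `s' ∼ P(·|s,a)`, then `a' ∼ π_θ(·|s')`. -/
def step (θ : Par d) : Kernel (S × A) (S × A) :=
  a.trans ⊗ₖ Kernel.prodMkLeft (S × A) (a.policy θ)

instance step_markov (θ : Par d) : IsMarkovKernel (a.step θ) := by
  unfold step; infer_instance

/-- The step as a kernel on histories; it only looks at the last state-action pair. -/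
def histStep (θ : Par d) (t : ℕ) :
    Kernel ((i : Finset.Iic t) → (fun _ : ℕ => S × A) i) ((fun _ : ℕ => S × A) (t + 1)) :=
  (a.step θ).comap (fun x => x ⟨t, Finset.mem_Iic.2 le_rfl⟩) (measurable_pi_apply _)

instance histStep_markov (θ : Par d) (t : ℕ) : IsMarkovKernel (a.histStep θ t) := by
  unfold histStep; infer_instance

/-- Law of the infinite trajectory `(s_t, a_t)_{t ≥ 0}`: `s_0 ∼ ρ`, `a_t ∼ π_θ(·|s_t)`,
`s_{t+1} ∼ P(·|s_t,a_t)`. -/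
def pathLaw (θ : Par d) : Measure (ℕ → S × A) :=
  Kernel.trajMeasure (X := fun _ : ℕ => S × A) (a.init ⊗ₘ a.policy θ) (a.histStep θ)

instance pathLaw_prob (θ : Par d) : IsProbabilityMeasure (a.pathLaw θ) := by
  unfold pathLaw; infer_instance

/-- Law `p(·|π_θ)` of the trajectory `(s_0,a_0,…,s_{H-1},a_{H-1})` of length `H`. -/
def trajLaw (H : ℕ) (θ : Par d) : Measure (Fin H → S × A) :=
  (a.pathLaw θ).map (fun ω t => ω t)

instance trajLaw_prob (H : ℕ) (θ : Par d) : IsProbabilityMeasure (a.trajLaw H θ) := by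
  have hm : Measurable (fun (ω : ℕ → S × A) (t : Fin H) => ω (t : ℕ)) :=
    measurable_pi_iff.2 fun t => measurable_pi_apply (t : ℕ)
  exact Measure.isProbabilityMeasure_map hm.aemeasurable

/-- Expected discounted return `J_i(θ) = E[∑_t γ^t r(s_t,a_t)]`. -/
def value (γ : ℝ) (θ : Par d) : ℝ :=
  ∫ ω, ∑' t : ℕ, γ ^ t * a.reward (ω t).1 (ω t).2 ∂(a.pathLaw θ)

/-- `θ ↦ log π_θ(b|s)`. -/
def logDens (s : S) (b : A) (θ : Par d) : ℝ := Real.log (a.dens θ s b)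

/-- Stochastic policy gradient
`g_H(τ,θ) = ∑_{t<H} (∑_{t≤h<H} γ^h r(s_h,a_h)) ∇ log π_θ(a_t|s_t)`. -/
def stochGrad (γ : ℝ) (H : ℕ) (τ : Fin H → S × A) (θ : Par d) : Par d :=
  ∑ t : Fin H, (∑ h ∈ Finset.Ici t, γ ^ (h : ℕ) * a.reward (τ h).1 (τ h).2) •
    ∇ (a.logDens (τ t).1 (τ t).2) θ

end Agent

/-! ### Constants -/

/-- The constants shared by all agents. -/
structure Consts where
  /-- discount factor -/
  γ : ℝ
  /-- bound on the rewards -/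
  rmax : ℝ
  /-- bound on `‖∇ log π‖` -/
  Mg : ℝ
  /-- bound on `‖∇² log π‖` -/
  Mh : ℝ
  /-- Lipschitz constant of `∇² log π` -/
  l2 : ℝ

/-- The range of the constants. -/
structure Consts.Valid (c : Consts) : Prop where
  γ_pos : 0 < c.γ
  γ_lt_one : c.γ < 1
  rmax_pos : 0 < c.rmax
  Mg_pos : 0 < c.Mg
  Mh_pos : 0 < c.Mh
  l2_pos : 0 < c.l2

/-- Bounded rewards, and a positive `C²` policy whose log-density has gradient bounded by `M_g`,
Hessian bounded by `M_h` (operator norm) and `l_2`-Lipschitz Hessian. -/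
structure Agent.Regular {d : ℕ} {S A : Type*} [MeasurableSpace S] [MeasurableSpace A]
    (a : Agent d S A) (c : Consts) : Prop where
  reward_le : ∀ s b, |a.reward s b| ≤ c.rmax
  dens_pos : ∀ θ s b, 0 < a.dens θ s b
  dens_contDiff : ∀ s b, ContDiff ℝ 2 (fun θ => a.dens θ s b)
  grad_le : ∀ s b θ, ‖∇ (a.logDens s b) θ‖ ≤ c.Mg
  hess_le : ∀ s b θ, ‖fderiv ℝ (∇ (a.logDens s b)) θ‖ ≤ c.Mh
  hess_lip : ∀ s b θ θ',
    ‖fderiv ℝ (∇ (a.logDens s b)) θ - fderiv ℝ (∇ (a.logDens s b)) θ'‖ ≤ c.l2 * ‖θ - θ'‖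

namespace Consts

variable (c : Consts)

/-- `L_g`, the smoothness constant of the objective. -/
def Lg : ℝ := c.rmax * (c.Mg ^ 2 + c.Mh) / (1 - c.γ) ^ 2

/-- `L_h`, the smoothness constant of the Hessian of the objective, with `l_2 / ((1 - γ) M_g)` as
the third entry of the maximum. With `l_2 / M_g` in that place the constant is too small: the true
Lipschitz constant of the Hessian can exceed it by a factor of order `(1 - γ)^{-1/2}`. -/
def Lh : ℝ :=
  c.rmax * c.Mg * c.Mh / (1 - c.γ) ^ 2 + c.rmax * c.Mg ^ 3 * (1 + c.γ) / (1 - c.γ) ^ 3 +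
    c.rmax * c.Mg / (1 - c.γ) *
      max c.Mh (max (c.γ * c.Mg ^ 2 / (1 - c.γ)) (max (c.l2 / ((1 - c.γ) * c.Mg))
        (max (c.Mh * c.γ / (1 - c.γ))
          ((c.Mg * (1 + c.γ) + c.Mh * c.γ * (1 - c.γ)) / (1 - c.γ ^ 2)))))

/-- `D_g` for horizon `H`. -/
def Dg (H : ℕ) : ℝ := c.Mg * c.rmax / (1 - c.γ) * √(1 / (1 - c.γ) + H)

/-- `D_h` for horizon `H`. -/
def Dh (H : ℕ) : ℝ := (c.Mh + c.Mg ^ 2) * c.rmax / (1 - c.γ) * (1 / (1 - c.γ) + H)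

/-- `σ²`, the variance bound of the stochastic policy gradients. -/
def sigmaSq : ℝ := c.rmax ^ 2 * c.Mg ^ 2 / (1 - c.γ) ^ 3

/-- `L_g Δ / ε² + √L_h Δ / ε^{3/2}`. -/
def iterTerm (ε Δ : ℝ) : ℝ := c.Lg * Δ / ε ^ 2 + √c.Lh * Δ / ε ^ (3 / 2 : ℝ)

/-- `σ² / ε² + σ² √L_h Δ / ε^{7/2}`. -/
def noiseTerm (ε Δ : ℝ) : ℝ := c.sigmaSq / ε ^ 2 + c.sigmaSq * √c.Lh * Δ / ε ^ (7 / 2 : ℝ)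

/-- `M_init = max {⌈σ²/ε²⌉, 1}`. -/
def batchInit (ε : ℝ) : ℕ := max ⌈c.sigmaSq / ε ^ 2⌉₊ 1

/-- `M = max {⌈(σ²/ε² + σ²√L_h Δ/ε^{7/2}) / (L_g Δ/ε² + √L_h Δ/ε^{3/2})⌉, 1}` (and `1` in the
degenerate case `Δ = 0`). -/
def batch (ε Δ : ℝ) : ℕ := max ⌈c.noiseTerm ε Δ / c.iterTerm ε Δ⌉₊ 1

/-- Momentum `η = min {M ε² / (64 σ²), 1/2}`. -/
def momentum (ε Δ : ℝ) : ℝ := min (c.batch ε Δ * ε ^ 2 / (64 * c.sigmaSq)) (1 / 2)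

/-- Step size `α = min {ε / (8 L_g), η √ε / (4 √L_h)}`. -/
def stepSize (ε Δ : ℝ) : ℝ :=
  min (ε / (8 * c.Lg)) (c.momentum ε Δ * √ε / (4 * √c.Lh))

/-- Horizon `H = max {log_γ (ε η / (64 max {D_g, α D_h})), 1}`. As `D_g` and `D_h` depend on `H`,
this is an implicit equation; `H` is the smallest integer that is at least the right-hand side,
that is, the solution of the equation rounded up. -/
def horizon (ε Δ : ℝ) : ℕ :=
  sInf {H : ℕ | max (Real.logb c.γ
    (ε * c.momentum ε Δ / (64 * max (c.Dg H) (c.stepSize ε Δ * c.Dh H)))) 1 ≤ (H : ℝ)}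

/-- The logarithmic factor hidden in the `Õ` notation. -/
def logFactor (ε : ℝ) : ℝ := Real.log (2 + c.rmax * c.Mg / ε + 1 / (1 - c.γ))

end Consts

/-! ### The heterogeneous problem and the algorithm -/

section Hetero

variable {n d : ℕ} {S A : Fin n → Type*} [∀ i, MeasurableSpace (S i)] [∀ i, MeasurableSpace (A i)]

/-- `J(θ) = (1/n) ∑_i J_i(θ)`. -/
def objective (ag : ∀ i, Agent d (S i) (A i)) (γ : ℝ) (θ : Par d) : ℝ :=
  (1 / n : ℝ) * ∑ i, (ag i).value γ θ

/-- `Δ = sup_θ J(θ) - J(θ₀)`. -/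
def gap (ag : ∀ i, Agent d (S i) (A i)) (γ : ℝ) (θ₀ : Par d) : ℝ :=
  (⨆ θ, objective ag γ θ) - objective ag γ θ₀

/-- All trajectories that the agents can sample in one call of the aggregation procedure:
`τ (i, j)` is the `j`-th trajectory of agent `i` (`j` starts at `0`). -/
abbrev Trajs (S A : Fin n → Type*) (H : ℕ) : Type _ :=
  (p : Fin n × ℕ) → (Fin H → S p.1 × A p.1)

/-- The law of `Trajs` when all trajectories are independent and those of agent `i` have law
`p_i(·|π_{i,θ})`. -/
def trajsLaw (ag : ∀ i, Agent d (S i) (A i)) (H : ℕ) (θ : Par d) : Measure (Trajs S A H) :=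
  Measure.infinitePi (fun p : Fin n × ℕ => (ag p.1).trajLaw H θ)

/-- If `who l` is the agent whose gradient is received in the `l`-th pass (from `0`) of the loop,
then `received who l i` is the number `M_i` of gradients received from agent `i` in the first `l`
passes. -/
def received (who : ℕ → Fin n) (l : ℕ) (i : Fin n) : ℕ :=
  ((Finset.range l).filter (fun l' => who l' = i)).card

/-- The negation of the loop condition `(1/n ∑_i 1/M_i)⁻¹ < M/n`, where the left-hand side counts
as `0` when some `M_i = 0`. -/
def LoopDone (M : ℕ) (m : Fin n → ℕ) : Prop :=
  (∀ i, 0 < m i) ∧ (M : ℝ) / n ≤ ((1 / n : ℝ) * ∑ i, 1 / (m i : ℝ))⁻¹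

/-- The number of passes of the loop. -/
def passes (M : ℕ) (who : ℕ → Fin n) : ℕ := sInf {l : ℕ | LoopDone M (received who l)}

/-- The vector returned by the aggregation procedure at `θ`:
`(1/n) ∑_i (1/M_i) ∑_{j < M_i} g_{i,H}(τ_{i,j}, θ)` with the final values of the `M_i`. -/
def aggregate (ag : ∀ i, Agent d (S i) (A i)) (γ : ℝ) (H M : ℕ) (who : ℕ → Fin n)
    (τ : Trajs S A H) (θ : Par d) : Par d :=
  (1 / n : ℝ) • ∑ i, (1 / (received who (passes M who) i : ℝ)) •
    ∑ j ∈ Finset.range (received who (passes M who) i), (ag i).stochGrad γ H (τ (i, j)) θ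

/-- A run of Malenia NIGT on a probability space. Call `0` of the aggregation procedure
produces `d_0`, call `k ≥ 1` produces `g_k`. -/
structure Run (ag : ∀ i, Agent d (S i) (A i)) (γ η α : ℝ) (θ₀ : Par d) (Minit M H : ℕ)
    {Ω : Type*} [mΩ : MeasurableSpace Ω] (P : Measure Ω) where
  /-- `hist k` is the information available when call `k` starts. -/
  hist : Filtration ℕ mΩ
  /-- the trajectories of call `k` -/
  traj : ℕ → Ω → Trajs S A H
  /-- `who k l` is the agent whose gradient is received in the `l`-th pass of the loop of call `k` -/
  who : ℕ → ℕ → Ω → Fin n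
  /-- the point at which the gradients of call `k` are computed (`θ_0`, or the extrapolated
  point) -/
  query : ℕ → Ω → Par d
  /-- momentum vectors `d_t` -/
  dir : ℕ → Ω → Par d
  /-- iterates `θ_t` -/
  iter : ℕ → Ω → Par d
  traj_measurable : ∀ k, Measurable[hist (k + 1)] (traj k)
  /-- Given the past, the trajectories of a call are independent, those of agent `i` having law
  `p_i(·|π_{i,θ})` at the query point `θ`. -/
  traj_law : ∀ k, ∀ B : Set (Trajs S A H), MeasurableSet B →
    P⟦traj k ⁻¹' B | hist k⟧ =ᵐ[P] fun ω => (trajsLaw ag H (query k ω)).real B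
  /-- The order in which the agents deliver does not depend on the trajectories being sampled. -/
  who_measurable : ∀ k l, Measurable[hist k] (who k l)
  iter_zero : ∀ ω, iter 0 ω = θ₀
  query_zero : ∀ ω, query 0 ω = θ₀
  query_succ : ∀ t ω, query (t + 1) ω =
    iter (t + 1) ω + ((1 - η) / η) • (iter (t + 1) ω - iter t ω)
  dir_zero : ∀ ω, dir 0 ω =
    aggregate ag γ H Minit (fun l => who 0 l ω) (traj 0 ω) (query 0 ω)
  dir_succ : ∀ t ω, dir (t + 1) ω = (1 - η) • dir t ω +
    η • aggregate ag γ H M (fun l => who (t + 1) l ω) (traj (t + 1) ω) (query (t + 1) ω)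
  /-- `θ_{t+1} = θ_t + α d_t / ‖d_t‖`, with `0 / ‖0‖ = 0`. -/
  iter_succ : ∀ t ω, iter (t + 1) ω = iter t ω + α • (‖dir t ω‖⁻¹ • dir t ω)

namespace Run

variable {ag : ∀ i, Agent d (S i) (A i)} {γ η α : ℝ} {θ₀ : Par d} {Minit M H : ℕ}
  {Ω : Type*} [mΩ : MeasurableSpace Ω] {P : Measure Ω}

/-- The computation and communication times of a run. In every call, agent `i` receives the query
point at time `recv`, and then computes its gradients one after the other without pause; after the
loop, the result is returned within time `ret`. Computing one gradient on agent `i` takes at most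
`hdot i * H` seconds and every transmission at most `κ` seconds. -/
structure Timing (R : Run ag γ η α θ₀ Minit M H P) (κ : ℝ) (hdot : Fin n → ℝ) where
  /-- `recv k i`: time from the start of call `k` until agent `i` has the query point -/
  recv : ℕ → Fin n → Ω → ℝ
  /-- `comp k i j`: time agent `i` needs for its `j`-th gradient in call `k` -/
  comp : ℕ → Fin n → ℕ → Ω → ℝ
  /-- `ret k`: time for returning the result of call `k` -/
  ret : ℕ → Ω → ℝ
  recv_mem : ∀ k i ω, recv k i ω ∈ Set.Icc 0 κ
  comp_mem : ∀ k i j ω, comp k i j ω ∈ Set.Icc 0 (hdot i * H)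
  ret_mem : ∀ k ω, ret k ω ∈ Set.Icc 0 κ
  /-- an agent completes only finitely many gradients in a bounded time -/
  comp_tendsto : ∀ k i ω, Filter.Tendsto (fun m => ∑ j ∈ Finset.range m, comp k i j ω)
    Filter.atTop Filter.atTop
  /-- Gradients are received in the order in which they are completed (ties are broken
  arbitrarily): the gradient received in pass `l` is the first one to be completed among the
  next pending gradients of all agents. -/
  order : ∀ k l ω i,
    recv k (R.who k l ω) ω + ∑ j ∈ Finset.range
      (received (fun l' => R.who k l' ω) l (R.who k l ω) + 1), comp k (R.who k l ω) j ω ≤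
    recv k i ω + ∑ j ∈ Finset.range (received (fun l' => R.who k l' ω) l i + 1), comp k i j ω

namespace Timing

variable {R : Run ag γ η α θ₀ Minit M H P} {κ : ℝ} {hdot : Fin n → ℝ} (𝒯 : R.Timing κ hdot)

/-- Time, from the start of call `k`, at which the first `l` passes of its loop are over. -/
def clock (k : ℕ) (ω : Ω) : ℕ → ℝ
  | 0 => 0
  | l + 1 => 𝒯.recv k (R.who k l ω) ω + ∑ j ∈ Finset.range
      (received (fun l' => R.who k l' ω) l (R.who k l ω) + 1), 𝒯.comp k (R.who k l ω) j ω

/-- Duration of call `k`: the loop and the return of the result. -/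
def callTime (k : ℕ) (ω : Ω) : ℝ :=
  𝒯.clock k ω (passes (if k = 0 then Minit else M) (fun l => R.who k l ω)) + 𝒯.ret k ω

/-- Time after which `θ_0, …, θ_{T-1}` are available; they need the calls `0, …, T-2`. -/
def elapsed (T : ℕ) (ω : Ω) : ℝ := ∑ k ∈ Finset.range (T - 1), 𝒯.callTime k ω

end Timing

/-- The law, on `Ω × Fin T`, of the randomness of the run and an independent uniformly distributed
index in `{0, …, T-1}`. -/
def withUniformIndex (P : Measure Ω) (T : ℕ) : Measure (Ω × Fin T) :=
  P.prod (uniformOn (Set.univ : Set (Fin T)))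

end Run

end Hetero

end MaleniaNIGT

end

open MaleniaNIGT

universe u v w

/-! The proof joins a smoothness analysis of the policy gradient, a momentum argument, and a bound
on the time of one call.

Smoothness. Since all densities are positive, the laws of path prefixes under two parameters have an
explicit likelihood ratio (`Agent.lintegral_pathLaw_lik`), and expectations can be differentiated
along lines (`Agent.Regular.hasDerivAt_integral`). Scores, and likewise the quantities ∇²π/π, are
martingale differences. Orthogonality gives a sum of N scores an L² norm of order √N instead of N,
so the first, second and third order variations of the expected reward at time t grow like √(t+1),
t+1 and (t+1)². Summing against γ^t yields the truncation bias γ^H D_g, the constants L_g and σ²,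
and the constant 7 L_h (`Agent.third_le_Lh`).

Momentum. The error of d_t splits into accumulated noise (`Run.noiseSum`) and bias (`Run.drift`).
The extrapolated query point is chosen so that θ_{t+1} is the mean of θ_t and the query point with
weights 1-η and η. First-order terms of the gradient therefore cancel, and the bias is of order L_h
α²/η² plus truncation (`Run.norm_drift_le`). Given the past, the order of arrival is fixed, and the
harmonic-mean stopping rule is exactly what bounds the variance of a call by σ²/M'
(`integral_norm_add_aggregate_sq_le`). A normalized step loses at most twice the momentum error, and
telescoping gives `Run.sum_integral_norm_objGrad_le`.

Time. One pass before the end the stopping rule still fails, and every agent's next pending gradient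
is completed no earlier than the last one received. This bounds a call by 2κ + H(ḣ_n +
2·mean(ḣ)·M'/n) (`Run.Timing.callTime_le`).

Parameters. About A steps suffice: the choice M ≥ B/A keeps the contribution of 1/η below a multiple
of A, while the total batch M_init + TM stays of order A + B. The horizon is O(Λ/(1-γ))
(`Consts.exists_horizon`). If L_gΔ/ε² ≤ 1/2, then θ_0 is already accurate and no call is needed. -/

noncomputable section

namespace MaleniaNIGT

/-! ### Change of measure between the path laws of two policies. -/

namespace Agent
variable {d : ℕ} {S A : Type*} [MeasurableSpace S] [MeasurableSpace A] (a : Agent d S A)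

theorem lintegral_policy (θ : Par d) (s : S) {f : A → ℝ≥0∞} (hf : Measurable f) :
    ∫⁻ b, f b ∂(a.policy θ s) = ∫⁻ b, ENNReal.ofReal (a.dens θ s b) * f b ∂a.ref := by
  have hm : Measurable (Function.uncurry (fun s b => ENNReal.ofReal (a.dens θ s b))) :=
    (a.dens_measurable θ).ennreal_ofReal
  rw [policy, Kernel.lintegral_withDensity _ hm s hf]
  rfl

/-- Likelihood ratio of one action. -/
def ratio (θ' θ : Par d) (x : S × A) : ℝ := a.dens θ x.1 x.2 / a.dens θ' x.1 x.2

/-- Likelihood ratio of the first `N` state-action pairs. -/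
def lik (θ' θ : Par d) (N : ℕ) (ω : ℕ → S × A) : ℝ := ∏ k ∈ Finset.range N, a.ratio θ' θ (ω k)

theorem measurable_ratio (θ' θ : Par d) : Measurable (a.ratio θ' θ) :=
  (a.dens_measurable θ).div (a.dens_measurable θ')

theorem ratio_nonneg (θ' θ : Par d) (x : S × A) : 0 ≤ a.ratio θ' θ x :=
  div_nonneg (a.dens_nonneg _ _ _) (a.dens_nonneg _ _ _)

theorem measurable_lik (θ' θ : Par d) (N : ℕ) : Measurable (a.lik θ' θ N) :=
  Finset.measurable_prod _ fun k _ => (a.measurable_ratio θ' θ).comp (measurable_pi_apply k)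

theorem lik_nonneg (θ' θ : Par d) (N : ℕ) (ω : ℕ → S × A) : 0 ≤ a.lik θ' θ N ω :=
  Finset.prod_nonneg fun _ _ => a.ratio_nonneg _ _ _

/-- Positivity of the density at `θ'` lets it cancel, so the policies are mutually absolutely
continuous. The two lemmas below lift this to one transition and to the initial pair. -/
theorem lintegral_policy_ratio (h : ∀ θ s b, 0 < a.dens θ s b) (θ' θ : Par d) (s : S)
    {f : A → ℝ≥0∞} (hf : Measurable f) :
    ∫⁻ b, f b ∂(a.policy θ s) =
      ∫⁻ b, ENNReal.ofReal (a.ratio θ' θ (s, b)) * f b ∂(a.policy θ' s) := by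
  have hr : Measurable fun b => ENNReal.ofReal (a.ratio θ' θ (s, b)) :=
    ((a.measurable_ratio θ' θ).comp measurable_prodMk_left).ennreal_ofReal
  have hrf : Measurable fun b => ENNReal.ofReal (a.ratio θ' θ (s, b)) * f b := hr.mul hf
  rw [lintegral_policy a θ s hf, lintegral_policy a θ' s hrf]
  refine lintegral_congr fun b => ?_
  rw [← mul_assoc, ← ENNReal.ofReal_mul (a.dens_nonneg _ _ _), ratio,
    mul_div_cancel₀ _ (h θ' s b).ne']

theorem lintegral_step_ratio (h : ∀ θ s b, 0 < a.dens θ s b) (θ' θ : Par d) (x : S × A)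
    {f : S × A → ℝ≥0∞} (hf : Measurable f) :
    ∫⁻ z, f z ∂(a.step θ x) = ∫⁻ z, ENNReal.ofReal (a.ratio θ' θ z) * f z ∂(a.step θ' x) := by
  have hrf : Measurable fun z => ENNReal.ofReal (a.ratio θ' θ z) * f z :=
    (a.measurable_ratio θ' θ).ennreal_ofReal.mul hf
  rw [step, step, Kernel.lintegral_compProd _ _ _ hf, Kernel.lintegral_compProd _ _ _ hrf]
  refine lintegral_congr fun s => ?_
  simp only [Kernel.prodMkLeft_apply]
  exact a.lintegral_policy_ratio h θ' θ s (hf.comp measurable_prodMk_left)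

theorem lintegral_initial_ratio (h : ∀ θ s b, 0 < a.dens θ s b) (θ' θ : Par d)
    {f : S × A → ℝ≥0∞} (hf : Measurable f) :
    ∫⁻ z, f z ∂(a.init ⊗ₘ a.policy θ) =
      ∫⁻ z, ENNReal.ofReal (a.ratio θ' θ z) * f z ∂(a.init ⊗ₘ a.policy θ') := by
  have hrf : Measurable fun z => ENNReal.ofReal (a.ratio θ' θ z) * f z :=
    (a.measurable_ratio θ' θ).ennreal_ofReal.mul hf
  rw [Measure.lintegral_compProd hf, Measure.lintegral_compProd hrf]
  refine lintegral_congr fun s => ?_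
  exact a.lintegral_policy_ratio h θ' θ s (hf.comp measurable_prodMk_left)

theorem map_eval_zero_pathLaw (θ : Par d) :
    (a.pathLaw θ).map (fun ω => ω 0) = a.init ⊗ₘ a.policy θ := by
  have h1 : (fun ω : ℕ → S × A => ω 0) =
      (fun x : (i : Finset.Iic 0) → (fun _ : ℕ => S × A) i => x ⟨0, by simp⟩) ∘
        Preorder.frestrictLe 0 := rfl
  rw [h1, ← Measure.map_map (measurable_pi_apply _) (by fun_prop), pathLaw, Kernel.trajMeasure,
    Measure.map_comp _ _ (by fun_prop), Kernel.traj_map_frestrictLe, Kernel.partialTraj_self,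
    Measure.id_comp, Measure.map_map (measurable_pi_apply _) (by fun_prop)]
  exact Measure.map_id

/-- Extend a history by a constant. -/
def extendHist {X : Type*} (t : ℕ) (x : (i : Finset.Iic t) → (fun _ : ℕ => X) i) (z : X) : ℕ → X :=
  fun k => if h : k ≤ t then x ⟨k, Finset.mem_Iic.2 h⟩ else z

theorem measurable_extendHist {X : Type*} [MeasurableSpace X] (t : ℕ) :
    Measurable fun p : ((i : Finset.Iic t) → (fun _ : ℕ => X) i) × X =>
      extendHist t p.1 p.2 := by
  refine measurable_pi_iff.2 fun k => ?_
  by_cases h : k ≤ t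
  · simp only [extendHist, h, dif_pos]
    exact (measurable_pi_apply _).comp measurable_fst
  · simp only [extendHist, h, dif_neg, not_false_eq_true]
    exact measurable_snd

/-- The Markov property: the pair at time `t + 1` is integrated out given the history up to `t`. `F`
may use the coordinates `0, …, t + 1`, hence the bound `t + 2`. -/
theorem lintegral_pathLaw_succ (θ : Par d) (t : ℕ) {F : (ℕ → S × A) → ℝ≥0∞} (hF : Measurable F)
    (hd : DependsOn F (Set.Iio (t + 2))) :
    ∫⁻ ω, F ω ∂(a.pathLaw θ) = ∫⁻ ω, ∫⁻ z, F (extendHist t (Preorder.frestrictLe t ω) z)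
      ∂(a.step θ (ω t)) ∂(a.pathLaw θ) := by
  have key := Kernel.map_frestrictLe_trajMeasure_compProd_eq_map_trajMeasure
    (X := fun _ : ℕ => S × A) (μ₀ := a.init ⊗ₘ a.policy θ) (κ := a.histStep θ) (a := t)
  have hG : Measurable fun p : ((i : Finset.Iic t) → (fun _ : ℕ => S × A) i) × (S × A) =>
      F (extendHist t p.1 p.2) := hF.comp (measurable_extendHist t)
  have h1 : ∫⁻ ω, F ω ∂(a.pathLaw θ) = ∫⁻ p, F (extendHist t p.1 p.2)
      ∂((a.pathLaw θ).map fun x => (Preorder.frestrictLe t x, x (t + 1))) := by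
    rw [lintegral_map hG (by fun_prop)]
    refine lintegral_congr fun ω => hd fun k hk => ?_
    rcases Nat.lt_or_ge t k with h | h
    · obtain rfl : k = t + 1 := by have := Set.mem_Iio.1 hk; omega
      simp [extendHist]
    · simp [extendHist, h]
  rw [h1, pathLaw, ← key, Measure.lintegral_compProd hG, lintegral_map]
  · rfl
  · exact hG.lintegral_kernel_prod_right'
  · fun_prop

/-- Change of measure for functions of the first `N` state-action pairs. -/
theorem lintegral_pathLaw_lik (h : ∀ θ s b, 0 < a.dens θ s b) (θ' θ : Par d) (N : ℕ)
    {F : (ℕ → S × A) → ℝ≥0∞} (hF : Measurable F) (hd : DependsOn F (Set.Iio N)) :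
    ∫⁻ ω, F ω ∂(a.pathLaw θ) =
      ∫⁻ ω, ENNReal.ofReal (a.lik θ' θ N ω) * F ω ∂(a.pathLaw θ') := by
  have dep : ∀ N, DependsOn (fun ω => ENNReal.ofReal (a.lik θ' θ N ω)) (Set.Iio N) := by
    intro N ω ω' hω
    simp only [lik]
    congr 1
    exact Finset.prod_congr rfl fun k hk => by rw [hω k (Finset.mem_range.1 hk)]
  induction N generalizing F with
  | zero =>
    -- With no coordinates to depend on, `F` is constant and both laws have mass one.
    have hc : ∀ ω ω', F ω = F ω' := fun ω ω' => hd (by simp)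
    simp only [lik, Finset.range_zero, Finset.prod_empty, ENNReal.ofReal_one, one_mul]
    rcases isEmpty_or_nonempty (ℕ → S × A) with he | ⟨⟨ω₀⟩⟩
    · simp [Measure.eq_zero_of_isEmpty]
    · rw [lintegral_congr fun ω => hc ω ω₀,
        lintegral_congr (μ := a.pathLaw θ') fun ω => hc ω ω₀]
      simp
  | succ t ih =>
    rcases t with _ | t
    · have hX : ∀ ω, F ω = F (fun _ => ω 0) := fun ω => hd fun k hk => by
        obtain rfl : k = 0 := by have := Set.mem_Iio.1 hk; omega
        rfl
      have hF' : Measurable fun x : S × A => F (fun _ => x) :=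
        hF.comp (measurable_pi_iff.2 fun _ => measurable_id)
      have e1 : ∫⁻ ω, F ω ∂(a.pathLaw θ) = ∫⁻ x, F (fun _ => x) ∂(a.init ⊗ₘ a.policy θ) := by
        rw [← map_eval_zero_pathLaw, lintegral_map hF' (measurable_pi_apply 0)]
        exact lintegral_congr hX
      have hrf : Measurable fun z => ENNReal.ofReal (a.ratio θ' θ z) * F (fun _ => z) :=
        (a.measurable_ratio θ' θ).ennreal_ofReal.mul hF'
      rw [e1, a.lintegral_initial_ratio h θ' θ hF', ← map_eval_zero_pathLaw,
        lintegral_map hrf (measurable_pi_apply 0)]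
      refine lintegral_congr fun ω => ?_
      rw [hX ω]
      simp [lik]
    · have hFe : Measurable fun p : (ℕ → S × A) × (S × A) =>
          F (extendHist t (Preorder.frestrictLe t p.1) p.2) :=
        (hF.comp (measurable_extendHist t)).comp (f := fun p : (ℕ → S × A) × (S × A) =>
          (Preorder.frestrictLe (π := fun _ => S × A) t p.1, p.2)) (by fun_prop)
      have hagree : ∀ (ω ω' : ℕ → S × A) z, (∀ i ∈ Set.Iio (t + 1), ω i = ω' i) →
          extendHist t (Preorder.frestrictLe t ω) z = extendHist t (Preorder.frestrictLe t ω') z := by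
        intro ω ω' z hω
        funext k
        by_cases hk : k ≤ t
        · simpa [extendHist, hk] using hω k (Set.mem_Iio.2 (by omega))
        · simp [extendHist, hk]
      have hmeasI : ∀ φ : S × A → ℝ≥0∞, Measurable φ → Measurable fun ω : ℕ → S × A =>
          ∫⁻ z, φ z * F (extendHist t (Preorder.frestrictLe t ω) z) ∂(a.step θ' (ω t)) := by
        intro φ hφ
        exact Measurable.lintegral_kernel_prod_right
          (κ := (a.step θ').comap (fun ω : ℕ → S × A => ω t) (measurable_pi_apply t))
          (f := fun ω z => φ z * F (extendHist t (Preorder.frestrictLe t ω) z))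
          ((hφ.comp measurable_snd).mul hFe)
      rw [a.lintegral_pathLaw_succ θ t hF hd]
      have e1 : ∀ ω : ℕ → S × A, ∫⁻ z, F (extendHist t (Preorder.frestrictLe t ω) z)
          ∂(a.step θ (ω t)) = ∫⁻ z, ENNReal.ofReal (a.ratio θ' θ z) *
            F (extendHist t (Preorder.frestrictLe t ω) z) ∂(a.step θ' (ω t)) := fun ω =>
        a.lintegral_step_ratio h θ' θ _ (hFe.comp measurable_prodMk_left)
      -- After the last transition is rewritten under `θ'`, the inner integral depends only on the
      -- pairs `0, …, t`. The induction hypothesis changes the outer law, and the Markov property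
      -- under `θ'`, read backwards, reassembles all `t + 2` ratios.
      rw [lintegral_congr e1, ih (hmeasI _ (a.measurable_ratio θ' θ).ennreal_ofReal),
        a.lintegral_pathLaw_succ θ' t (F := fun ω => ENNReal.ofReal (a.lik θ' θ (t + 2) ω) * F ω)
          ((a.measurable_lik θ' θ _).ennreal_ofReal.mul hF)]
      · refine lintegral_congr fun ω => ?_
        rw [← lintegral_const_mul]
        · refine lintegral_congr fun z => ?_
          rw [← mul_assoc, ← ENNReal.ofReal_mul (a.lik_nonneg _ _ _ _)]
          congr 2
          rw [lik, lik, Finset.prod_range_succ (n := t + 1)]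
          congr 1
          · exact Finset.prod_congr rfl fun k hk => by
              have : k ≤ t := by have := Finset.mem_range.1 hk; omega
              simp [extendHist, this]
          · simp [extendHist]
        · exact (a.measurable_ratio θ' θ).ennreal_ofReal.mul (hFe.comp measurable_prodMk_left)
      · intro ω ω' hω
        exact congrArg₂ (· * ·) (dep _ hω) (hd hω)
      · intro ω ω' hω
        simp only
        rw [hω t (Set.mem_Iio.2 (by omega))]
        refine lintegral_congr fun z => ?_
        rw [hagree ω ω' z hω]

/-- The law of `F` under `θ` equals its law under the reweighted `θ'`-measure. Comparing these two
laws on the real line avoids any integrability assumption. -/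
theorem integral_pathLaw_lik (h : ∀ θ s b, 0 < a.dens θ s b) (θ' θ : Par d) (N : ℕ)
    {F : (ℕ → S × A) → ℝ} (hF : Measurable F) (hd : DependsOn F (Set.Iio N)) :
    ∫ ω, F ω ∂(a.pathLaw θ) = ∫ ω, a.lik θ' θ N ω * F ω ∂(a.pathLaw θ') := by
  have hmap : (a.pathLaw θ).map F =
      ((a.pathLaw θ').withDensity (fun ω => ENNReal.ofReal (a.lik θ' θ N ω))).map F := by
    refine Measure.ext fun B hB => ?_
    rw [Measure.map_apply hF hB, Measure.map_apply hF hB, withDensity_apply _ (hF hB),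
      ← lintegral_indicator_one (hF hB), a.lintegral_pathLaw_lik h θ' θ N
        (measurable_one.indicator (hF hB)), ← lintegral_indicator (hF hB)]
    · refine lintegral_congr fun ω => ?_
      by_cases hω : ω ∈ F ⁻¹' B <;> simp [hω]
    · intro ω ω' hω
      have : (ω ∈ F ⁻¹' B) = (ω' ∈ F ⁻¹' B) := by simp [Set.mem_preimage, hd hω]
      by_cases h' : ω' ∈ F ⁻¹' B
      · have h'' : ω ∈ F ⁻¹' B := by rw [this]; exact h'
        simp [h', h'']
      · have h'' : ω ∉ F ⁻¹' B := by rw [this]; exact h'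
        simp [h', h'']
  have e := fun μ : Measure (ℕ → S × A) => integral_map (μ := μ) hF.aemeasurable
    (f := fun x : ℝ => x) measurable_id.aestronglyMeasurable
  rw [← e, hmap, e,
    integral_withDensity_eq_integral_toReal_smul (a.measurable_lik θ' θ N).ennreal_ofReal
      (by simp)]
  simp [ENNReal.toReal_ofReal (a.lik_nonneg _ _ _ _)]

end Agent

/-! ### Bounded functionals of a path prefix. -/

/-- Bounded measurable functions of the first `N` coordinates of a sequence. -/
structure BddAdapted {X : Type*} [MeasurableSpace X] (N : ℕ) (F : (ℕ → X) → ℝ) : Prop where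
  meas : Measurable F
  dep : DependsOn F (Set.Iio N)
  bdd : ∃ K, ∀ ω, |F ω| ≤ K

namespace BddAdapted

variable {X : Type*} [MeasurableSpace X] {N : ℕ} {F G : (ℕ → X) → ℝ}

theorem const (N : ℕ) (x : ℝ) : BddAdapted (X := X) N fun _ => x :=
  ⟨measurable_const, fun _ _ _ => rfl, |x|, fun _ => le_rfl⟩

theorem mono {M : ℕ} (h : N ≤ M) (hF : BddAdapted N F) : BddAdapted M F :=
  ⟨hF.meas, hF.dep.mono (Set.Iio_subset_Iio h), hF.bdd⟩

theorem add (hF : BddAdapted N F) (hG : BddAdapted N G) : BddAdapted N fun ω => F ω + G ω := by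
  obtain ⟨K, hK⟩ := hF.bdd
  obtain ⟨L, hL⟩ := hG.bdd
  refine ⟨hF.meas.add hG.meas, fun ω ω' h => ?_, K + L, fun ω => ?_⟩
  · simp only [hF.dep h, hG.dep h]
  · exact (abs_add_le _ _).trans (add_le_add (hK ω) (hL ω))

theorem mul (hF : BddAdapted N F) (hG : BddAdapted N G) : BddAdapted N fun ω => F ω * G ω := by
  obtain ⟨K, hK⟩ := hF.bdd
  obtain ⟨L, hL⟩ := hG.bdd
  refine ⟨hF.meas.mul hG.meas, fun ω ω' h => ?_, K * L, fun ω => ?_⟩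
  · simp only [hF.dep h, hG.dep h]
  · rw [abs_mul]
    exact mul_le_mul (hK ω) (hL ω) (abs_nonneg _) ((abs_nonneg _).trans (hK ω))

theorem abs (hF : BddAdapted N F) : BddAdapted N fun ω => |F ω| := by
  obtain ⟨K, hK⟩ := hF.bdd
  exact ⟨hF.meas.abs, fun ω ω' h => by simp only [hF.dep h], K, fun ω => by simpa using hK ω⟩

theorem sub (hF : BddAdapted N F) (hG : BddAdapted N G) : BddAdapted N fun ω => F ω - G ω := by
  have := hF.add ((const N (-1)).mul hG)
  simpa [sub_eq_add_neg] using this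

theorem eval {q : X → ℝ} (hq : Measurable q) {K : ℝ} (hK : ∀ x, |q x| ≤ K) {k : ℕ} (hk : k < N) :
    BddAdapted N fun ω => q (ω k) :=
  ⟨hq.comp (measurable_pi_apply k), fun ω ω' h => by simp only [h k hk], K, fun ω => hK _⟩

theorem sum {ι : Type*} (s : Finset ι) {f : ι → (ℕ → X) → ℝ} (h : ∀ i ∈ s, BddAdapted N (f i)) :
    BddAdapted N fun ω => ∑ i ∈ s, f i ω := by
  classical
  induction s using Finset.induction_on with
  | empty => simpa using const N 0
  | insert i s hi ih =>
    simp only [Finset.sum_insert hi]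
    exact (h i (by simp)).add (ih fun j hj => h j (by simp [hj]))

theorem integrable (hF : BddAdapted N F) (μ : Measure (ℕ → X)) [IsFiniteMeasure μ] :
    Integrable F μ := by
  obtain ⟨K, hK⟩ := hF.bdd
  exact Integrable.of_bound hF.meas.aestronglyMeasurable K (Filter.Eventually.of_forall hK)

end BddAdapted

/-! ### Scores, Hessians of log-densities, and differentiation of expectations. -/

namespace Agent
variable {d : ℕ} {S A : Type*} [MeasurableSpace S] [MeasurableSpace A] {a : Agent d S A}
  {c : Consts}

variable (a) in
/-- Directional derivative `⟨∇ log π_θ, u⟩`. -/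
def score (θ u : Par d) (x : S × A) : ℝ := inner ℝ (∇ (a.logDens x.1 x.2) θ) u

variable (a) in
/-- Second directional derivative `∇² log π_θ (u, v)`. -/
def hess (θ u v : Par d) (x : S × A) : ℝ :=
  inner ℝ (fderiv ℝ (∇ (a.logDens x.1 x.2)) θ u) v

variable (a) in
/-- Sum of the scores of the first `N` actions. -/
def scoreSum (θ u : Par d) (N : ℕ) (ω : ℕ → S × A) : ℝ :=
  ∑ k ∈ Finset.range N, a.score θ u (ω k)

variable (a) in
/-- Sum of the second derivatives of the first `N` log-densities. -/
def hessSum (θ u v : Par d) (N : ℕ) (ω : ℕ → S × A) : ℝ :=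
  ∑ k ∈ Finset.range N, a.hess θ u v (ω k)

theorem Regular.contDiff_logDens (ha : a.Regular c) (s : S) (b : A) :
    ContDiff ℝ 2 (a.logDens s b) :=
  (ha.dens_contDiff s b).log fun θ => (ha.dens_pos θ s b).ne'

theorem Regular.contDiff_gradient (ha : a.Regular c) (s : S) (b : A) :
    ContDiff ℝ 1 (∇ (a.logDens s b)) := by
  have h1 : ContDiff ℝ 1 (fderiv ℝ (a.logDens s b)) :=
    (ha.contDiff_logDens s b).fderiv_right (by norm_num)
  exact (InnerProductSpace.toDual ℝ (Par d)).symm.toContinuousLinearEquiv.contDiff.comp h1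

theorem hasDerivAt_line (θ w : Par d) (s : ℝ) : HasDerivAt (fun s : ℝ => θ + s • w) w s := by
  simpa using ((hasDerivAt_id s).smul_const w).const_add θ

theorem Regular.hasDerivAt_logDens (ha : a.Regular c) (θ w : Par d) (x : S × A) (s : ℝ) :
    HasDerivAt (fun s : ℝ => a.logDens x.1 x.2 (θ + s • w)) (a.score (θ + s • w) w x) s := by
  have h1 : HasFDerivAt (a.logDens x.1 x.2) _ (θ + s • w) :=
    (((ha.contDiff_logDens x.1 x.2).differentiable (by norm_num)) _).hasGradientAt.hasFDerivAt
  have := h1.comp_hasDerivAt s (hasDerivAt_line θ w s)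
  rwa [InnerProductSpace.toDual_apply_apply] at this

theorem Regular.hasDerivAt_score (ha : a.Regular c) (θ w v : Par d) (x : S × A) (s : ℝ) :
    HasDerivAt (fun s : ℝ => a.score (θ + s • w) v x) (a.hess (θ + s • w) w v x) s := by
  have h1 := (((ha.contDiff_gradient x.1 x.2).differentiable (by norm_num)) (θ + s • w)).hasFDerivAt
  have := (h1.comp_hasDerivAt s (hasDerivAt_line θ w s)).inner ℝ (hasDerivAt_const s v)
  simpa [score, hess] using this

theorem Regular.abs_score_le (ha : a.Regular c) (θ u : Par d) (x : S × A) :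
    |a.score θ u x| ≤ c.Mg * ‖u‖ :=
  (abs_real_inner_le_norm _ _).trans
    (mul_le_mul_of_nonneg_right (ha.grad_le _ _ _) (norm_nonneg _))

theorem Regular.abs_hess_le (ha : a.Regular c) (θ u v : Par d) (x : S × A) :
    |a.hess θ u v x| ≤ c.Mh * ‖u‖ * ‖v‖ :=
  (abs_real_inner_le_norm _ _).trans (mul_le_mul_of_nonneg_right
    ((ContinuousLinearMap.le_opNorm _ _).trans
      (mul_le_mul_of_nonneg_right (ha.hess_le _ _ _) (norm_nonneg _))) (norm_nonneg _))

theorem Regular.abs_hess_sub_le (ha : a.Regular c) (θ θ' u v : Par d) (x : S × A) :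
    |a.hess θ u v x - a.hess θ' u v x| ≤ c.l2 * ‖θ - θ'‖ * ‖u‖ * ‖v‖ := by
  rw [hess, hess, ← inner_sub_left, ← _root_.sub_apply]
  exact (abs_real_inner_le_norm _ _).trans (mul_le_mul_of_nonneg_right
    ((ContinuousLinearMap.le_opNorm _ _).trans
      (mul_le_mul_of_nonneg_right (ha.hess_lip _ _ _ _) (norm_nonneg _))) (norm_nonneg _))

/-- The derivative at `0` of a family of measurable functions is measurable. -/
theorem measurable_of_hasDerivAt_zero {X : Type*} [MeasurableSpace X] {f : ℝ → X → ℝ} {f' : X → ℝ}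
    (hf : ∀ s, Measurable (f s)) (h : ∀ x, HasDerivAt (fun s => f s x) (f' x) 0) :
    Measurable f' := by
  -- The derivative is the pointwise limit of the difference quotients at `1 / (n + 1)`.
  refine measurable_of_tendsto_metrizable (f := fun (n : ℕ) x =>
    ((n : ℝ) + 1) * (f (1 / ((n : ℝ) + 1)) x - f 0 x)) (fun n => ((hf _).sub (hf 0)).const_mul _)
    (tendsto_pi_nhds.2 fun x => ?_)
  have h1 := (hasDerivAt_iff_tendsto_slope_zero.1 (h x))
  have h2 : Filter.Tendsto (fun n : ℕ => 1 / ((n : ℝ) + 1)) Filter.atTop (nhdsWithin 0 {0}ᶜ) :=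
    tendsto_nhdsWithin_iff.2 ⟨tendsto_one_div_add_atTop_nhds_zero_nat,
      Filter.Eventually.of_forall fun n => by
        simp only [Set.mem_compl_iff, Set.mem_singleton_iff]; positivity⟩
  simpa [Function.comp_def] using h1.comp h2

variable (a) in
theorem measurable_logDens (θ : Par d) : Measurable fun x : S × A => a.logDens x.1 x.2 θ :=
  (a.dens_measurable θ).log

theorem Regular.measurable_score (ha : a.Regular c) (θ u : Par d) : Measurable (a.score θ u) :=
  measurable_of_hasDerivAt_zero (f := fun s x => a.logDens x.1 x.2 (θ + s • u))
    (fun _ => a.measurable_logDens _) fun x => by simpa using ha.hasDerivAt_logDens θ u x 0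

theorem Regular.measurable_hess (ha : a.Regular c) (θ u v : Par d) : Measurable (a.hess θ u v) :=
  measurable_of_hasDerivAt_zero (f := fun s x => a.score (θ + s • u) v x)
    (fun _ => ha.measurable_score _ _) fun x => by simpa using ha.hasDerivAt_score θ u v x 0

theorem Regular.score_eval (ha : a.Regular c) (θ u : Par d) {k N : ℕ} (h : k < N) :
    BddAdapted N fun ω => a.score θ u (ω k) :=
  .eval (ha.measurable_score θ u) (ha.abs_score_le θ u) h

theorem Regular.hess_eval (ha : a.Regular c) (θ u v : Par d) {k N : ℕ} (h : k < N) :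
    BddAdapted N fun ω => a.hess θ u v (ω k) :=
  .eval (ha.measurable_hess θ u v) (ha.abs_hess_le θ u v) h

theorem Regular.scoreSum_adapted (ha : a.Regular c) (θ u : Par d) (N : ℕ) :
    BddAdapted N (a.scoreSum θ u N) :=
  .sum _ fun _ hk => ha.score_eval θ u (Finset.mem_range.1 hk)

theorem Regular.hessSum_adapted (ha : a.Regular c) (θ u v : Par d) (N : ℕ) :
    BddAdapted N (a.hessSum θ u v N) :=
  .sum _ fun _ hk => ha.hess_eval θ u v (Finset.mem_range.1 hk)

theorem abs_sum_range_le {N : ℕ} {f : ℕ → ℝ} {K : ℝ} (h : ∀ k, |f k| ≤ K) :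
    |∑ k ∈ Finset.range N, f k| ≤ N * K := by
  refine (Finset.abs_sum_le_sum_abs _ _).trans ((Finset.sum_le_sum fun k _ => h k).trans ?_)
  simp

theorem Regular.abs_scoreSum_le (ha : a.Regular c) (θ u : Par d) (N : ℕ) (ω : ℕ → S × A) :
    |a.scoreSum θ u N ω| ≤ N * (c.Mg * ‖u‖) :=
  abs_sum_range_le fun _ => ha.abs_score_le _ _ _

theorem Regular.abs_hessSum_le (ha : a.Regular c) (θ u v : Par d) (N : ℕ) (ω : ℕ → S × A) :
    |a.hessSum θ u v N ω| ≤ N * (c.Mh * ‖u‖ * ‖v‖) :=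
  abs_sum_range_le fun _ => ha.abs_hess_le _ _ _ _

theorem Regular.abs_hessSum_sub_le (ha : a.Regular c) (θ θ' u v : Par d) (N : ℕ)
    (ω : ℕ → S × A) : |a.hessSum θ u v N ω - a.hessSum θ' u v N ω| ≤
      N * (c.l2 * ‖θ - θ'‖ * ‖u‖ * ‖v‖) := by
  rw [hessSum, hessSum, ← Finset.sum_sub_distrib]
  exact abs_sum_range_le fun _ => ha.abs_hess_sub_le _ _ _ _ _

theorem Regular.hasDerivAt_scoreSum (ha : a.Regular c) (θ w v : Par d) (N : ℕ) (ω : ℕ → S × A)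
    (s : ℝ) : HasDerivAt (fun s : ℝ => a.scoreSum (θ + s • w) v N ω)
      (a.hessSum (θ + s • w) w v N ω) s :=
  HasDerivAt.fun_sum fun k _ => ha.hasDerivAt_score θ w v (ω k) s

/-- In exponential form the logarithmic derivative of the likelihood ratio is visibly the sum of
scores. -/
theorem Regular.lik_eq (ha : a.Regular c) (θ' θ : Par d) (N : ℕ) (ω : ℕ → S × A) :
    a.lik θ' θ N ω = Real.exp (∑ k ∈ Finset.range N,
      (a.logDens (ω k).1 (ω k).2 θ - a.logDens (ω k).1 (ω k).2 θ')) := by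
  rw [Real.exp_sum, lik]
  refine Finset.prod_congr rfl fun k _ => ?_
  rw [Real.exp_sub, logDens, logDens, Real.exp_log (ha.dens_pos _ _ _),
    Real.exp_log (ha.dens_pos _ _ _), ratio]

theorem Regular.hasDerivAt_lik (ha : a.Regular c) (θ' θ w : Par d) (N : ℕ) (ω : ℕ → S × A)
    (s : ℝ) : HasDerivAt (fun s : ℝ => a.lik θ' (θ + s • w) N ω)
      (a.lik θ' (θ + s • w) N ω * a.scoreSum (θ + s • w) w N ω) s := by
  simp only [ha.lik_eq]
  refine HasDerivAt.exp (HasDerivAt.fun_sum fun k _ => ?_)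
  exact (ha.hasDerivAt_logDens θ w (ω k) s).sub_const _

theorem Regular.lik_self (ha : a.Regular c) (θ : Par d) (N : ℕ) (ω : ℕ → S × A) :
    a.lik θ θ N ω = 1 := by
  simp [ha.lik_eq]

/-- The mean value inequality for each log-density. On a unit neighbourhood this dominates the
likelihood ratio uniformly in the path, as differentiation under the integral requires. -/
theorem Regular.lik_line_le (ha : a.Regular c) (θ w : Par d) (N : ℕ) (ω : ℕ → S × A) (s t : ℝ) :
    a.lik (θ + s • w) (θ + t • w) N ω ≤ Real.exp (N * (c.Mg * ‖w‖ * |t - s|)) := by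
  rw [ha.lik_eq, Real.exp_le_exp]
  refine (le_abs_self _).trans (abs_sum_range_le fun k => ?_)
  have := Convex.norm_image_sub_le_of_norm_hasDerivWithin_le (s := Set.univ) (x := s) (y := t)
    (f := fun s : ℝ => a.logDens (ω k).1 (ω k).2 (θ + s • w)) (C := c.Mg * ‖w‖)
    (fun s _ => (ha.hasDerivAt_logDens θ w (ω k) s).hasDerivWithinAt)
    (fun s _ => ha.abs_score_le _ _ _) convex_univ (Set.mem_univ _) (Set.mem_univ _)
  simpa using this

/-- Differentiation of an expectation along a line in the parameter space. -/
theorem Regular.hasDerivAt_integral (ha : a.Regular c) (θ w : Par d) {N : ℕ}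
    {F F' : ℝ → (ℕ → S × A) → ℝ} {K K' : ℝ} (hFm : ∀ s, Measurable (F s))
    (hFd : ∀ s, DependsOn (F s) (Set.Iio N)) (hF'm : ∀ s, Measurable (F' s))
    (hF : ∀ s ω, HasDerivAt (fun s => F s ω) (F' s ω) s) (hK : ∀ s ω, |F s ω| ≤ K)
    (hK' : ∀ s ω, |F' s ω| ≤ K') (s : ℝ) :
    HasDerivAt (fun s => ∫ ω, F s ω ∂(a.pathLaw (θ + s • w)))
      (∫ ω, (a.scoreSum (θ + s • w) w N ω * F s ω + F' s ω) ∂(a.pathLaw (θ + s • w))) s := by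
  -- All expectations are transported to the fixed law at `θ + s • w`, so that the parameter `t`
  -- only enters the integrand.
  have e1 : (fun t => ∫ ω, F t ω ∂(a.pathLaw (θ + t • w))) = fun t =>
      ∫ ω, a.lik (θ + s • w) (θ + t • w) N ω * F t ω ∂(a.pathLaw (θ + s • w)) := by
    funext t
    exact a.integral_pathLaw_lik ha.dens_pos _ _ N (hFm t) (hFd t)
  have e2 : ∫ ω, (a.scoreSum (θ + s • w) w N ω * F s ω + F' s ω) ∂(a.pathLaw (θ + s • w)) =
      ∫ ω, (a.lik (θ + s • w) (θ + s • w) N ω * a.scoreSum (θ + s • w) w N ω * F s ω +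
        a.lik (θ + s • w) (θ + s • w) N ω * F' s ω) ∂(a.pathLaw (θ + s • w)) := by
    simp [ha.lik_self]
  rw [e1, e2]
  set L : ℝ := Real.exp (N * (c.Mg * ‖w‖)) with hL
  -- No sign of `c.Mg` is assumed here. It follows from the score bound as soon as one path exists,
  -- and otherwise the pointwise bounds are vacuous.
  have hMg : 0 ≤ c.Mg * ‖w‖ ∨ IsEmpty (ℕ → S × A) := by
    rcases isEmpty_or_nonempty (ℕ → S × A) with h | ⟨⟨ω⟩⟩
    · exact .inr h
    · exact .inl ((abs_nonneg _).trans (ha.abs_score_le θ w (ω 0)))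
  have hlik : ∀ t ∈ Metric.ball s 1, ∀ ω, |a.lik (θ + s • w) (θ + t • w) N ω| ≤ L := by
    intro t ht ω
    rw [abs_of_nonneg (a.lik_nonneg _ _ _ _)]
    refine (ha.lik_line_le θ w N ω s t).trans (Real.exp_le_exp.2 ?_)
    have h1 : |t - s| ≤ 1 := (Metric.mem_ball.1 ht).le
    have h2 : 0 ≤ c.Mg * ‖w‖ := hMg.resolve_right fun h => h.elim ω
    exact mul_le_mul_of_nonneg_left (mul_le_of_le_one_right h2 h1) (Nat.cast_nonneg _)
  have hmeas : ∀ t, Measurable fun ω => a.lik (θ + s • w) (θ + t • w) N ω * F t ω := fun t =>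
    (a.measurable_lik _ _ _).mul (hFm t)
  refine (hasDerivAt_integral_of_dominated_loc_of_deriv_le
    (bound := fun _ => L * (N * (c.Mg * ‖w‖)) * K + L * K')
    (F' := fun t ω => a.lik (θ + s • w) (θ + t • w) N ω * a.scoreSum (θ + t • w) w N ω * F t ω +
      a.lik (θ + s • w) (θ + t • w) N ω * F' t ω) (Metric.ball_mem_nhds s one_pos)
    (Filter.Eventually.of_forall fun t => (hmeas t).aestronglyMeasurable) ?_ ?_ ?_
    (integrable_const (μ := a.pathLaw (θ + s • w)) _) ?_).2
  · refine Integrable.of_bound (hmeas s).aestronglyMeasurable K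
      (Filter.Eventually.of_forall fun ω => ?_)
    simpa [ha.lik_self] using hK s ω
  · exact ((((a.measurable_lik _ _ _).mul (ha.scoreSum_adapted _ _ _).meas).mul (hFm s)).add
      ((a.measurable_lik _ _ _).mul (hF'm s))).aestronglyMeasurable
  · refine Filter.Eventually.of_forall fun ω t ht => ?_
    have h1 := hlik t ht ω
    have h2 := ha.abs_scoreSum_le (θ + t • w) w N ω
    have hL0 := (abs_nonneg _).trans h1
    rw [Real.norm_eq_abs]
    refine (abs_add_le _ _).trans (add_le_add ?_ ?_)
    · rw [abs_mul, abs_mul]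
      exact mul_le_mul (mul_le_mul h1 h2 (abs_nonneg _) hL0) (hK t ω) (abs_nonneg _)
        (mul_nonneg hL0 ((abs_nonneg _).trans h2))
    · rw [abs_mul]
      exact mul_le_mul h1 (hK' t ω) (abs_nonneg _) hL0
  · exact Filter.Eventually.of_forall fun ω t _ => (ha.hasDerivAt_lik _ θ w N ω t).mul (hF t ω)

end Agent

/-! ### Martingale property of the scores and moment bounds for their sums. -/

namespace Agent
variable {d : ℕ} {S A : Type*} [MeasurableSpace S] [MeasurableSpace A] {a : Agent d S A}
  {c : Consts}

theorem scoreSum_succ (θ u : Par d) (N : ℕ) (ω : ℕ → S × A) :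
    a.scoreSum θ u (N + 1) ω = a.scoreSum θ u N ω + a.score θ u (ω N) :=
  Finset.sum_range_succ _ _

theorem Regular.hasDerivAt_integral_const (ha : a.Regular c) (θ w : Par d) {N : ℕ}
    {F : (ℕ → S × A) → ℝ} (hF : BddAdapted N F) (s : ℝ) :
    HasDerivAt (fun s => ∫ ω, F ω ∂(a.pathLaw (θ + s • w)))
      (∫ ω, a.scoreSum (θ + s • w) w N ω * F ω ∂(a.pathLaw (θ + s • w))) s := by
  obtain ⟨K, hK⟩ := hF.bdd
  simpa using ha.hasDerivAt_integral θ w (F := fun _ => F) (F' := fun _ _ => 0) (K := K) (K' := 0)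
    (fun _ => hF.meas) (fun _ => hF.dep) (fun _ => measurable_const)
    (fun s ω => hasDerivAt_const s _) (fun _ => hK) (fun _ _ => by simp) s

/-- The score of an action has conditional mean zero given the past. -/
theorem Regular.integral_mul_score (ha : a.Regular c) (θ u : Par d) {k : ℕ}
    {G : (ℕ → S × A) → ℝ} (hG : BddAdapted k G) :
    ∫ ω, G ω * a.score θ u (ω k) ∂(a.pathLaw θ) = 0 := by
  -- `G` can be regarded as a function of `k` or of `k + 1` pairs. Both readings give the derivative
  -- of the same expectation, and they differ exactly by the term of the score at time `k`.
  have h1 := ha.hasDerivAt_integral_const θ u hG 0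
  have h2 := ha.hasDerivAt_integral_const θ u (hG.mono (Nat.le_succ k)) 0
  have h3 := h1.unique h2
  simp only [zero_smul, add_zero, scoreSum_succ, add_mul] at h3
  rw [integral_add (((ha.scoreSum_adapted θ u k).mul hG).integrable _)
    (((ha.score_eval θ u (Nat.lt_succ_self k)).mul (hG.mono (Nat.le_succ k))).integrable _)] at h3
  have h4 : ∫ ω, a.score θ u (ω k) * G ω ∂(a.pathLaw θ) = 0 := by linarith
  simpa only [mul_comm] using h4

variable (a) in
/-- The second-order counterpart `∇² π / π` of the score. -/
def scoreTwo (θ u v : Par d) (x : S × A) : ℝ := a.hess θ u v x + a.score θ u x * a.score θ v x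

theorem Regular.measurable_scoreTwo (ha : a.Regular c) (θ u v : Par d) :
    Measurable (a.scoreTwo θ u v) :=
  (ha.measurable_hess θ u v).add ((ha.measurable_score θ u).mul (ha.measurable_score θ v))

theorem Regular.abs_scoreTwo_le (ha : a.Regular c) (θ u v : Par d) (x : S × A) :
    |a.scoreTwo θ u v x| ≤ (c.Mh + c.Mg ^ 2) * ‖u‖ * ‖v‖ := by
  have h1 := ha.abs_hess_le θ u v x
  have h2 := ha.abs_score_le θ u x
  have h3 := ha.abs_score_le θ v x
  have h4 := mul_le_mul h2 h3 (abs_nonneg _) ((abs_nonneg _).trans h2)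
  rw [← abs_mul] at h4
  refine (abs_add_le _ _).trans ((add_le_add h1 h4).trans (le_of_eq (by ring)))

/-- `∇² π / π` has conditional mean zero given the past. -/
theorem Regular.integral_mul_scoreTwo (ha : a.Regular c) (θ u v : Par d) {k : ℕ}
    {G : (ℕ → S × A) → ℝ} (hG : BddAdapted k G) :
    ∫ ω, G ω * a.scoreTwo θ u v (ω k) ∂(a.pathLaw θ) = 0 := by
  obtain ⟨K, hK⟩ := hG.bdd
  have hG' := hG.mono (Nat.le_succ k)
  have hk := Nat.lt_succ_self k
  -- The identity `integral_mul_score` holds at every parameter, so its derivative in direction `u`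
  -- is zero. The earlier scores produced by the derivative are absorbed into the past factor and
  -- vanish by the same identity; the current score combines with the Hessian.
  have h1 := ha.hasDerivAt_integral θ u (N := k + 1)
    (F := fun s ω => G ω * a.score (θ + s • u) v (ω k))
    (F' := fun s ω => G ω * a.hess (θ + s • u) u v (ω k))
    (K := K * (c.Mg * ‖v‖)) (K' := K * (c.Mh * ‖u‖ * ‖v‖))
    (fun s => (hG'.mul (ha.score_eval _ _ hk)).meas)
    (fun s => (hG'.mul (ha.score_eval _ _ hk)).dep)
    (fun s => (hG'.mul (ha.hess_eval _ _ _ hk)).meas)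
    (fun s ω => (ha.hasDerivAt_score θ u v (ω k) s).const_mul _)
    (fun s ω => by
      rw [abs_mul]
      exact mul_le_mul (hK ω) (ha.abs_score_le _ _ _) (abs_nonneg _) ((abs_nonneg _).trans (hK ω)))
    (fun s ω => by
      rw [abs_mul]
      exact mul_le_mul (hK ω) (ha.abs_hess_le _ _ _ _) (abs_nonneg _)
        ((abs_nonneg _).trans (hK ω))) 0
  have h2 : HasDerivAt (fun s : ℝ => ∫ ω, G ω * a.score (θ + s • u) v (ω k)
      ∂(a.pathLaw (θ + s • u))) 0 0 := by
    simp only [ha.integral_mul_score _ v hG]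
    exact hasDerivAt_const 0 0
  have h3 := h1.unique h2
  simp only [zero_smul, add_zero] at h3
  have h4 := ha.integral_mul_score θ v (hG.mul (ha.scoreSum_adapted θ u k))
  have e : ∀ ω, a.scoreSum θ u (k + 1) ω * (G ω * a.score θ v (ω k)) +
      G ω * a.hess θ u v (ω k) = G ω * a.scoreSum θ u k ω * a.score θ v (ω k) +
        G ω * a.scoreTwo θ u v (ω k) := fun ω => by
    rw [scoreSum_succ, scoreTwo]; ring
  simp only [e] at h3
  rw [integral_add, h4, zero_add] at h3
  · exact h3
  · exact (((hG.mul (ha.scoreSum_adapted θ u k)).mono (Nat.le_succ k)).mul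
      (ha.score_eval θ v hk)).integrable _
  · exact (hG'.mul (.eval (ha.measurable_scoreTwo θ u v) (ha.abs_scoreTwo_le θ u v) hk)).integrable _

/-- Martingale differences are orthogonal. -/
theorem integral_sum_sq {X : Type*} [MeasurableSpace X] {μ : Measure (ℕ → X)} [IsFiniteMeasure μ]
    {q : X → ℝ} (hq : Measurable q) {K : ℝ} (hK : ∀ x, |q x| ≤ K)
    (h0 : ∀ k, ∀ G : (ℕ → X) → ℝ, BddAdapted k G → ∫ ω, G ω * q (ω k) ∂μ = 0) (N : ℕ) :
    ∫ ω, (∑ k ∈ Finset.range N, q (ω k)) ^ 2 ∂μ = ∑ k ∈ Finset.range N, ∫ ω, q (ω k) ^ 2 ∂μ := by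
  induction N with
  | zero => simp
  | succ N ih =>
    have hs : BddAdapted N fun ω : ℕ → X => ∑ k ∈ Finset.range N, q (ω k) :=
      .sum _ fun k hk => .eval hq hK (Finset.mem_range.1 hk)
    have hq' : BddAdapted (N + 1) fun ω : ℕ → X => q (ω N) := .eval hq hK (Nat.lt_succ_self N)
    have e : ∀ ω : ℕ → X, (∑ k ∈ Finset.range (N + 1), q (ω k)) ^ 2 =
        ((∑ k ∈ Finset.range N, q (ω k)) * (∑ k ∈ Finset.range N, q (ω k)) +
          2 * ((∑ k ∈ Finset.range N, q (ω k)) * q (ω N))) + q (ω N) * q (ω N) := fun ω => by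
      rw [Finset.sum_range_succ]; ring
    have i1 := (hs.mul hs).integrable μ
    have i2 := (((hs.mono (Nat.le_succ N)).mul hq').integrable μ).const_mul 2
    have i3 := (hq'.mul hq').integrable μ
    have i12 : Integrable (fun ω : ℕ → X =>
        (∑ k ∈ Finset.range N, q (ω k)) * (∑ k ∈ Finset.range N, q (ω k)) +
          2 * ((∑ k ∈ Finset.range N, q (ω k)) * q (ω N))) μ := i1.add i2
    simp only [e]
    rw [integral_add i12 i3, integral_add i1 i2, integral_const_mul, h0 N _ hs,
      Finset.sum_range_succ, ← ih]
    simp [sq]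

theorem integral_sum_sq_le {X : Type*} [MeasurableSpace X] {μ : Measure (ℕ → X)}
    [IsProbabilityMeasure μ] {q : X → ℝ} (hq : Measurable q) {K : ℝ} (hK : ∀ x, |q x| ≤ K)
    (h0 : ∀ k, ∀ G : (ℕ → X) → ℝ, BddAdapted k G → ∫ ω, G ω * q (ω k) ∂μ = 0) (N : ℕ) :
    ∫ ω, (∑ k ∈ Finset.range N, q (ω k)) ^ 2 ∂μ ≤ N * K ^ 2 := by
  rw [integral_sum_sq hq hK h0]
  have : ∀ k ∈ Finset.range N, ∫ ω, q (ω k) ^ 2 ∂μ ≤ K ^ 2 := fun k _ => by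
    have h1 : ∀ ω : ℕ → X, q (ω k) ^ 2 ≤ K ^ 2 := fun ω => by
      rw [← sq_abs]; exact pow_le_pow_left₀ (abs_nonneg _) (hK _) 2
    have hb := BddAdapted.eval hq hK (Nat.lt_succ_self k)
    calc ∫ ω, q (ω k) ^ 2 ∂μ ≤ ∫ _, K ^ 2 ∂μ :=
          integral_mono (by simpa only [sq] using (hb.mul hb).integrable μ) (integrable_const _) h1
      _ = K ^ 2 := by simp
  simpa using Finset.sum_le_sum this

theorem Regular.integral_scoreSum_sq_le (ha : a.Regular c) (θ u : Par d) (N : ℕ) :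
    ∫ ω, a.scoreSum θ u N ω ^ 2 ∂(a.pathLaw θ) ≤ N * (c.Mg * ‖u‖) ^ 2 :=
  integral_sum_sq_le (ha.measurable_score θ u) (ha.abs_score_le θ u)
    (fun _ _ hG => ha.integral_mul_score θ u hG) N

variable (a) in
/-- Sum of `∇² π / π` over the first `N` actions. -/
def scoreTwoSum (θ u v : Par d) (N : ℕ) (ω : ℕ → S × A) : ℝ :=
  ∑ k ∈ Finset.range N, a.scoreTwo θ u v (ω k)

theorem Regular.scoreTwoSum_adapted (ha : a.Regular c) (θ u v : Par d) (N : ℕ) :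
    BddAdapted N (a.scoreTwoSum θ u v N) :=
  .sum _ fun _ hk => .eval (ha.measurable_scoreTwo θ u v) (ha.abs_scoreTwo_le θ u v)
    (Finset.mem_range.1 hk)

theorem Regular.integral_scoreTwoSum_sq_le (ha : a.Regular c) (θ u v : Par d) (N : ℕ) :
    ∫ ω, a.scoreTwoSum θ u v N ω ^ 2 ∂(a.pathLaw θ) ≤
      N * ((c.Mh + c.Mg ^ 2) * ‖u‖ * ‖v‖) ^ 2 :=
  integral_sum_sq_le (ha.measurable_scoreTwo θ u v) (ha.abs_scoreTwo_le θ u v)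
    (fun _ _ hG => ha.integral_mul_scoreTwo θ u v hG) N

/-- Cauchy–Schwarz in the form used below. -/
theorem integral_abs_mul_le {X : Type*} [MeasurableSpace X] {μ : Measure (ℕ → X)}
    [IsProbabilityMeasure μ] {N : ℕ} {F G : (ℕ → X) → ℝ} (hF : BddAdapted N F)
    (hG : BddAdapted N G) {x y : ℝ} (hx : 0 ≤ x) (hy : 0 ≤ y)
    (h1 : ∫ ω, F ω ^ 2 ∂μ ≤ x ^ 2) (h2 : ∫ ω, G ω ^ 2 ∂μ ≤ y ^ 2) :
    ∫ ω, |F ω * G ω| ∂μ ≤ x * y := by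
  have iF : Integrable (fun ω => F ω ^ 2) μ := by simpa only [sq] using (hF.mul hF).integrable μ
  have iG : Integrable (fun ω => G ω ^ 2) μ := by simpa only [sq] using (hG.mul hG).integrable μ
  have iFG : Integrable (fun ω => |F ω * G ω|) μ := (hF.mul hG).abs.integrable μ
  -- Weighted arithmetic-geometric mean inequality; enlarging `x` and `y` by `e` keeps the weights
  -- finite when one of them is zero.
  have key : ∀ e > 0, ∫ ω, |F ω * G ω| ∂μ ≤ (x + e) * (y + e) := by
    intro e he
    have hx' : 0 < x + e := by linarith
    have hy' : 0 < y + e := by linarith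
    have hp : ∀ ω, |F ω * G ω| ≤ (y + e) / (2 * (x + e)) * F ω ^ 2 +
        (x + e) / (2 * (y + e)) * G ω ^ 2 := by
      intro ω
      rw [abs_mul, ← sq_abs (F ω), ← sq_abs (G ω)]
      have h : 0 ≤ (|F ω| * (y + e) - |G ω| * (x + e)) ^ 2 / (2 * (x + e) * (y + e)) := by
        positivity
      have h' : (|F ω| * (y + e) - |G ω| * (x + e)) ^ 2 / (2 * (x + e) * (y + e)) =
          (y + e) / (2 * (x + e)) * |F ω| ^ 2 + (x + e) / (2 * (y + e)) * |G ω| ^ 2 -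
            |F ω| * |G ω| := by field_simp; ring
      linarith
    have := integral_mono iFG ((iF.const_mul _).add (iG.const_mul _)) hp
    refine this.trans ?_
    simp only [Pi.add_apply]
    rw [integral_add (iF.const_mul _) (iG.const_mul _), integral_const_mul, integral_const_mul]
    have b1 : ∫ ω, F ω ^ 2 ∂μ ≤ (x + e) ^ 2 := h1.trans (pow_le_pow_left₀ hx (by linarith) 2)
    have b2 : ∫ ω, G ω ^ 2 ∂μ ≤ (y + e) ^ 2 := h2.trans (pow_le_pow_left₀ hy (by linarith) 2)
    have c1 := mul_le_mul_of_nonneg_left b1 (by positivity : 0 ≤ (y + e) / (2 * (x + e)))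
    have c2 := mul_le_mul_of_nonneg_left b2 (by positivity : 0 ≤ (x + e) / (2 * (y + e)))
    have e1 : (y + e) / (2 * (x + e)) * (x + e) ^ 2 = (x + e) * (y + e) / 2 := by field_simp
    have e2 : (x + e) / (2 * (y + e)) * (y + e) ^ 2 = (x + e) * (y + e) / 2 := by field_simp
    linarith
  have lim : Filter.Tendsto (fun e : ℝ => (x + e) * (y + e)) (nhdsWithin 0 (Set.Ioi 0))
      (nhds (x * y)) := by
    have : ContinuousAt (fun e : ℝ => (x + e) * (y + e)) 0 := by fun_prop
    simpa using this.tendsto.mono_left nhdsWithin_le_nhds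
  exact ge_of_tendsto lim (by filter_upwards [self_mem_nhdsWithin] with e he using key e he)

theorem integral_abs_le_of_sq {X : Type*} [MeasurableSpace X] {μ : Measure (ℕ → X)}
    [IsProbabilityMeasure μ] {N : ℕ} {F : (ℕ → X) → ℝ} (hF : BddAdapted N F) {x : ℝ} (hx : 0 ≤ x)
    (h1 : ∫ ω, F ω ^ 2 ∂μ ≤ x ^ 2) : ∫ ω, |F ω| ∂μ ≤ x := by
  simpa using integral_abs_mul_le hF (.const N 1) hx zero_le_one h1 (by simp)

/-- Orthogonality is the source of √N; the pointwise bound would only give N. -/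
theorem Regular.integral_abs_scoreSum_le (ha : a.Regular c) (hc : c.Valid) (θ u : Par d) (N : ℕ) :
    ∫ ω, |a.scoreSum θ u N ω| ∂(a.pathLaw θ) ≤ √N * (c.Mg * ‖u‖) := by
  have := hc.Mg_pos
  refine integral_abs_le_of_sq (ha.scoreSum_adapted θ u N) (by positivity) ?_
  rw [mul_pow, Real.sq_sqrt (Nat.cast_nonneg _)]
  exact ha.integral_scoreSum_sq_le θ u N

theorem Regular.integral_abs_scoreSum_mul_le (ha : a.Regular c) (hc : c.Valid) (θ u v : Par d)
    (N : ℕ) : ∫ ω, |a.scoreSum θ u N ω * a.scoreSum θ v N ω| ∂(a.pathLaw θ) ≤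
      N * c.Mg ^ 2 * ‖u‖ * ‖v‖ := by
  have := hc.Mg_pos
  have hs : √(N : ℝ) * √N = N := Real.mul_self_sqrt (Nat.cast_nonneg _)
  refine (integral_abs_mul_le (ha.scoreSum_adapted θ u N) (ha.scoreSum_adapted θ v N)
    (x := √N * (c.Mg * ‖u‖)) (y := √N * (c.Mg * ‖v‖)) (by positivity) (by positivity) ?_ ?_).trans
    (le_of_eq ?_)
  · rw [mul_pow, Real.sq_sqrt (Nat.cast_nonneg _)]
    exact ha.integral_scoreSum_sq_le θ u N
  · rw [mul_pow, Real.sq_sqrt (Nat.cast_nonneg _)]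
    exact ha.integral_scoreSum_sq_le θ v N
  · linear_combination c.Mg ^ 2 * ‖u‖ * ‖v‖ * hs

/-- One factor is bounded pointwise by a multiple of N and the other two by Cauchy–Schwarz. The
resulting N² matches the `(1 - γ)⁻³` of the `M_g³` term in `L_h`. -/
theorem Regular.integral_abs_scoreSum_mul_mul_le (ha : a.Regular c) (hc : c.Valid)
    (θ u v w : Par d) (N : ℕ) :
    ∫ ω, |a.scoreSum θ u N ω * a.scoreSum θ v N ω * a.scoreSum θ w N ω| ∂(a.pathLaw θ) ≤
      N ^ 2 * c.Mg ^ 3 * ‖u‖ * ‖v‖ * ‖w‖ := by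
  have := hc.Mg_pos
  have hu := ha.scoreSum_adapted θ u N
  have hv := ha.scoreSum_adapted θ v N
  have hw := ha.scoreSum_adapted θ w N
  calc _ ≤ ∫ ω, |a.scoreSum θ u N ω * a.scoreSum θ v N ω| * (N * (c.Mg * ‖w‖))
        ∂(a.pathLaw θ) := by
        refine integral_mono (((hu.mul hv).mul hw).abs.integrable _)
          (((hu.mul hv).abs.integrable _).mul_const _) fun ω => ?_
        rw [abs_mul]
        exact mul_le_mul_of_nonneg_left (ha.abs_scoreSum_le θ w N ω) (abs_nonneg _)
    _ ≤ (N * c.Mg ^ 2 * ‖u‖ * ‖v‖) * (N * (c.Mg * ‖w‖)) := by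
        rw [integral_mul_const]
        exact mul_le_mul_of_nonneg_right (ha.integral_abs_scoreSum_mul_le hc θ u v N)
          (by positivity)
    _ = _ := by ring

/-- The correlation of the score with the accumulated Hessian: the Hessian is a martingale minus
a sum of products of scores. -/
theorem Regular.integral_abs_scoreSum_mul_hessSum_le (ha : a.Regular c) (hc : c.Valid)
    (θ u v w : Par d) (N : ℕ) :
    ∫ ω, |a.scoreSum θ w N ω * a.hessSum θ u v N ω| ∂(a.pathLaw θ) ≤
      (N * (c.Mg * c.Mh) + 2 * (N ^ 2 * c.Mg ^ 3)) * ‖u‖ * ‖v‖ * ‖w‖ := by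
  have hMg := hc.Mg_pos
  have hMh := hc.Mh_pos
  have hw := ha.scoreSum_adapted θ w N
  have hh := ha.hessSum_adapted θ u v N
  have ht := ha.scoreTwoSum_adapted θ u v N
  have hs : √(N : ℝ) * √N = N := Real.mul_self_sqrt (Nat.cast_nonneg _)
  have b1 : ∫ ω, |a.scoreSum θ w N ω * a.scoreTwoSum θ u v N ω| ∂(a.pathLaw θ) ≤
      (√N * (c.Mg * ‖w‖)) * (√N * ((c.Mh + c.Mg ^ 2) * ‖u‖ * ‖v‖)) := by
    refine integral_abs_mul_le hw ht (by positivity) (by positivity) ?_ ?_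
    · rw [mul_pow, Real.sq_sqrt (Nat.cast_nonneg _)]
      exact ha.integral_scoreSum_sq_le θ w N
    · rw [mul_pow, Real.sq_sqrt (Nat.cast_nonneg _)]
      exact ha.integral_scoreTwoSum_sq_le θ u v N
  -- The pointwise bound on the Hessian sum would leave `N^(3/2) * M_g * M_h`. Writing it as a
  -- martingale minus products of scores replaces this by `N * M_g * M_h` at the price of a term `N²
  -- * M_g³`, which `L_h` can carry.
  have hp : ∀ ω, |a.scoreSum θ w N ω * a.hessSum θ u v N ω| ≤
      |a.scoreSum θ w N ω * a.scoreTwoSum θ u v N ω| +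
        (N * (c.Mg * ‖w‖)) * (N * ((c.Mg * ‖u‖) * (c.Mg * ‖v‖))) := by
    intro ω
    have e : a.scoreSum θ w N ω * a.hessSum θ u v N ω =
        a.scoreSum θ w N ω * a.scoreTwoSum θ u v N ω - a.scoreSum θ w N ω *
          ∑ k ∈ Finset.range N, a.score θ u (ω k) * a.score θ v (ω k) := by
      rw [← mul_sub, scoreTwoSum, hessSum, ← Finset.sum_sub_distrib]
      simp [scoreTwo]
    rw [e]
    refine (abs_sub _ _).trans (add_le_add_right ?_ _)
    rw [abs_mul]
    refine mul_le_mul (ha.abs_scoreSum_le θ w N ω) (abs_sum_range_le fun k => ?_) (abs_nonneg _)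
      (by positivity)
    rw [abs_mul]
    exact mul_le_mul (ha.abs_score_le _ _ _) (ha.abs_score_le _ _ _) (abs_nonneg _) (by positivity)
  have h1 := integral_mono ((hw.mul hh).abs.integrable (a.pathLaw θ))
    (((hw.mul ht).abs.integrable (a.pathLaw θ)).add (integrable_const _)) hp
  refine h1.trans ?_
  simp only [Pi.add_apply]
  rw [integral_add ((hw.mul ht).abs.integrable _) (integrable_const _)]
  simp only [integral_const, probReal_univ, one_smul]
  have e1 : (√N * (c.Mg * ‖w‖)) * (√N * ((c.Mh + c.Mg ^ 2) * ‖u‖ * ‖v‖)) =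
      (N * (c.Mg * c.Mh) + N * c.Mg ^ 3) * ‖u‖ * ‖v‖ * ‖w‖ := by
    linear_combination (c.Mg * ‖w‖) * ((c.Mh + c.Mg ^ 2) * ‖u‖ * ‖v‖) * hs
  have e2 : (N : ℝ) ≤ N ^ 2 := by exact_mod_cast Nat.le_self_pow two_ne_zero N
  have e3 : (N : ℝ) * c.Mg ^ 3 * ‖u‖ * ‖v‖ * ‖w‖ ≤ N ^ 2 * c.Mg ^ 3 * ‖u‖ * ‖v‖ * ‖w‖ := by
    gcongr
  linarith [e3, b1, e1]

end Agent

/-! ### Elementary one-variable estimates. -/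

/-- A quadratic term in a Lipschitz estimate can be dropped. -/
theorem abs_sub_le_of_quadratic {f : ℝ → ℝ} {L K : ℝ}
    (h : ∀ x y, |f x - f y| ≤ L * |x - y| + K * |x - y| ^ 2) (x y : ℝ) :
    |f x - f y| ≤ L * |x - y| := by
  -- The interval is cut into `n + 1` equal pieces: the linear terms add up to the same amount, the
  -- quadratic ones shrink by the factor `n + 1`.
  have key : ∀ n : ℕ, |f x - f y| ≤ L * |x - y| + K * |x - y| ^ 2 * (1 / ((n : ℝ) + 1)) := by
    intro n
    have hn : (0 : ℝ) < (n : ℝ) + 1 := by positivity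
    have h1 := dist_le_range_sum_dist (fun k : ℕ => f (x + (k / ((n : ℝ) + 1)) * (y - x))) (n + 1)
    have h2 : ∀ k ∈ Finset.range (n + 1), dist (f (x + (k / ((n : ℝ) + 1)) * (y - x)))
        (f (x + ((k + 1 : ℕ) / ((n : ℝ) + 1)) * (y - x))) ≤
          L * (|x - y| / (n + 1)) + K * (|x - y| / (n + 1)) ^ 2 := by
      intro k _
      have e : |x + (k / ((n : ℝ) + 1)) * (y - x) - (x + ((k + 1 : ℕ) / ((n : ℝ) + 1)) * (y - x))|
          = |x - y| / (n + 1) := by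
        rw [← abs_of_pos hn, ← abs_div, abs_of_pos hn]
        congr 1
        push_cast
        field_simp
        ring
      rw [Real.dist_eq]
      refine (h _ _).trans (le_of_eq ?_)
      rw [e]
    have h3 := h1.trans (Finset.sum_le_sum h2)
    simp only [Nat.cast_zero, zero_div, zero_mul, add_zero, Finset.sum_const, Finset.card_range,
      nsmul_eq_mul, Nat.cast_add, Nat.cast_one] at h3
    rw [div_self hn.ne', one_mul, Real.dist_eq, add_sub_cancel] at h3
    refine h3.trans (le_of_eq ?_)
    field_simp
  have lim : Filter.Tendsto (fun n : ℕ => L * |x - y| + K * |x - y| ^ 2 * (1 / ((n : ℝ) + 1)))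
      Filter.atTop (nhds (L * |x - y| + K * |x - y| ^ 2 * 0)) :=
    (tendsto_one_div_add_atTop_nhds_zero_nat.const_mul _).const_add _
  simpa using ge_of_tendsto' lim key

theorem abs_sub_le_of_hasDerivAt {f f' : ℝ → ℝ} {L : ℝ} (hf : ∀ s, HasDerivAt f (f' s) s)
    (hL : ∀ s, |f' s| ≤ L) (x y : ℝ) : |f x - f y| ≤ L * |x - y| :=
  Convex.norm_image_sub_le_of_norm_hasDerivWithin_le (s := Set.univ)
    (fun s _ => (hf s).hasDerivWithinAt) (fun s _ => hL s) convex_univ (Set.mem_univ _)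
    (Set.mem_univ _)

/-- The remainder is compared with a parabola on `[0, 1]` after rescaling by `s`, which treats both
signs at once. The derivative need only be Lipschitz about `0`, so no second derivative has to
exist. -/
theorem abs_taylor_le {f f' : ℝ → ℝ} {L : ℝ} (hf : ∀ s, HasDerivAt f (f' s) s)
    (hL : ∀ s, |f' s - f' 0| ≤ L * |s|) (s : ℝ) :
    |f s - f 0 - s * f' 0| ≤ L * s ^ 2 / 2 := by
  have hd : ∀ t, HasDerivAt (fun t => f (t * s) - f 0 - t * s * f' 0)
      (f' (t * s) * s - s * f' 0) t := by
    intro t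
    have h1 : HasDerivAt (fun t : ℝ => t * s) s t := by simpa using (hasDerivAt_id t).mul_const s
    exact ((((hf (t * s)).comp t h1)).sub_const _).sub (h1.mul_const _)
  have hB : ∀ t, HasDerivAt (fun t : ℝ => L * s ^ 2 * t ^ 2 / 2) (L * s ^ 2 * t) t := by
    intro t
    have := ((hasDerivAt_pow 2 t).const_mul (L * s ^ 2)).div_const 2
    refine this.congr_deriv ?_
    norm_num
    ring
  have := image_norm_le_of_norm_deriv_right_le_deriv_boundary (a := (0 : ℝ)) (b := 1)
    (f := fun t => f (t * s) - f 0 - t * s * f' 0) (f' := fun t => f' (t * s) * s - s * f' 0)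
    (B := fun t => L * s ^ 2 * t ^ 2 / 2) (B' := fun t => L * s ^ 2 * t)
    (fun t _ => (hd t).continuousAt.continuousWithinAt)
    (fun t _ => (hd t).hasDerivWithinAt) (by simp) hB (fun t ht => by
      have e : f' (t * s) * s - s * f' 0 = (f' (t * s) - f' 0) * s := by ring
      rw [Real.norm_eq_abs, e, abs_mul]
      refine (mul_le_mul_of_nonneg_right (hL _) (abs_nonneg _)).trans (le_of_eq ?_)
      rw [abs_mul, abs_of_nonneg ht.1, ← sq_abs s]
      ring)
    (Set.right_mem_Icc.2 zero_le_one)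
  simpa using this

/-! ### Derivatives along lines of the expectation of a bounded path functional. -/

namespace Agent
variable {d : ℕ} {S A : Type*} [MeasurableSpace S] [MeasurableSpace A] {a : Agent d S A}
  {c : Consts}

variable (a) in
/-- Directional derivative of the expectation of `R`. -/
def dirDeriv (N : ℕ) (R : (ℕ → S × A) → ℝ) (θ u : Par d) : ℝ :=
  ∫ ω, R ω * a.scoreSum θ u N ω ∂(a.pathLaw θ)

variable (a) in
/-- Second directional derivative of the expectation of `R`. -/
def dirDerivTwo (N : ℕ) (R : (ℕ → S × A) → ℝ) (θ w v : Par d) : ℝ :=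
  ∫ ω, R ω * (a.scoreSum θ w N ω * a.scoreSum θ v N ω) ∂(a.pathLaw θ) +
    ∫ ω, R ω * a.hessSum θ w v N ω ∂(a.pathLaw θ)

variable {N : ℕ} {R : (ℕ → S × A) → ℝ} {ρ : ℝ}

theorem abs_integral_mul_le {X : Type*} [MeasurableSpace X] {μ : Measure (ℕ → X)}
    [IsProbabilityMeasure μ] {R F : (ℕ → X) → ℝ} (hR : ∀ ω, |R ω| ≤ ρ) (hF : BddAdapted N F)
    {K : ℝ} (hK : ∫ ω, |F ω| ∂μ ≤ K) : |∫ ω, R ω * F ω ∂μ| ≤ ρ * K := by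
  have hρ : 0 ≤ ρ := by
    obtain ⟨ω⟩ := nonempty_of_isProbabilityMeasure μ
    exact (abs_nonneg _).trans (hR ω)
  have h1 : ‖∫ ω, R ω * F ω ∂μ‖ ≤ ∫ ω, ρ * |F ω| ∂μ :=
    norm_integral_le_of_norm_le ((hF.abs.integrable μ).const_mul ρ)
      (Filter.Eventually.of_forall fun ω => by
        rw [Real.norm_eq_abs, abs_mul]
        exact mul_le_mul_of_nonneg_right (hR ω) (abs_nonneg _))
  rw [integral_const_mul] at h1
  exact h1.trans (mul_le_mul_of_nonneg_left hK hρ)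

theorem Regular.hasDerivAt_val (ha : a.Regular c) (hR : BddAdapted N R) (θ w : Par d) (s : ℝ) :
    HasDerivAt (fun s => ∫ ω, R ω ∂(a.pathLaw (θ + s • w))) (a.dirDeriv N R (θ + s • w) w) s := by
  have := ha.hasDerivAt_integral_const θ w hR s
  simpa only [dirDeriv, mul_comm] using this

theorem Regular.abs_dirDeriv_le (ha : a.Regular c) (hc : c.Valid) (hρ : ∀ ω, |R ω| ≤ ρ)
    (θ u : Par d) : |a.dirDeriv N R θ u| ≤ ρ * (√N * (c.Mg * ‖u‖)) :=
  abs_integral_mul_le hρ (ha.scoreSum_adapted θ u N) (ha.integral_abs_scoreSum_le hc θ u N)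

theorem Regular.hasDerivAt_dirDeriv (ha : a.Regular c) (hR : BddAdapted N R) (θ w v : Par d)
    (s : ℝ) : HasDerivAt (fun s => a.dirDeriv N R (θ + s • w) v)
      (a.dirDerivTwo N R (θ + s • w) w v) s := by
  obtain ⟨K, hK⟩ := hR.bdd
  have hK0 : ∀ ω, 0 ≤ K := fun ω => (abs_nonneg _).trans (hK ω)
  have h1 := ha.hasDerivAt_integral θ w (N := N)
    (F := fun s ω => R ω * a.scoreSum (θ + s • w) v N ω)
    (F' := fun s ω => R ω * a.hessSum (θ + s • w) w v N ω)
    (K := K * (N * (c.Mg * ‖v‖))) (K' := K * (N * (c.Mh * ‖w‖ * ‖v‖)))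
    (fun s => (hR.mul (ha.scoreSum_adapted _ _ _)).meas)
    (fun s => (hR.mul (ha.scoreSum_adapted _ _ _)).dep)
    (fun s => (hR.mul (ha.hessSum_adapted _ _ _ _)).meas)
    (fun s ω => (ha.hasDerivAt_scoreSum θ w v N ω s).const_mul _)
    (fun s ω => by
      rw [abs_mul]
      exact mul_le_mul (hK ω) (ha.abs_scoreSum_le _ _ _ _) (abs_nonneg _) (hK0 ω))
    (fun s ω => by
      rw [abs_mul]
      exact mul_le_mul (hK ω) (ha.abs_hessSum_le _ _ _ _ _) (abs_nonneg _) (hK0 ω)) s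
  refine h1.congr_deriv ?_
  rw [integral_add, dirDerivTwo]
  · congr 1
    exact integral_congr_ae (Filter.Eventually.of_forall fun ω => by ring)
  · exact ((ha.scoreSum_adapted _ _ _).mul (hR.mul (ha.scoreSum_adapted _ _ _))).integrable _
  · exact (hR.mul (ha.hessSum_adapted _ _ _ _)).integrable _

theorem integral_abs_le_of_bound {X : Type*} [MeasurableSpace X] {μ : Measure (ℕ → X)}
    [IsProbabilityMeasure μ] {F : (ℕ → X) → ℝ} (hF : BddAdapted N F)
    {K : ℝ} (hK : ∀ ω, |F ω| ≤ K) : ∫ ω, |F ω| ∂μ ≤ K := by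
  simpa using integral_mono (hF.abs.integrable μ) (integrable_const K) hK

/-- Cauchy–Schwarz on the product of score sums keeps the growth linear in `N`; this becomes `L_g`
after summation over time. -/
theorem Regular.abs_dirDerivTwo_le (ha : a.Regular c) (hc : c.Valid) (hρ : ∀ ω, |R ω| ≤ ρ)
    (θ w v : Par d) :
    |a.dirDerivTwo N R θ w v| ≤ ρ * N * (c.Mg ^ 2 + c.Mh) * ‖w‖ * ‖v‖ := by
  have h1 := abs_integral_mul_le (μ := a.pathLaw θ) hρ
    ((ha.scoreSum_adapted θ w N).mul (ha.scoreSum_adapted θ v N))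
    (ha.integral_abs_scoreSum_mul_le hc θ w v N)
  have h2 := abs_integral_mul_le (μ := a.pathLaw θ) hρ (ha.hessSum_adapted θ w v N)
    (integral_abs_le_of_bound (ha.hessSum_adapted θ w v N) (ha.abs_hessSum_le θ w v N))
  refine (abs_add_le _ _).trans ((add_le_add h1 h2).trans (le_of_eq (by ring)))

/-- The second derivative of the expectation of `R` is Lipschitz along lines. -/
theorem Regular.abs_dirDerivTwo_sub_le (ha : a.Regular c) (hc : c.Valid) (hR : BddAdapted N R)
    (hρ : ∀ ω, |R ω| ≤ ρ) (θ w v : Par d) (s t : ℝ) :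
    |a.dirDerivTwo N R (θ + s • w) w v - a.dirDerivTwo N R (θ + t • w) w v| ≤
      ρ * (7 * (N ^ 2 * c.Mg ^ 3) + 3 * (N * (c.Mg * c.Mh)) + N * c.l2) * ‖w‖ ^ 2 * ‖v‖ *
        |s - t| := by
  have hMg := hc.Mg_pos
  have hMh := hc.Mh_pos
  have hl2 := hc.l2_pos
  have hS := fun θ u => ha.scoreSum_adapted θ u N
  have hH := fun θ u v => ha.hessSum_adapted θ u v N
  have hρ0 : 0 ≤ ρ := by
    obtain ⟨ω⟩ := nonempty_of_isProbabilityMeasure (a.pathLaw θ)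
    exact (abs_nonneg _).trans (hρ ω)
  have hb2 : ∀ θ u v ω, |a.scoreSum θ u N ω * a.scoreSum θ v N ω| ≤
      (N * (c.Mg * ‖u‖)) * (N * (c.Mg * ‖v‖)) := fun θ u v ω => by
    rw [abs_mul]
    exact mul_le_mul (ha.abs_scoreSum_le _ _ _ _) (ha.abs_scoreSum_le _ _ _ _) (abs_nonneg _)
      (by positivity)
  have hb3 : ∀ θ u v v' ω, |a.hessSum θ u v N ω * a.scoreSum θ v' N ω| ≤
      (N * (c.Mh * ‖u‖ * ‖v‖)) * (N * (c.Mg * ‖v'‖)) := fun θ u v v' ω => by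
    rw [abs_mul]
    exact mul_le_mul (ha.abs_hessSum_le _ _ _ _ _) (ha.abs_scoreSum_le _ _ _ _) (abs_nonneg _)
      (by positivity)
  -- the product of scores
  have part1 : |∫ ω, R ω * (a.scoreSum (θ + s • w) w N ω * a.scoreSum (θ + s • w) v N ω)
        ∂(a.pathLaw (θ + s • w)) -
      ∫ ω, R ω * (a.scoreSum (θ + t • w) w N ω * a.scoreSum (θ + t • w) v N ω)
        ∂(a.pathLaw (θ + t • w))| ≤
      ρ * (5 * (N ^ 2 * c.Mg ^ 3) + 2 * (N * (c.Mg * c.Mh))) * ‖w‖ ^ 2 * ‖v‖ * |s - t| := by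
    refine abs_sub_le_of_hasDerivAt (f := fun s => ∫ ω, R ω *
      (a.scoreSum (θ + s • w) w N ω * a.scoreSum (θ + s • w) v N ω) ∂(a.pathLaw (θ + s • w)))
      (fun s => ha.hasDerivAt_integral θ w (N := N)
        (F := fun s ω => R ω * (a.scoreSum (θ + s • w) w N ω * a.scoreSum (θ + s • w) v N ω))
        (F' := fun s ω => R ω * (a.hessSum (θ + s • w) w w N ω * a.scoreSum (θ + s • w) v N ω +
          a.scoreSum (θ + s • w) w N ω * a.hessSum (θ + s • w) w v N ω))
        (K := ρ * ((N * (c.Mg * ‖w‖)) * (N * (c.Mg * ‖v‖))))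
        (K' := ρ * ((N * (c.Mh * ‖w‖ * ‖w‖)) * (N * (c.Mg * ‖v‖)) +
          (N * (c.Mh * ‖w‖ * ‖v‖)) * (N * (c.Mg * ‖w‖))))
        (fun s => (hR.mul ((hS _ _).mul (hS _ _))).meas)
        (fun s => (hR.mul ((hS _ _).mul (hS _ _))).dep)
        (fun s => (hR.mul (((hH _ _ _).mul (hS _ _)).add ((hS _ _).mul (hH _ _ _)))).meas)
        (fun s ω => ((ha.hasDerivAt_scoreSum θ w w N ω s).mul
          (ha.hasDerivAt_scoreSum θ w v N ω s)).const_mul _)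
        (fun s ω => by
          rw [abs_mul]
          exact mul_le_mul (hρ ω) (hb2 _ _ _ ω) (abs_nonneg _) hρ0)
        (fun s ω => by
          rw [abs_mul]
          refine mul_le_mul (hρ ω) ((abs_add_le _ _).trans (add_le_add (hb3 _ _ _ _ ω) ?_))
            (abs_nonneg _) hρ0
          rw [mul_comm (a.scoreSum _ _ _ _)]
          exact hb3 _ _ _ _ ω) s) (fun s => ?_) s t
    have e : ∫ ω, (a.scoreSum (θ + s • w) w N ω *
          (R ω * (a.scoreSum (θ + s • w) w N ω * a.scoreSum (θ + s • w) v N ω)) +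
        R ω * (a.hessSum (θ + s • w) w w N ω * a.scoreSum (θ + s • w) v N ω +
          a.scoreSum (θ + s • w) w N ω * a.hessSum (θ + s • w) w v N ω))
            ∂(a.pathLaw (θ + s • w)) =
        ∫ ω, R ω * (a.scoreSum (θ + s • w) w N ω * a.scoreSum (θ + s • w) w N ω *
          a.scoreSum (θ + s • w) v N ω) ∂(a.pathLaw (θ + s • w)) +
        ∫ ω, R ω * (a.scoreSum (θ + s • w) v N ω * a.hessSum (θ + s • w) w w N ω)
          ∂(a.pathLaw (θ + s • w)) +
        ∫ ω, R ω * (a.scoreSum (θ + s • w) w N ω * a.hessSum (θ + s • w) w v N ω)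
          ∂(a.pathLaw (θ + s • w)) := by
      rw [← integral_add, ← integral_add]
      · exact integral_congr_ae (Filter.Eventually.of_forall fun ω => by ring)
      · exact ((hR.mul (((hS _ _).mul (hS _ _)).mul (hS _ _))).add
          (hR.mul ((hS _ _).mul (hH _ _ _)))).integrable _
      · exact (hR.mul ((hS _ _).mul (hH _ _ _))).integrable _
      · exact (hR.mul (((hS _ _).mul (hS _ _)).mul (hS _ _))).integrable _
      · exact (hR.mul ((hS _ _).mul (hH _ _ _))).integrable _
    rw [e]
    have i1 := abs_integral_mul_le (μ := a.pathLaw (θ + s • w)) hρ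
      (((hS (θ + s • w) w).mul (hS _ w)).mul (hS _ v))
      (ha.integral_abs_scoreSum_mul_mul_le hc (θ + s • w) w w v N)
    have i2 := abs_integral_mul_le (μ := a.pathLaw (θ + s • w)) hρ
      ((hS (θ + s • w) v).mul (hH _ w w))
      (ha.integral_abs_scoreSum_mul_hessSum_le hc (θ + s • w) w w v N)
    have i3 := abs_integral_mul_le (μ := a.pathLaw (θ + s • w)) hρ
      ((hS (θ + s • w) w).mul (hH _ w v))
      (ha.integral_abs_scoreSum_mul_hessSum_le hc (θ + s • w) w v w N)
    -- The triple product of scores contributes one `N² * M_g³`, and each of the two score-Hessian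
    -- correlations contributes two more and one `N * M_g * M_h`: hence 5 and 2.
    refine (abs_add_le _ _).trans ((add_le_add ((abs_add_le _ _).trans (add_le_add i1 i2)) i3).trans
      (le_of_eq (by ring)))
  -- the Hessian
  have part2 : |∫ ω, R ω * a.hessSum (θ + s • w) w v N ω ∂(a.pathLaw (θ + s • w)) -
      ∫ ω, R ω * a.hessSum (θ + t • w) w v N ω ∂(a.pathLaw (θ + t • w))| ≤
      ρ * (2 * (N ^ 2 * c.Mg ^ 3) + N * (c.Mg * c.Mh) + N * c.l2) * ‖w‖ ^ 2 * ‖v‖ * |s - t| := by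
    -- The Hessian is only Lipschitz in the parameter, so it is not differentiated. Law and Hessian
    -- are moved one after the other; the mismatch is quadratic in `s - t`, and although its
    -- coefficient grows like `N²`, it disappears by subdivision.
    refine abs_sub_le_of_quadratic (f := fun s => ∫ ω, R ω * a.hessSum (θ + s • w) w v N ω
      ∂(a.pathLaw (θ + s • w))) (K := ρ * ((N * (c.Mg * ‖w‖)) * (N * (c.l2 * ‖w‖ * ‖w‖ * ‖v‖))))
      (fun s t => ?_) s t
    have hdiff : ∀ x y ω, |a.hessSum (θ + x • w) w v N ω - a.hessSum (θ + y • w) w v N ω| ≤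
        N * (c.l2 * ‖w‖ * ‖w‖ * ‖v‖) * |x - y| := fun x y ω => by
      refine (ha.abs_hessSum_sub_le _ _ _ _ _ _).trans (le_of_eq ?_)
      rw [add_sub_add_left_eq_sub, ← sub_smul, norm_smul, Real.norm_eq_abs]
      ring
    -- frozen Hessian, moving law
    have f1 : |∫ ω, R ω * a.hessSum (θ + s • w) w v N ω ∂(a.pathLaw (θ + s • w)) -
        ∫ ω, R ω * a.hessSum (θ + s • w) w v N ω ∂(a.pathLaw (θ + t • w))| ≤
        (ρ * (2 * (N ^ 2 * c.Mg ^ 3) + N * (c.Mg * c.Mh)) * ‖w‖ ^ 2 * ‖v‖ +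
          ρ * ((N * (c.Mg * ‖w‖)) * (N * (c.l2 * ‖w‖ * ‖w‖ * ‖v‖))) * |s - t|) * |s - t| := by
      have hd : ∀ x, HasDerivAt (fun x => ∫ ω, R ω * a.hessSum (θ + s • w) w v N ω
          ∂(a.pathLaw (θ + x • w))) (∫ ω, a.scoreSum (θ + x • w) w N ω *
            (R ω * a.hessSum (θ + s • w) w v N ω) ∂(a.pathLaw (θ + x • w))) x := fun x =>
        ha.hasDerivAt_integral_const θ w (hR.mul (hH _ _ _)) x
      -- Staying between `t` and `s` keeps the frozen Hessian within a multiple of `|s - t|` of the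
      -- one at the current parameter, to which the correlation bound applies.
      refine Convex.norm_image_sub_le_of_norm_hasDerivWithin_le (s := Set.uIcc t s)
        (f := fun x => ∫ ω, R ω * a.hessSum (θ + s • w) w v N ω ∂(a.pathLaw (θ + x • w)))
        (fun x _ => (hd x).hasDerivWithinAt) (fun x hx => ?_) (convex_uIcc _ _)
        Set.left_mem_uIcc Set.right_mem_uIcc
      have hxs : |s - x| ≤ |s - t| := Set.abs_sub_right_of_mem_uIcc hx
      have e : ∫ ω, a.scoreSum (θ + x • w) w N ω * (R ω * a.hessSum (θ + s • w) w v N ω)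
          ∂(a.pathLaw (θ + x • w)) =
          ∫ ω, R ω * (a.scoreSum (θ + x • w) w N ω * a.hessSum (θ + x • w) w v N ω)
            ∂(a.pathLaw (θ + x • w)) +
          ∫ ω, R ω * (a.scoreSum (θ + x • w) w N ω *
            (a.hessSum (θ + s • w) w v N ω - a.hessSum (θ + x • w) w v N ω))
            ∂(a.pathLaw (θ + x • w)) := by
        rw [← integral_add]
        · exact integral_congr_ae (Filter.Eventually.of_forall fun ω => by ring)
        · exact (hR.mul ((hS _ _).mul (hH _ _ _))).integrable _
        · exact (hR.mul ((hS _ _).mul ((hH _ _ _).sub (hH _ _ _)))).integrable _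
      rw [e, Real.norm_eq_abs]
      have i1 := abs_integral_mul_le (μ := a.pathLaw (θ + x • w)) hρ
        ((hS (θ + x • w) w).mul (hH _ w v))
        (ha.integral_abs_scoreSum_mul_hessSum_le hc (θ + x • w) w v w N)
      have hbd : ∀ ω, |a.scoreSum (θ + x • w) w N ω *
            (a.hessSum (θ + s • w) w v N ω - a.hessSum (θ + x • w) w v N ω)| ≤
          (N * (c.Mg * ‖w‖)) * (N * (c.l2 * ‖w‖ * ‖w‖ * ‖v‖) * |s - t|) := fun ω => by
        rw [abs_mul]
        refine mul_le_mul (ha.abs_scoreSum_le _ _ _ _) ((hdiff s x ω).trans ?_) (abs_nonneg _)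
          (by positivity)
        exact mul_le_mul_of_nonneg_left hxs (by positivity)
      have hadp := (hS (θ + x • w) w).mul ((hH (θ + s • w) w v).sub (hH (θ + x • w) w v))
      have i2 := abs_integral_mul_le (μ := a.pathLaw (θ + x • w)) hρ hadp
        (integral_abs_le_of_bound hadp hbd)
      refine (abs_add_le _ _).trans ((add_le_add i1 i2).trans (le_of_eq (by ring)))
    -- moving Hessian, frozen law
    have f2 : |∫ ω, R ω * a.hessSum (θ + s • w) w v N ω ∂(a.pathLaw (θ + t • w)) -
        ∫ ω, R ω * a.hessSum (θ + t • w) w v N ω ∂(a.pathLaw (θ + t • w))| ≤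
        ρ * (N * (c.l2 * ‖w‖ * ‖w‖ * ‖v‖) * |s - t|) := by
      rw [← integral_sub ((hR.mul (hH _ _ _)).integrable _) ((hR.mul (hH _ _ _)).integrable _)]
      simp only [← mul_sub]
      have hadp := (hH (θ + s • w) w v).sub (hH (θ + t • w) w v)
      exact abs_integral_mul_le hρ hadp (integral_abs_le_of_bound hadp (hdiff s t))
    refine (abs_sub_le _ _ _).trans ((add_le_add f1 f2).trans (le_of_eq (by ring)))
  have e : a.dirDerivTwo N R (θ + s • w) w v - a.dirDerivTwo N R (θ + t • w) w v =
      (∫ ω, R ω * (a.scoreSum (θ + s • w) w N ω * a.scoreSum (θ + s • w) v N ω)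
        ∂(a.pathLaw (θ + s • w)) -
      ∫ ω, R ω * (a.scoreSum (θ + t • w) w N ω * a.scoreSum (θ + t • w) v N ω)
        ∂(a.pathLaw (θ + t • w))) +
      (∫ ω, R ω * a.hessSum (θ + s • w) w v N ω ∂(a.pathLaw (θ + s • w)) -
      ∫ ω, R ω * a.hessSum (θ + t • w) w v N ω ∂(a.pathLaw (θ + t • w))) := by
    simp only [dirDerivTwo]; ring
  rw [e]
  refine (abs_add_le _ _).trans ((add_le_add part1 part2).trans (le_of_eq (by ring)))

/-- Second-order expansion of the expectation of `R`. -/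
theorem Regular.abs_val_taylor_le (ha : a.Regular c) (hc : c.Valid) (hR : BddAdapted N R)
    (hρ : ∀ ω, |R ω| ≤ ρ) (θ w : Par d) :
    |∫ ω, R ω ∂(a.pathLaw (θ + w)) - ∫ ω, R ω ∂(a.pathLaw θ) - a.dirDeriv N R θ w| ≤
      ρ * N * (c.Mg ^ 2 + c.Mh) * ‖w‖ ^ 2 / 2 := by
  have h1 := abs_taylor_le (ha.hasDerivAt_val hR θ w)
    (L := ρ * N * (c.Mg ^ 2 + c.Mh) * ‖w‖ ^ 2) (fun s => by
      have := abs_sub_le_of_hasDerivAt (ha.hasDerivAt_dirDeriv hR θ w w)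
        (fun s => ha.abs_dirDerivTwo_le hc hρ (θ + s • w) w w) s 0
      refine this.trans (le_of_eq ?_)
      rw [sub_zero]; ring) 1
  simpa using h1

/-- Expansion of the gradient along a line: the linear term cancels. -/
theorem Regular.abs_dirDeriv_comb_le (ha : a.Regular c) (hc : c.Valid) (hR : BddAdapted N R)
    (hρ : ∀ ω, |R ω| ≤ ρ) (θ w v : Par d) {η : ℝ} (h0 : 0 < η) (h1 : η ≤ 1) :
    |(1 - η) * (a.dirDeriv N R (θ - w) v - a.dirDeriv N R θ v) +
      η * (a.dirDeriv N R (θ + ((1 - η) / η) • w) v - a.dirDeriv N R θ v)| ≤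
      ρ * (7 * (N ^ 2 * c.Mg ^ 3) + 3 * (N * (c.Mg * c.Mh)) + N * c.l2) * ‖w‖ ^ 2 * ‖v‖ *
        ((1 - η) / (2 * η)) := by
  set L := ρ * (7 * (N ^ 2 * c.Mg ^ 3) + 3 * (N * (c.Mg * c.Mh)) + N * c.l2) * ‖w‖ ^ 2 * ‖v‖
  have h2 := abs_taylor_le (ha.hasDerivAt_dirDeriv hR θ w v) (L := L) (fun s => by
      simpa using ha.abs_dirDerivTwo_sub_le hc hR hρ θ w v s 0)
  -- The displacements `-1` and `(1 - η) / η` have weighted mean zero for the weights `1 - η` and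
  -- `η`. Their weighted mean square is `(1 - η) / η`, and half of it is the remainder.
  have h3 := h2 (-1)
  have h4 := h2 ((1 - η) / η)
  simp only [neg_smul, one_smul, zero_smul, add_zero, ← sub_eq_add_neg] at h3 h4
  set D := a.dirDerivTwo N R θ w v
  have e : (1 - η) * (a.dirDeriv N R (θ - w) v - a.dirDeriv N R θ v) +
      η * (a.dirDeriv N R (θ + ((1 - η) / η) • w) v - a.dirDeriv N R θ v) =
      (1 - η) * (a.dirDeriv N R (θ - w) v - a.dirDeriv N R θ v - (-1) * D) +
      η * (a.dirDeriv N R (θ + ((1 - η) / η) • w) v - a.dirDeriv N R θ v - (1 - η) / η * D) := by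
    field_simp; ring
  rw [e]
  refine (abs_add_le _ _).trans ?_
  rw [abs_mul, abs_mul, abs_of_nonneg (sub_nonneg.2 h1), abs_of_pos h0]
  refine (add_le_add (mul_le_mul_of_nonneg_left h3 (sub_nonneg.2 h1))
    (mul_le_mul_of_nonneg_left h4 h0.le)).trans (le_of_eq ?_)
  field_simp; ring

end Agent

/-! ### Vector-valued tools, geometric series and the policy gradient. -/

theorem measurable_of_inner {X : Type*} [MeasurableSpace X] {d : ℕ} {f : X → Par d}
    (h : ∀ u, Measurable fun x => inner ℝ (f x) u) : Measurable f := by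
  have e : f = fun x => ∑ i, inner ℝ (f x) (EuclideanSpace.basisFun (Fin d) ℝ i) •
      EuclideanSpace.basisFun (Fin d) ℝ i := by
    funext x
    conv_lhs => rw [← (EuclideanSpace.basisFun (Fin d) ℝ).sum_repr (f x)]
    refine Finset.sum_congr rfl fun i _ => ?_
    rw [OrthonormalBasis.repr_apply_apply, real_inner_comm]
  rw [e]
  exact Finset.measurable_sum _ fun i _ => (h _).smul_const _

theorem norm_le_of_inner {d : ℕ} {x : Par d} {K : ℝ} (hK : 0 ≤ K)
    (h : ∀ v, |inner ℝ x v| ≤ K * ‖v‖) : ‖x‖ ≤ K := by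
  rcases eq_or_lt_of_le (norm_nonneg x) with h0 | h0
  · rw [← h0]; exact hK
  · have := h x
    rw [real_inner_self_eq_norm_sq, abs_of_nonneg (sq_nonneg _), sq] at this
    exact le_of_mul_le_mul_right this h0

theorem hasSum_pow_mul_succ {γ : ℝ} (h0 : 0 < γ) (h1 : γ < 1) :
    HasSum (fun t : ℕ => γ ^ t * ((t : ℝ) + 1)) (1 / (1 - γ) ^ 2) := by
  have := hasSum_choose_mul_geometric_of_norm_lt_one (𝕜 := ℝ) 1 (r := γ)
    (by rwa [Real.norm_of_nonneg h0.le])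
  simpa [mul_comm] using this

/-- From `(t + 1)² = 2 * choose (t + 2) 2 - (t + 1)` and the negative binomial series. -/
theorem hasSum_pow_mul_succ_sq {γ : ℝ} (h0 : 0 < γ) (h1 : γ < 1) :
    HasSum (fun t : ℕ => γ ^ t * ((t : ℝ) + 1) ^ 2) ((1 + γ) / (1 - γ) ^ 3) := by
  have h2 := (hasSum_choose_mul_geometric_of_norm_lt_one (𝕜 := ℝ) 2 (r := γ)
    (by rwa [Real.norm_of_nonneg h0.le])).mul_left 2
  have h3 := h2.sub (hasSum_pow_mul_succ h0 h1)
  have hne : 1 - γ ≠ 0 := by linarith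
  have e1 : (fun t : ℕ => γ ^ t * ((t : ℝ) + 1) ^ 2) = fun t : ℕ =>
      2 * (((t + 2).choose 2 : ℕ) * γ ^ t) - γ ^ t * ((t : ℝ) + 1) := by
    funext t
    rw [Nat.cast_choose_two]
    push_cast
    ring
  have e2 : (1 + γ) / (1 - γ) ^ 3 = 2 * (1 / (1 - γ) ^ (2 + 1)) - 1 / (1 - γ) ^ 2 := by
    field_simp; ring
  rw [e1, e2]
  exact h3

namespace Agent
variable {d : ℕ} {S A : Type*} [MeasurableSpace S] [MeasurableSpace A] {a : Agent d S A}
  {c : Consts}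

variable (a) in
/-- The score vector `∇ log π_θ`. -/
def scoreVec (θ : Par d) (x : S × A) : Par d := ∇ (a.logDens x.1 x.2) θ

theorem Regular.measurable_scoreVec (ha : a.Regular c) (θ : Par d) : Measurable (a.scoreVec θ) :=
  measurable_of_inner fun u => ha.measurable_score θ u

/-- A Carathéodory function: continuous in the parameter, measurable in the state-action pair. Joint
measurability is needed because query points are random. -/
theorem Regular.measurable_uncurry_scoreVec (ha : a.Regular c) :
    Measurable (Function.uncurry a.scoreVec) :=
  measurable_uncurry_of_continuous_of_measurable
    (fun x => (ha.contDiff_gradient x.1 x.2).continuous) ha.measurable_scoreVec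

variable (a) in
/-- Sum of the first `N` score vectors. -/
def scoreVecSum (θ : Par d) (N : ℕ) (ω : ℕ → S × A) : Par d :=
  ∑ k ∈ Finset.range N, a.scoreVec θ (ω k)

theorem Regular.measurable_scoreVecSum (ha : a.Regular c) (θ : Par d) (N : ℕ) :
    Measurable (a.scoreVecSum θ N) :=
  Finset.measurable_sum _ fun k _ => (ha.measurable_scoreVec θ).comp (measurable_pi_apply k)

theorem Regular.norm_scoreVecSum_le (ha : a.Regular c) (θ : Par d) (N : ℕ) (ω : ℕ → S × A) :
    ‖a.scoreVecSum θ N ω‖ ≤ N * c.Mg := by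
  refine (norm_sum_le _ _).trans ((Finset.sum_le_sum fun k _ => ha.grad_le _ _ _).trans ?_)
  simp

theorem inner_scoreVecSum (θ u : Par d) (N : ℕ) (ω : ℕ → S × A) :
    inner ℝ (a.scoreVecSum θ N ω) u = a.scoreSum θ u N ω := by
  rw [scoreVecSum, sum_inner]; rfl

/-- Orthogonality is used in each coordinate, but the coordinates are summed before the scores are
bounded, so no factor `d` appears. -/
theorem Regular.integral_norm_scoreVecSum_sq_le (ha : a.Regular c) (θ : Par d) (N : ℕ) :
    ∫ ω, ‖a.scoreVecSum θ N ω‖ ^ 2 ∂(a.pathLaw θ) ≤ N * c.Mg ^ 2 := by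
  have b := EuclideanSpace.basisFun (Fin d) ℝ
  have e : ∀ x : Par d, ‖x‖ ^ 2 = ∑ i, (inner ℝ x (b i)) ^ 2 := fun x => by
    rw [← b.sum_sq_norm_inner_left x]; simp
  have h1 : ∫ ω, ‖a.scoreVecSum θ N ω‖ ^ 2 ∂(a.pathLaw θ) =
      ∑ i, ∫ ω, a.scoreSum θ (b i) N ω ^ 2 ∂(a.pathLaw θ) := by
    rw [← integral_finsetSum]
    · exact integral_congr_ae (Filter.Eventually.of_forall fun ω => by
        simp only [e, inner_scoreVecSum])
    · intro i _
      simpa only [sq] using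
        ((ha.scoreSum_adapted θ (b i) N).mul (ha.scoreSum_adapted θ (b i) N)).integrable _
  have h2 : ∀ i, ∫ ω, a.scoreSum θ (b i) N ω ^ 2 ∂(a.pathLaw θ) =
      ∑ k ∈ Finset.range N, ∫ ω, a.score θ (b i) (ω k) ^ 2 ∂(a.pathLaw θ) := fun i =>
    integral_sum_sq (ha.measurable_score θ (b i)) (ha.abs_score_le θ (b i))
      (fun _ _ hG => ha.integral_mul_score θ (b i) hG) N
  have isq : ∀ i k, Integrable (fun ω : ℕ → S × A => a.score θ (b i) (ω k) ^ 2) (a.pathLaw θ) := by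
    intro i k
    have hk := ha.score_eval θ (b i) (Nat.lt_succ_self k)
    simpa only [sq] using (hk.mul hk).integrable _
  rw [h1]
  simp only [h2]
  rw [Finset.sum_comm]
  have h3 : ∀ k ∈ Finset.range N,
      ∑ i, ∫ ω, a.score θ (b i) (ω k) ^ 2 ∂(a.pathLaw θ) ≤ c.Mg ^ 2 := by
    intro k _
    rw [← integral_finsetSum _ fun i _ => isq i k]
    have h4 : ∀ ω : ℕ → S × A, ∑ i, a.score θ (b i) (ω k) ^ 2 ≤ c.Mg ^ 2 := fun ω => by
      have := e (a.scoreVec θ (ω k))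
      simp only [score]
      rw [scoreVec] at this
      rw [← this]
      exact pow_le_pow_left₀ (norm_nonneg _) (ha.grad_le _ _ _) 2
    simpa using integral_mono (integrable_finsetSum _ fun i _ => isq i k)
      (integrable_const (μ := a.pathLaw θ) (c.Mg ^ 2)) h4
  simpa using Finset.sum_le_sum h3

variable (a) in
/-- The reward at time `t`. -/
def rewardAt (t : ℕ) (ω : ℕ → S × A) : ℝ := a.reward (ω t).1 (ω t).2

theorem Regular.rewardAt_adapted (ha : a.Regular c) (t : ℕ) : BddAdapted (t + 1) (a.rewardAt t) :=
  .eval (q := Function.uncurry a.reward) a.reward_measurable (fun x => ha.reward_le x.1 x.2)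
    (Nat.lt_succ_self t)

variable (a) in
/-- Gradient of the expected reward at time `t`. -/
def gradTerm (t : ℕ) (θ : Par d) : Par d :=
  ∫ ω, a.rewardAt t ω • a.scoreVecSum θ (t + 1) ω ∂(a.pathLaw θ)

theorem Regular.integrable_rewardAt_smul (ha : a.Regular c) (t : ℕ) (θ : Par d) :
    Integrable (fun ω => a.rewardAt t ω • a.scoreVecSum θ (t + 1) ω) (a.pathLaw θ) := by
  refine Integrable.of_bound ((ha.rewardAt_adapted t).meas.smul
    (ha.measurable_scoreVecSum θ _)).aestronglyMeasurable (c.rmax * ((t + 1 : ℕ) * c.Mg))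
    (Filter.Eventually.of_forall fun ω => ?_)
  rw [norm_smul]
  exact mul_le_mul (ha.reward_le _ _) (ha.norm_scoreVecSum_le _ _ _) (norm_nonneg _)
    ((abs_nonneg _).trans (ha.reward_le (ω 0).1 (ω 0).2))

theorem Regular.inner_gradTerm (ha : a.Regular c) (t : ℕ) (θ u : Par d) :
    inner ℝ (a.gradTerm t θ) u = a.dirDeriv (t + 1) (a.rewardAt t) θ u := by
  rw [real_inner_comm, gradTerm, ← integral_inner (ha.integrable_rewardAt_smul t θ)]
  refine integral_congr_ae (Filter.Eventually.of_forall fun ω => ?_)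
  simp only [real_inner_comm _ u, real_inner_smul_left, inner_scoreVecSum]

theorem Regular.norm_gradTerm_le (ha : a.Regular c) (hc : c.Valid) (t : ℕ) (θ : Par d) :
    ‖a.gradTerm t θ‖ ≤ c.rmax * c.Mg * √(t + 1) := by
  have := hc.Mg_pos
  have := hc.rmax_pos
  refine norm_le_of_inner (by positivity) fun v => ?_
  rw [ha.inner_gradTerm]
  refine (ha.abs_dirDeriv_le hc (fun ω => ha.reward_le _ _) θ v).trans (le_of_eq ?_)
  push_cast; ring

theorem sqrt_succ_le (t : ℕ) : √((t : ℝ) + 1) ≤ t + 1 := by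
  rw [Real.sqrt_le_left (by positivity)]
  nlinarith [(Nat.cast_nonneg t : (0 : ℝ) ≤ t)]

theorem Regular.summable_gradTerm (ha : a.Regular c) (hc : c.Valid) (θ : Par d) :
    Summable fun t => c.γ ^ t • a.gradTerm t θ := by
  have := hc.Mg_pos
  have := hc.rmax_pos
  have := hc.γ_pos
  refine Summable.of_norm_bounded
    ((hasSum_pow_mul_succ hc.γ_pos hc.γ_lt_one).summable.mul_left (c.rmax * c.Mg)) fun t => ?_
  rw [norm_smul, Real.norm_of_nonneg (by positivity)]
  calc c.γ ^ t * ‖a.gradTerm t θ‖ ≤ c.γ ^ t * (c.rmax * c.Mg * (t + 1)) := by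
        refine mul_le_mul_of_nonneg_left ((ha.norm_gradTerm_le hc t θ).trans ?_) (by positivity)
        exact mul_le_mul_of_nonneg_left (sqrt_succ_le t) (by positivity)
    _ = _ := by ring

variable (a) in
/-- The policy gradient as a series. -/
def polGrad (γ : ℝ) (θ : Par d) : Par d := ∑' t, γ ^ t • a.gradTerm t θ

variable (a) in
/-- The truncated policy gradient. -/
def truncGrad (γ : ℝ) (H : ℕ) (θ : Par d) : Par d := ∑ t ∈ Finset.range H, γ ^ t • a.gradTerm t θ

theorem Regular.hasSum_inner_polGrad (ha : a.Regular c) (hc : c.Valid) (θ u : Par d) :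
    HasSum (fun t => c.γ ^ t * a.dirDeriv (t + 1) (a.rewardAt t) θ u)
      (inner ℝ (a.polGrad c.γ θ) u) := by
  have h := (ha.summable_gradTerm hc θ).hasSum.mapL ((innerSL ℝ) u)
  simp only [innerSL_apply_apply, real_inner_comm _ u, real_inner_smul_left, ha.inner_gradTerm] at h
  exact h

theorem Regular.hasSum_value (ha : a.Regular c) (hc : c.Valid) (θ : Par d) :
    HasSum (fun t => c.γ ^ t * ∫ ω, a.rewardAt t ω ∂(a.pathLaw θ)) (a.value c.γ θ) := by
  have hγ := hc.γ_pos
  have hi : ∀ t, Integrable (fun ω => c.γ ^ t * a.rewardAt t ω) (a.pathLaw θ) := fun t =>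
    ((ha.rewardAt_adapted t).integrable _).const_mul _
  have h := hasSum_integral_of_summable_integral_norm hi ?_
  · simp only [integral_const_mul] at h
    exact h
  · refine Summable.of_nonneg_of_le (fun t => integral_nonneg fun ω => norm_nonneg _) (fun t => ?_)
      ((summable_geometric_of_lt_one hγ.le hc.γ_lt_one).mul_right c.rmax)
    have := integral_mono (hi t).norm (integrable_const (μ := a.pathLaw θ) (c.γ ^ t * c.rmax))
      fun ω => by
        rw [norm_mul, Real.norm_of_nonneg (by positivity)]
        exact mul_le_mul_of_nonneg_left (ha.reward_le _ _) (by positivity)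
    simpa using this

/-- Quadratic expansion of the value. -/
theorem Regular.abs_value_taylor_le (ha : a.Regular c) (hc : c.Valid) (θ w : Par d) :
    |a.value c.γ (θ + w) - a.value c.γ θ - inner ℝ (a.polGrad c.γ θ) w| ≤
      c.Lg / 2 * ‖w‖ ^ 2 := by
  have hγ := hc.γ_pos
  have h1 := ((ha.hasSum_value hc (θ + w)).sub (ha.hasSum_value hc θ)).sub
    (ha.hasSum_inner_polGrad hc θ w)
  have h2 := (hasSum_pow_mul_succ hc.γ_pos hc.γ_lt_one).mul_left
    (c.rmax * (c.Mg ^ 2 + c.Mh) * ‖w‖ ^ 2 / 2)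
  refine (h1.norm_le_of_bounded h2 fun t => ?_).trans (le_of_eq ?_)
  · have := ha.abs_val_taylor_le hc (ha.rewardAt_adapted t) (fun ω => ha.reward_le _ _) θ w
    rw [← mul_sub, ← mul_sub, norm_mul, Real.norm_of_nonneg (by positivity), Real.norm_eq_abs]
    refine (mul_le_mul_of_nonneg_left this (by positivity)).trans (le_of_eq ?_)
    push_cast; ring
  · rw [Consts.Lg]; ring

theorem Lh_nonneg (hc : c.Valid) : 0 ≤ c.Lh := by
  have h1 := hc.Mg_pos
  have h2 := hc.rmax_pos
  have h3 := hc.γ_pos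
  have h4 : 0 < 1 - c.γ := by linarith [hc.γ_lt_one]
  have h5 := hc.Mh_pos
  rw [Consts.Lh]
  refine add_nonneg (by positivity) (mul_nonneg (by positivity) ?_)
  exact h5.le.trans (le_max_left _ _)

/-- The left side is the discounted sum of the third-order bounds. The first two summands of `L_h`
cover the `M_g³` and `M_g * M_h` terms, the entry `l2 / ((1 - γ) * M_g)` of the maximum is exactly
the `l2` term, and 7 is the largest coefficient. -/
theorem third_le_Lh (hc : c.Valid) :
    c.rmax * (7 * c.Mg ^ 3 * ((1 + c.γ) / (1 - c.γ) ^ 3) + 3 * (c.Mg * c.Mh) * (1 / (1 - c.γ) ^ 2) +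
      c.l2 * (1 / (1 - c.γ) ^ 2)) ≤ 7 * c.Lh := by
  have h1 := hc.Mg_pos
  have h2 := hc.rmax_pos
  have h3 := hc.γ_pos
  have h4 : 0 < 1 - c.γ := by linarith [hc.γ_lt_one]
  have h5 := hc.Mh_pos
  have h6 := hc.l2_pos
  rw [Consts.Lh]
  set m := max c.Mh (max (c.γ * c.Mg ^ 2 / (1 - c.γ)) (max (c.l2 / ((1 - c.γ) * c.Mg))
        (max (c.Mh * c.γ / (1 - c.γ))
          ((c.Mg * (1 + c.γ) + c.Mh * c.γ * (1 - c.γ)) / (1 - c.γ ^ 2)))))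
  have hm : c.l2 / ((1 - c.γ) * c.Mg) ≤ m :=
    (le_max_left _ _).trans ((le_max_right _ _).trans (le_max_right _ _))
  have h7 : c.rmax * (c.l2 * (1 / (1 - c.γ) ^ 2)) ≤ c.rmax * c.Mg / (1 - c.γ) * m := by
    refine le_trans (le_of_eq ?_) (mul_le_mul_of_nonneg_left hm (by positivity))
    field_simp
  have h8 : 0 ≤ c.rmax * c.Mg * c.Mh / (1 - c.γ) ^ 2 := by positivity
  have h9 : 0 ≤ c.rmax * (c.l2 * (1 / (1 - c.γ) ^ 2)) := by positivity
  have e : c.rmax * (7 * c.Mg ^ 3 * ((1 + c.γ) / (1 - c.γ) ^ 3) +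
      3 * (c.Mg * c.Mh) * (1 / (1 - c.γ) ^ 2) + c.l2 * (1 / (1 - c.γ) ^ 2)) =
      7 * (c.rmax * c.Mg ^ 3 * (1 + c.γ) / (1 - c.γ) ^ 3) +
        3 * (c.rmax * c.Mg * c.Mh / (1 - c.γ) ^ 2) + c.rmax * (c.l2 * (1 / (1 - c.γ) ^ 2)) := by
    ring
  linarith

/-- Expansion of the policy gradient along a line; the linear term cancels. -/
theorem Regular.norm_polGrad_comb_le (ha : a.Regular c) (hc : c.Valid) (θ w : Par d) {η : ℝ}
    (h0 : 0 < η) (h1 : η ≤ 1) :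
    ‖(1 - η) • (a.polGrad c.γ (θ - w) - a.polGrad c.γ θ) +
      η • (a.polGrad c.γ (θ + ((1 - η) / η) • w) - a.polGrad c.γ θ)‖ ≤
      7 * c.Lh * ‖w‖ ^ 2 * ((1 - η) / (2 * η)) := by
  have hγ := hc.γ_pos
  have hL := Lh_nonneg hc
  have hη : 0 ≤ (1 - η) / (2 * η) := div_nonneg (by linarith) (by linarith)
  refine norm_le_of_inner (by positivity) fun v => ?_
  have i1 := (((ha.hasSum_inner_polGrad hc (θ - w) v).sub
    (ha.hasSum_inner_polGrad hc θ v)).mul_left (1 - η)).add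
    (((ha.hasSum_inner_polGrad hc (θ + ((1 - η) / η) • w) v).sub
    (ha.hasSum_inner_polGrad hc θ v)).mul_left η)
  have i2 := ((((hasSum_pow_mul_succ_sq hc.γ_pos hc.γ_lt_one).mul_left (7 * c.Mg ^ 3)).add
    ((hasSum_pow_mul_succ hc.γ_pos hc.γ_lt_one).mul_left (3 * (c.Mg * c.Mh)))).add
    ((hasSum_pow_mul_succ hc.γ_pos hc.γ_lt_one).mul_left c.l2)).mul_left
      (c.rmax * ‖w‖ ^ 2 * ‖v‖ * ((1 - η) / (2 * η)))
  rw [inner_add_left, inner_smul_left, inner_smul_left, inner_sub_left, inner_sub_left]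
  refine (i1.norm_le_of_bounded i2 fun t => ?_).trans ?_
  · have := ha.abs_dirDeriv_comb_le hc (ha.rewardAt_adapted t) (fun ω => ha.reward_le _ _) θ w v
      h0 h1
    have e : ∀ x y z : ℝ, (1 - η) * (c.γ ^ t * x - c.γ ^ t * z) +
        η * (c.γ ^ t * y - c.γ ^ t * z) = c.γ ^ t * ((1 - η) * (x - z) + η * (y - z)) :=
      fun x y z => by ring
    rw [e, norm_mul, Real.norm_of_nonneg (by positivity), Real.norm_eq_abs]
    refine (mul_le_mul_of_nonneg_left this (by positivity)).trans (le_of_eq ?_)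
    push_cast; ring
  · have h3 := mul_le_mul_of_nonneg_right (third_le_Lh hc)
      (by positivity : 0 ≤ ‖w‖ ^ 2 * ‖v‖ * ((1 - η) / (2 * η)))
    refine le_trans (le_of_eq ?_) (h3.trans (le_of_eq ?_)) <;> ring

/-- Truncation bias of the policy gradient. -/
theorem Regular.norm_polGrad_sub_truncGrad_le (ha : a.Regular c) (hc : c.Valid) (H : ℕ)
    (θ : Par d) : ‖a.polGrad c.γ θ - a.truncGrad c.γ H θ‖ ≤ c.γ ^ H * c.Dg H := by
  have h1 := hc.Mg_pos
  have h2 := hc.rmax_pos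
  have h3 := hc.γ_pos
  have h4 : 0 < 1 - c.γ := by linarith [hc.γ_lt_one]
  have hs := ha.summable_gradTerm hc θ
  have e : a.polGrad c.γ θ - a.truncGrad c.γ H θ = ∑' t, c.γ ^ (t + H) • a.gradTerm (t + H) θ := by
    rw [polGrad, truncGrad, ← hs.sum_add_tsum_nat_add H, add_sub_cancel_left]
  have i1 := ((summable_nat_add_iff H).2 hs).hasSum
  rw [← e] at i1
  -- The square root is replaced by its tangent at `y`, that is `√x ≤ (x + y) / (2√y)`. With this
  -- `y` the discounted sum of the tangent bounds is exactly the one in `D_g`.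
  set y : ℝ := 1 / (1 - c.γ) + H with hy
  have hy0 : 0 < y := by positivity
  have i2 := (((hasSum_pow_mul_succ hc.γ_pos hc.γ_lt_one).add
    ((hasSum_geometric_of_lt_one h3.le hc.γ_lt_one).mul_right (H + y))).mul_left
      (c.γ ^ H * (c.rmax * c.Mg) / (2 * √y)))
  refine (i1.norm_le_of_bounded i2 fun t => ?_).trans (le_of_eq ?_)
  · rw [norm_smul, Real.norm_of_nonneg (by positivity)]
    have g1 := ha.norm_gradTerm_le hc (t + H) θ
    have g2 : √(((t + H : ℕ) : ℝ) + 1) ≤ (t + 1 + (H + y)) / (2 * √y) := by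
      rw [le_div_iff₀ (by positivity)]
      have q1 := Real.sq_sqrt hy0.le
      have q2 := Real.sq_sqrt (by positivity : (0 : ℝ) ≤ ((t + H : ℕ) : ℝ) + 1)
      have q3 := sq_nonneg (√(((t + H : ℕ) : ℝ) + 1) - √y)
      push_cast at q2 q3 ⊢
      nlinarith
    calc c.γ ^ (t + H) * ‖a.gradTerm (t + H) θ‖
        ≤ c.γ ^ (t + H) * (c.rmax * c.Mg * ((t + 1 + (H + y)) / (2 * √y))) :=
          mul_le_mul_of_nonneg_left (g1.trans (mul_le_mul_of_nonneg_left g2 (by positivity)))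
            (by positivity)
      _ = _ := by rw [pow_add]; ring
  · have q1 := Real.sq_sqrt hy0.le
    have q0 : 0 < √y := Real.sqrt_pos.2 hy0
    have e2 : 1 / (1 - c.γ) ^ 2 + (1 - c.γ)⁻¹ * (H + y) = 2 * √y ^ 2 / (1 - c.γ) := by
      rw [q1, hy]; field_simp; ring
    rw [e2, Consts.Dg, ← hy]
    field_simp

/-! ### The stochastic policy gradient: mean and second moment. -/

/-- The stochastic gradient in terms of the sums of score vectors. -/
theorem stochGrad_eq (γ : ℝ) (H : ℕ) (ω : ℕ → S × A) (θ : Par d) :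
    a.stochGrad γ H (fun t : Fin H => ω t) θ =
      ∑ t ∈ Finset.range H, γ ^ t • (a.rewardAt t ω • a.scoreVecSum θ (t + 1) ω) := by
  have e : ∀ t : Fin H, (∑ h ∈ Finset.Ici t, γ ^ (h : ℕ) * a.reward (ω h).1 (ω h).2) •
      ∇ (a.logDens (ω t).1 (ω t).2) θ = ∑ h : Fin H, if t ≤ h then
        (γ ^ (h : ℕ) * a.rewardAt h ω) • a.scoreVec θ (ω t) else 0 := by
    intro t
    rw [Finset.sum_smul, ← Finset.sum_filter]
    refine Finset.sum_congr ?_ fun h _ => rfl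
    ext h; simp
  rw [stochGrad]
  simp only [e]
  -- Exchanging the sums turns "score times later rewards" into "reward times scores up to that
  -- time".
  rw [Finset.sum_comm, ← Fin.sum_univ_eq_sum_range
    (fun t => γ ^ t • (a.rewardAt t ω • a.scoreVecSum θ (t + 1) ω)) H]
  refine Finset.sum_congr rfl fun h _ => ?_
  rw [smul_smul, scoreVecSum, Finset.smul_sum]
  have : ∀ t : Fin H, (if t ≤ h then (γ ^ (h : ℕ) * a.rewardAt h ω) • a.scoreVec θ (ω t) else 0) =
      (fun k : ℕ => if k ≤ (h : ℕ) then
        (γ ^ (h : ℕ) * a.rewardAt h ω) • a.scoreVec θ (ω k) else 0) t := fun t => rfl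
  rw [Finset.sum_congr rfl fun t _ => this t, Fin.sum_univ_eq_sum_range
    (fun k : ℕ => if k ≤ (h : ℕ) then
        (γ ^ (h : ℕ) * a.rewardAt h ω) • a.scoreVec θ (ω k) else 0) H, ← Finset.sum_filter]
  refine Finset.sum_congr ?_ fun _ _ => rfl
  ext k
  simp only [Finset.mem_filter, Finset.mem_range]
  omega

theorem Regular.measurable_stochGrad (ha : a.Regular c) (γ : ℝ) (H : ℕ) :
    Measurable fun p : (Fin H → S × A) × Par d => a.stochGrad γ H p.1 p.2 := by
  refine Finset.measurable_sum _ fun t _ => ?_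
  have h1 : Measurable fun p : (Fin H → S × A) × Par d =>
      ∑ h ∈ Finset.Ici t, γ ^ (h : ℕ) * a.reward (p.1 h).1 (p.1 h).2 :=
    Finset.measurable_sum _ fun h _ => Measurable.const_mul
      (a.reward_measurable.comp ((measurable_pi_apply h).comp measurable_fst)) _
  have h2 : Measurable fun p : (Fin H → S × A) × Par d => a.scoreVec p.2 (p.1 t) :=
    ha.measurable_uncurry_scoreVec.comp (f := fun p : (Fin H → S × A) × Par d =>
      (p.2, p.1 t)) (measurable_snd.prodMk ((measurable_pi_apply t).comp measurable_fst))
  exact h1.smul h2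

theorem Regular.measurable_stochGrad_left (ha : a.Regular c) (γ : ℝ) (H : ℕ) (θ : Par d) :
    Measurable fun τ : Fin H → S × A => a.stochGrad γ H τ θ :=
  (ha.measurable_stochGrad γ H).comp (g := fun p : (Fin H → S × A) × Par d =>
    a.stochGrad γ H p.1 p.2) (f := fun τ => (τ, θ)) measurable_prodMk_right

/-- A crude bound whose only purpose is integrability; the variance is controlled separately. -/
theorem Regular.norm_stochGrad_le (ha : a.Regular c) (hc : c.Valid) (H : ℕ) (τ : Fin H → S × A)
    (θ : Par d) : ‖a.stochGrad c.γ H τ θ‖ ≤ H * (H * c.rmax * c.Mg) := by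
  have h1 := hc.Mg_pos
  have h2 := hc.rmax_pos
  have h3 := hc.γ_pos
  rw [stochGrad]
  have : ∀ t ∈ (Finset.univ : Finset (Fin H)),
      ‖(∑ h ∈ Finset.Ici t, c.γ ^ (h : ℕ) * a.reward (τ h).1 (τ h).2) •
        ∇ (a.logDens (τ t).1 (τ t).2) θ‖ ≤ H * c.rmax * c.Mg := by
    intro t _
    rw [norm_smul]
    refine mul_le_mul ?_ (ha.grad_le _ _ _) (norm_nonneg _) (by positivity)
    have hle : ∀ h ∈ Finset.Ici t, ‖c.γ ^ (h : ℕ) * a.reward (τ h).1 (τ h).2‖ ≤ c.rmax := by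
      intro h _
      rw [norm_mul, Real.norm_of_nonneg (by positivity)]
      calc c.γ ^ (h : ℕ) * ‖a.reward (τ h).1 (τ h).2‖ ≤ 1 * c.rmax :=
            mul_le_mul (pow_le_one₀ h3.le hc.γ_lt_one.le) (ha.reward_le _ _) (norm_nonneg _)
              zero_le_one
        _ = c.rmax := one_mul _
    refine (norm_sum_le_of_le _ hle).trans ?_
    rw [Finset.sum_const, nsmul_eq_mul]
    refine mul_le_mul_of_nonneg_right ?_ h2.le
    exact_mod_cast (Finset.card_le_univ _).trans (le_of_eq (Fintype.card_fin H))
  refine (norm_sum_le_of_le _ this).trans (le_of_eq ?_)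
  simp

theorem measurable_restrict_fin {X : Type*} [MeasurableSpace X] (H : ℕ) :
    Measurable fun (ω : ℕ → X) (t : Fin H) => ω t :=
  measurable_pi_iff.2 fun t => measurable_pi_apply (t : ℕ)

theorem integral_trajLaw {E : Type*} [NormedAddCommGroup E] [NormedSpace ℝ E] (H : ℕ) (θ : Par d)
    {f : (Fin H → S × A) → E} (hf : StronglyMeasurable f) :
    ∫ τ, f τ ∂(a.trajLaw H θ) = ∫ ω, f (fun t : Fin H => ω t) ∂(a.pathLaw θ) :=
  integral_map (measurable_restrict_fin H).aemeasurable hf.aestronglyMeasurable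

/-- The stochastic gradient is an unbiased estimate of the truncated gradient. -/
theorem Regular.integral_stochGrad (ha : a.Regular c) (γ : ℝ) (H : ℕ) (θ : Par d) :
    ∫ τ, a.stochGrad γ H τ θ ∂(a.trajLaw H θ) = a.truncGrad γ H θ := by
  have hm := ha.measurable_stochGrad_left γ H θ
  rw [integral_trajLaw H θ hm.stronglyMeasurable,
    integral_congr_ae (Filter.Eventually.of_forall fun ω => stochGrad_eq γ H ω θ),
    integral_finsetSum, truncGrad]
  · exact Finset.sum_congr rfl fun t _ => integral_smul _ _
  · exact fun t _ => (ha.integrable_rewardAt_smul t θ).smul (γ ^ t)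

/-- Cauchy–Schwarz with weights `γ ^ t` costs one factor `1 / (1 - γ)`. The second moments of the
score sums, linear in `t`, then supply `(1 - γ)⁻²`, which makes up `σ²`. -/
theorem Regular.norm_sum_rewardAt_smul_sq_le (ha : a.Regular c) (hc : c.Valid) (H : ℕ)
    (θ : Par d) (ω : ℕ → S × A) :
    ‖∑ t ∈ Finset.range H, c.γ ^ t • (a.rewardAt t ω • a.scoreVecSum θ (t + 1) ω)‖ ^ 2 ≤
      1 / (1 - c.γ) * c.rmax ^ 2 *
        ∑ t ∈ Finset.range H, c.γ ^ t * ‖a.scoreVecSum θ (t + 1) ω‖ ^ 2 := by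
  have h3 := hc.γ_pos
  have hgeo : ∑ t ∈ Finset.range H, c.γ ^ t ≤ 1 / (1 - c.γ) := by
    rw [one_div, ← tsum_geometric_of_lt_one h3.le hc.γ_lt_one]
    exact (summable_geometric_of_lt_one h3.le hc.γ_lt_one).sum_le_tsum _ fun t _ => by positivity
  have hx : ∀ t, 0 ≤ ‖a.scoreVecSum θ (t + 1) ω‖ := fun t => norm_nonneg _
  have b1 : ‖∑ t ∈ Finset.range H, c.γ ^ t • (a.rewardAt t ω • a.scoreVecSum θ (t + 1) ω)‖ ≤
      ∑ t ∈ Finset.range H, √(c.γ ^ t) * (√(c.γ ^ t) * (c.rmax * ‖a.scoreVecSum θ (t + 1) ω‖)) := by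
    refine norm_sum_le_of_le _ fun t _ => ?_
    rw [← mul_assoc, Real.mul_self_sqrt (by positivity), norm_smul, norm_smul,
      Real.norm_of_nonneg (by positivity)]
    exact mul_le_mul_of_nonneg_left
      (mul_le_mul_of_nonneg_right (ha.reward_le _ _) (norm_nonneg _)) (by positivity)
  have b3 := pow_le_pow_left₀ (norm_nonneg _) b1 2
  have b2 := Finset.sum_mul_sq_le_sq_mul_sq (Finset.range H) (fun t => √(c.γ ^ t))
    (fun t => √(c.γ ^ t) * (c.rmax * ‖a.scoreVecSum θ (t + 1) ω‖))
  have e1 : ∑ t ∈ Finset.range H, √(c.γ ^ t) ^ 2 = ∑ t ∈ Finset.range H, c.γ ^ t :=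
    Finset.sum_congr rfl fun t _ => Real.sq_sqrt (pow_nonneg h3.le _)
  have e2 : ∑ t ∈ Finset.range H, (√(c.γ ^ t) * (c.rmax * ‖a.scoreVecSum θ (t + 1) ω‖)) ^ 2 =
      c.rmax ^ 2 * ∑ t ∈ Finset.range H, c.γ ^ t * ‖a.scoreVecSum θ (t + 1) ω‖ ^ 2 := by
    rw [Finset.mul_sum]
    refine Finset.sum_congr rfl fun t _ => ?_
    rw [mul_pow, Real.sq_sqrt (pow_nonneg h3.le _)]
    ring
  rw [e1, e2] at b2
  refine b3.trans (b2.trans ?_)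
  rw [mul_assoc (1 / (1 - c.γ))]
  exact mul_le_mul_of_nonneg_right hgeo (mul_nonneg (sq_nonneg _)
    (Finset.sum_nonneg fun t _ => mul_nonneg (pow_nonneg h3.le _) (sq_nonneg _)))

/-- Second moment of the stochastic gradient. -/
theorem Regular.integral_norm_stochGrad_sq_le (ha : a.Regular c) (hc : c.Valid) (H : ℕ)
    (θ : Par d) : ∫ τ, ‖a.stochGrad c.γ H τ θ‖ ^ 2 ∂(a.trajLaw H θ) ≤ c.sigmaSq := by
  have h1 := hc.Mg_pos
  have h2 := hc.rmax_pos
  have h3 := hc.γ_pos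
  have h4 : 0 < 1 - c.γ := by linarith [hc.γ_lt_one]
  have hm := ha.measurable_stochGrad_left c.γ H θ
  have e : ∀ ω : ℕ → S × A, ‖a.stochGrad c.γ H (fun t : Fin H => ω t) θ‖ ^ 2 =
      ‖∑ t ∈ Finset.range H, c.γ ^ t • (a.rewardAt t ω • a.scoreVecSum θ (t + 1) ω)‖ ^ 2 :=
    fun ω => by rw [stochGrad_eq]
  rw [integral_trajLaw H θ (hm.norm.pow_const 2).stronglyMeasurable,
    integral_congr_ae (Filter.Eventually.of_forall e)]
  have hint : ∀ t, Integrable (fun ω => ‖a.scoreVecSum θ (t + 1) ω‖ ^ 2) (a.pathLaw θ) := by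
    intro t
    refine Integrable.of_bound
      ((ha.measurable_scoreVecSum θ (t + 1)).norm.pow_const 2).aestronglyMeasurable
      (((t + 1 : ℕ) * c.Mg) ^ 2) (Filter.Eventually.of_forall fun ω => ?_)
    rw [norm_pow, norm_norm]
    exact pow_le_pow_left₀ (norm_nonneg _) (ha.norm_scoreVecSum_le _ _ _) 2
  have hp := ha.norm_sum_rewardAt_smul_sq_le hc H θ
  have hint' : Integrable (fun ω => 1 / (1 - c.γ) * c.rmax ^ 2 *
      ∑ t ∈ Finset.range H, c.γ ^ t * ‖a.scoreVecSum θ (t + 1) ω‖ ^ 2) (a.pathLaw θ) :=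
    (integrable_finsetSum _ fun t _ => (hint t).const_mul _).const_mul _
  refine (integral_mono_of_nonneg (Filter.Eventually.of_forall fun ω => sq_nonneg _) hint'
    (Filter.Eventually.of_forall hp)).trans ?_
  rw [integral_const_mul, integral_finsetSum _ fun t _ => (hint t).const_mul _]
  simp only [integral_const_mul]
  have hsum : ∑ t ∈ Finset.range H, c.γ ^ t * ∫ ω, ‖a.scoreVecSum θ (t + 1) ω‖ ^ 2 ∂(a.pathLaw θ) ≤
      c.Mg ^ 2 * (1 / (1 - c.γ) ^ 2) := by
    have q1 := (hasSum_pow_mul_succ hc.γ_pos hc.γ_lt_one).mul_left (c.Mg ^ 2)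
    rw [← q1.tsum_eq]
    refine le_trans (Finset.sum_le_sum fun t _ => ?_)
      (q1.summable.sum_le_tsum (Finset.range H) fun t _ => by positivity)
    refine (mul_le_mul_of_nonneg_left (ha.integral_norm_scoreVecSum_sq_le θ (t + 1))
      (by positivity)).trans (le_of_eq ?_)
    push_cast; ring
  refine (mul_le_mul_of_nonneg_left hsum (by positivity)).trans (le_of_eq ?_)
  rw [Consts.sigmaSq]
  field_simp

end Agent

/-! ### Continuity and measurability in the parameter. -/

namespace Agent
variable {d : ℕ} {S A : Type*} [MeasurableSpace S] [MeasurableSpace A] {a : Agent d S A}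
  {c : Consts}

/-- The second-derivative bound makes the gradient Lipschitz. Continuity makes gradients at random
points measurable. -/
theorem Regular.continuous_gradTerm (ha : a.Regular c) (hc : c.Valid) (t : ℕ) :
    Continuous (a.gradTerm t) := by
  have h1 := hc.Mg_pos
  have h2 := hc.rmax_pos
  have h5 := hc.Mh_pos
  refine (LipschitzWith.of_dist_le_mul (K := Real.toNNReal
    (c.rmax * (t + 1 : ℕ) * (c.Mg ^ 2 + c.Mh))) fun x y => ?_).continuous
  rw [Real.coe_toNNReal _ (by positivity), dist_eq_norm, dist_eq_norm]
  refine norm_le_of_inner (by positivity) fun v => ?_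
  rw [inner_sub_left, ha.inner_gradTerm, ha.inner_gradTerm]
  have := abs_sub_le_of_hasDerivAt (ha.hasDerivAt_dirDeriv (ha.rewardAt_adapted t) y (x - y) v)
    (fun s => ha.abs_dirDerivTwo_le hc (fun ω => ha.reward_le _ _) (y + s • (x - y)) (x - y) v) 1 0
  simpa using this

theorem Regular.continuous_truncGrad (ha : a.Regular c) (hc : c.Valid) (γ : ℝ) (H : ℕ) :
    Continuous (a.truncGrad γ H) :=
  continuous_finsetSum _ fun t _ => (ha.continuous_gradTerm hc t).fun_const_smul _

theorem Regular.norm_pow_smul_gradTerm_le (ha : a.Regular c) (hc : c.Valid) (t : ℕ) (θ : Par d) :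
    ‖c.γ ^ t • a.gradTerm t θ‖ ≤ c.rmax * c.Mg * (c.γ ^ t * ((t : ℝ) + 1)) := by
  have := hc.Mg_pos
  have := hc.rmax_pos
  have := hc.γ_pos
  rw [norm_smul, Real.norm_of_nonneg (by positivity)]
  calc c.γ ^ t * ‖a.gradTerm t θ‖ ≤ c.γ ^ t * (c.rmax * c.Mg * (t + 1)) := by
        refine mul_le_mul_of_nonneg_left ((ha.norm_gradTerm_le hc t θ).trans ?_) (by positivity)
        exact mul_le_mul_of_nonneg_left (sqrt_succ_le t) (by positivity)
    _ = _ := by ring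

theorem Regular.continuous_polGrad (ha : a.Regular c) (hc : c.Valid) :
    Continuous (a.polGrad c.γ) :=
  continuous_tsum (fun t => (ha.continuous_gradTerm hc t).fun_const_smul _)
    ((hasSum_pow_mul_succ hc.γ_pos hc.γ_lt_one).summable.mul_left (c.rmax * c.Mg))
    fun t θ => ha.norm_pow_smul_gradTerm_le hc t θ

theorem Regular.norm_polGrad_le (ha : a.Regular c) (hc : c.Valid) (θ : Par d) :
    ‖a.polGrad c.γ θ‖ ≤ c.rmax * c.Mg * (1 / (1 - c.γ) ^ 2) :=
  (ha.summable_gradTerm hc θ).hasSum.norm_le_of_bounded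
    ((hasSum_pow_mul_succ hc.γ_pos hc.γ_lt_one).mul_left (c.rmax * c.Mg))
    fun t => ha.norm_pow_smul_gradTerm_le hc t θ

theorem Regular.abs_value_le (ha : a.Regular c) (hc : c.Valid) (θ : Par d) :
    |a.value c.γ θ| ≤ (1 - c.γ)⁻¹ * c.rmax := by
  have := hc.γ_pos
  refine (ha.hasSum_value hc θ).norm_le_of_bounded
    ((hasSum_geometric_of_lt_one hc.γ_pos.le hc.γ_lt_one).mul_right c.rmax) fun t => ?_
  rw [norm_mul, Real.norm_of_nonneg (by positivity)]
  refine mul_le_mul_of_nonneg_left ?_ (by positivity)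
  simpa using norm_integral_le_of_norm_le_const (μ := a.pathLaw θ)
    (f := a.rewardAt t) (C := c.rmax) (Filter.Eventually.of_forall fun ω => ha.reward_le _ _)

theorem Regular.measurable_uncurry_dens (ha : a.Regular c) :
    Measurable (Function.uncurry fun (θ : Par d) (x : S × A) => a.dens θ x.1 x.2) :=
  measurable_uncurry_of_continuous_of_measurable
    (fun x => (ha.dens_contDiff x.1 x.2).continuous) a.dens_measurable

/-- Expressed through the fixed law at parameter `0`, the probability of an event becomes an
integral of a jointly measurable likelihood ratio. -/
theorem Regular.measurable_trajLaw (ha : a.Regular c) (H : ℕ) : Measurable (a.trajLaw H) := by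
  refine Measure.measurable_of_measurable_coe _ fun B hB => ?_
  have hm := measurable_restrict_fin (X := S × A) H
  have e : ∀ θ, a.trajLaw H θ B = ∫⁻ ω, ENNReal.ofReal (a.lik 0 θ H ω) *
      ((fun (ω : ℕ → S × A) (t : Fin H) => ω t) ⁻¹' B).indicator 1 ω ∂(a.pathLaw 0) := by
    intro θ
    rw [trajLaw, Measure.map_apply hm hB, ← lintegral_indicator_one (hm hB),
      a.lintegral_pathLaw_lik ha.dens_pos 0 θ H (measurable_one.indicator (hm hB))]
    intro ω ω' hω
    have : (fun t : Fin H => ω t) = fun t : Fin H => ω' t := funext fun t => hω t t.2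
    have h1 : ω ∈ (fun (ω : ℕ → S × A) (t : Fin H) => ω t) ⁻¹' B ↔
        ω' ∈ (fun (ω : ℕ → S × A) (t : Fin H) => ω t) ⁻¹' B := by
      rw [Set.mem_preimage, Set.mem_preimage, this]
    by_cases h2 : ω' ∈ (fun (ω : ℕ → S × A) (t : Fin H) => ω t) ⁻¹' B
    · rw [Set.indicator_of_mem h2, Set.indicator_of_mem (h1.2 h2)]; rfl
    · rw [Set.indicator_of_notMem h2, Set.indicator_of_notMem (mt h1.1 h2)]
  simp only [e]
  refine Measurable.lintegral_prod_right' (f := fun p : Par d × (ℕ → S × A) =>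
    ENNReal.ofReal (a.lik 0 p.1 H p.2) *
      ((fun (ω : ℕ → S × A) (t : Fin H) => ω t) ⁻¹' B).indicator 1 p.2) ?_
  refine Measurable.mul (Measurable.ennreal_ofReal ?_)
    ((measurable_one.indicator (hm hB)).comp measurable_snd)
  refine Finset.measurable_prod _ fun k _ => Measurable.div ?_ ?_
  · exact ha.measurable_uncurry_dens.comp (f := fun p : Par d × (ℕ → S × A) => (p.1, p.2 k))
      (measurable_fst.prodMk ((measurable_pi_apply k).comp measurable_snd))
  · exact (a.dens_measurable 0).comp (f := fun p : Par d × (ℕ → S × A) => p.2 k)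
      ((measurable_pi_apply k).comp measurable_snd)

end Agent

/-! ### Orthogonal sums, and the objective as an average over agents. -/

/-- Expected squared norm of a sum of orthogonal centred vectors. -/
theorem integral_norm_add_sum_sq {Ω ι : Type*} [MeasurableSpace Ω] {μ : Measure Ω}
    [IsProbabilityMeasure μ] {d : ℕ} {X : ι → Ω → Par d} {K : ℝ} (hm : ∀ p, Measurable (X p))
    (hK : ∀ p ω, ‖X p ω‖ ≤ K) (h0 : ∀ p, ∫ ω, X p ω ∂μ = 0)
    (horth : ∀ p q, p ≠ q → ∫ ω, inner ℝ (X p ω) (X q ω) ∂μ = 0) (w : ι → ℝ) (x : Par d)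
    (s : Finset ι) :
    ∫ ω, ‖x + ∑ p ∈ s, w p • X p ω‖ ^ 2 ∂μ = ‖x‖ ^ 2 + ∑ p ∈ s, w p ^ 2 * ∫ ω, ‖X p ω‖ ^ 2 ∂μ := by
  classical
  have hX : ∀ p, Integrable (X p) μ := fun p =>
    Integrable.of_bound (hm p).aestronglyMeasurable K (Filter.Eventually.of_forall (hK p))
  have hin : ∀ p q, Integrable (fun ω => inner ℝ (X p ω) (X q ω)) μ := fun p q =>
    Integrable.of_bound ((hm p).inner (hm q)).aestronglyMeasurable (K * K)
      (Filter.Eventually.of_forall fun ω => (norm_inner_le_norm _ _).trans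
        (mul_le_mul (hK p ω) (hK q ω) (norm_nonneg _) ((norm_nonneg _).trans (hK p ω))))
  induction s using Finset.induction_on with
  | empty => simp
  | insert q s hq ih =>
    have hS : Measurable fun ω => x + ∑ p ∈ s, w p • X p ω :=
      (Finset.measurable_sum _ fun p _ => (hm p).const_smul (w p)).const_add x
    have hSb : ∀ ω, ‖x + ∑ p ∈ s, w p • X p ω‖ ≤ ‖x‖ + ∑ p ∈ s, |w p| * K := fun ω =>
      (norm_add_le _ _).trans (add_le_add_right (norm_sum_le_of_le _ fun p _ => by
        rw [norm_smul, Real.norm_eq_abs]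
        exact mul_le_mul_of_nonneg_left (hK p ω) (abs_nonneg _)) _)
    have i1 : Integrable (fun ω => ‖x + ∑ p ∈ s, w p • X p ω‖ ^ 2) μ :=
      Integrable.of_bound (hS.norm.pow_const 2).aestronglyMeasurable
        ((‖x‖ + ∑ p ∈ s, |w p| * K) ^ 2) (Filter.Eventually.of_forall fun ω => by
          rw [norm_pow, norm_norm]
          exact pow_le_pow_left₀ (norm_nonneg _) (hSb ω) 2)
    have i3 : Integrable (fun ω => w q ^ 2 * ‖X q ω‖ ^ 2) μ := by
      have := (hin q q).const_mul (w q ^ 2)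
      simpa only [real_inner_self_eq_norm_sq] using this
    have ix : Integrable (fun ω => inner ℝ x (X q ω)) μ := (hX q).const_inner x
    have e2 : ∀ ω, 2 * w q * inner ℝ (x + ∑ p ∈ s, w p • X p ω) (X q ω) =
        2 * w q * (inner ℝ x (X q ω) + ∑ p ∈ s, w p * inner ℝ (X p ω) (X q ω)) := by
      intro ω
      rw [inner_add_left, sum_inner]
      simp only [real_inner_smul_left]
    have isum : Integrable (fun ω => ∑ p ∈ s, w p * inner ℝ (X p ω) (X q ω)) μ :=
      integrable_finsetSum _ fun p _ => (hin p q).const_mul _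
    have i2 : Integrable (fun ω => 2 * w q * inner ℝ (x + ∑ p ∈ s, w p • X p ω) (X q ω)) μ := by
      simp only [e2]
      exact (ix.add isum).const_mul _
    have z2 : ∫ ω, 2 * w q * inner ℝ (x + ∑ p ∈ s, w p • X p ω) (X q ω) ∂μ = 0 := by
      simp only [e2]
      rw [integral_const_mul, integral_add ix isum, integral_inner (hX q), h0 q, inner_zero_right,
        integral_finsetSum _ fun p _ => (hin p q).const_mul _]
      have : ∀ p ∈ s, ∫ ω, w p * inner ℝ (X p ω) (X q ω) ∂μ = 0 := fun p hp => by
        rw [integral_const_mul, horth p q (by rintro rfl; exact hq hp), mul_zero]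
      rw [Finset.sum_eq_zero this]
      simp
    have e : ∀ ω, ‖x + ∑ p ∈ insert q s, w p • X p ω‖ ^ 2 =
        (‖x + ∑ p ∈ s, w p • X p ω‖ ^ 2 +
          2 * w q * inner ℝ (x + ∑ p ∈ s, w p • X p ω) (X q ω)) + w q ^ 2 * ‖X q ω‖ ^ 2 := by
      intro ω
      rw [Finset.sum_insert hq, add_comm (w q • X q ω), ← add_assoc, norm_add_sq_real,
        real_inner_smul_right, norm_smul, mul_pow, Real.norm_eq_abs, sq_abs]
      ring
    have i12 : Integrable (fun ω => ‖x + ∑ p ∈ s, w p • X p ω‖ ^ 2 +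
        2 * w q * inner ℝ (x + ∑ p ∈ s, w p • X p ω) (X q ω)) μ := i1.add i2
    rw [integral_congr_ae (Filter.Eventually.of_forall e), integral_add i12 i3, integral_add i1 i2,
      z2, ih, integral_const_mul, Finset.sum_insert hq]
    ring

section Hetero

variable {n d : ℕ} {S A : Fin n → Type*} [∀ i, MeasurableSpace (S i)] [∀ i, MeasurableSpace (A i)]
  {ag : ∀ i, Agent d (S i) (A i)} {c : Consts}

instance trajsLaw_prob (H : ℕ) (θ : Par d) : IsProbabilityMeasure (trajsLaw ag H θ) := by
  unfold trajsLaw; infer_instance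

/-- It suffices to test on the π-system of cylinders, where the law is a finite product. This makes
the trajectory law a kernel in the query point. -/
theorem measurable_trajsLaw (hag : ∀ i, (ag i).Regular c) (H : ℕ) :
    Measurable (trajsLaw ag H) := by
  refine Measurable.measure_of_isPiSystem_of_isProbabilityMeasure
    (generateFrom_squareCylinders (α := fun p : Fin n × ℕ => Fin H → S p.1 × A p.1)).symm
    (isPiSystem_squareCylinders (fun _ => MeasurableSpace.isPiSystem_measurableSet)
      (fun _ => Set.mem_ofPred.2 MeasurableSet.univ)) ?_
  rintro B ⟨s, t, ht, rfl⟩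
  have ht' : ∀ p ∈ s, MeasurableSet (t p) := fun p _ => ht p (Set.mem_univ p)
  have e : ∀ θ, trajsLaw ag H θ (Set.pi s t) = ∏ p ∈ s, (ag p.1).trajLaw H θ (t p) := fun θ =>
    Measure.infinitePi_pi _ ht'
  simp only [e]
  exact Finset.measurable_prod _ fun p hp =>
    (Measure.measurable_coe (ht' p hp)).comp ((hag p.1).measurable_trajLaw H)

variable (ag) in
/-- The gradient of the objective. -/
def objGrad (γ : ℝ) (θ : Par d) : Par d := (1 / n : ℝ) • ∑ i, (ag i).polGrad γ θ

variable (ag) in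
/-- The truncated gradient of the objective. -/
def truncObjGrad (γ : ℝ) (H : ℕ) (θ : Par d) : Par d := (1 / n : ℝ) • ∑ i, (ag i).truncGrad γ H θ

theorem norm_average_le [NeZero n] {x : Fin n → Par d} {K : ℝ} (h : ∀ i, ‖x i‖ ≤ K) :
    ‖(1 / n : ℝ) • ∑ i, x i‖ ≤ K := by
  have hn : (0 : ℝ) < n := Nat.cast_pos.2 (NeZero.pos n)
  rw [norm_smul, Real.norm_of_nonneg (by positivity)]
  refine (mul_le_mul_of_nonneg_left (norm_sum_le_of_le _ fun i _ => h i) (by positivity)).trans ?_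
  simp only [Finset.sum_const, Finset.card_univ, Fintype.card_fin, nsmul_eq_mul]
  rw [← mul_assoc, one_div_mul_cancel hn.ne', one_mul]

theorem abs_average_le [NeZero n] {x : Fin n → ℝ} {K : ℝ} (h : ∀ i, |x i| ≤ K) :
    |(1 / n : ℝ) * ∑ i, x i| ≤ K := by
  have hn : (0 : ℝ) < n := Nat.cast_pos.2 (NeZero.pos n)
  rw [abs_mul, abs_of_nonneg (by positivity)]
  refine (mul_le_mul_of_nonneg_left ((Finset.abs_sum_le_sum_abs _ _).trans
    (Finset.sum_le_sum fun i _ => h i)) (by positivity)).trans ?_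
  simp only [Finset.sum_const, Finset.card_univ, Fintype.card_fin, nsmul_eq_mul]
  rw [← mul_assoc, one_div_mul_cancel hn.ne', one_mul]

theorem abs_objective_taylor_le [NeZero n] (hc : c.Valid) (hag : ∀ i, (ag i).Regular c)
    (θ w : Par d) :
    |objective ag c.γ (θ + w) - objective ag c.γ θ - inner ℝ (objGrad ag c.γ θ) w| ≤
      c.Lg / 2 * ‖w‖ ^ 2 := by
  have := abs_average_le (fun i => (hag i).abs_value_taylor_le hc θ w)
  convert this using 2
  simp only [objective, objGrad, real_inner_smul_left, sum_inner, Finset.sum_sub_distrib]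
  ring

theorem Lg_pos (hc : c.Valid) : 0 < c.Lg := by
  have h1 := hc.Mg_pos
  have h2 := hc.rmax_pos
  have h4 : 0 < 1 - c.γ := by linarith [hc.γ_lt_one]
  have h5 := hc.Mh_pos
  rw [Consts.Lg]; positivity

/-- The quadratic Taylor remainder identifies the gradient directly, without termwise
differentiation of the series. -/
theorem hasGradientAt_objective [NeZero n] (hc : c.Valid) (hag : ∀ i, (ag i).Regular c)
    (θ : Par d) : HasGradientAt (objective ag c.γ) (objGrad ag c.γ θ) θ := by
  rw [hasGradientAt_iff_isLittleO_nhds_zero]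
  refine Asymptotics.IsBigO.trans_isLittleO (g := fun w : Par d => ‖w‖ ^ 2) ?_ ?_
  · refine Asymptotics.IsBigO.of_bound (c.Lg / 2) (Filter.Eventually.of_forall fun w => ?_)
    rw [Real.norm_eq_abs, norm_pow, norm_norm]
    exact abs_objective_taylor_le hc hag θ w
  · exact Asymptotics.isLittleO_norm_pow_id one_lt_two

theorem gradient_objective [NeZero n] (hc : c.Valid) (hag : ∀ i, (ag i).Regular c) :
    ∇ (objective ag c.γ) = objGrad ag c.γ :=
  gradient_eq fun θ => hasGradientAt_objective hc hag θ

theorem norm_objGrad_comb_le [NeZero n] (hc : c.Valid) (hag : ∀ i, (ag i).Regular c)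
    (θ w : Par d) {η : ℝ} (h0 : 0 < η) (h1 : η ≤ 1) :
    ‖(1 - η) • (objGrad ag c.γ (θ - w) - objGrad ag c.γ θ) +
      η • (objGrad ag c.γ (θ + ((1 - η) / η) • w) - objGrad ag c.γ θ)‖ ≤
      7 * c.Lh * ‖w‖ ^ 2 * ((1 - η) / (2 * η)) := by
  have := norm_average_le (fun i => (hag i).norm_polGrad_comb_le hc θ w h0 h1)
  convert this using 2
  simp only [objGrad, Finset.sum_add_distrib, ← Finset.smul_sum, Finset.sum_sub_distrib]
  module

theorem norm_truncObjGrad_sub_le [NeZero n] (hc : c.Valid) (hag : ∀ i, (ag i).Regular c) (H : ℕ)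
    (θ : Par d) : ‖truncObjGrad ag c.γ H θ - objGrad ag c.γ θ‖ ≤ c.γ ^ H * c.Dg H := by
  have := norm_average_le (fun i => (hag i).norm_polGrad_sub_truncGrad_le hc H θ)
  rw [norm_sub_rev, objGrad, truncObjGrad, ← smul_sub, ← Finset.sum_sub_distrib]
  exact this

theorem continuous_objGrad (hc : c.Valid) (hag : ∀ i, (ag i).Regular c) :
    Continuous (objGrad ag c.γ) :=
  (continuous_finsetSum _ fun i _ => (hag i).continuous_polGrad hc).fun_const_smul (1 / n : ℝ)

theorem continuous_truncObjGrad (hc : c.Valid) (hag : ∀ i, (ag i).Regular c) (H : ℕ) :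
    Continuous (truncObjGrad ag c.γ H) :=
  (continuous_finsetSum _ fun i _ => (hag i).continuous_truncGrad hc c.γ H).fun_const_smul
    (1 / n : ℝ)

theorem norm_objGrad_le [NeZero n] (hc : c.Valid) (hag : ∀ i, (ag i).Regular c) (θ : Par d) :
    ‖objGrad ag c.γ θ‖ ≤ c.rmax * c.Mg * (1 / (1 - c.γ) ^ 2) :=
  norm_average_le fun i => (hag i).norm_polGrad_le hc θ

/-- Without boundedness the real supremum in `gap` would take its default value. -/
theorem bddAbove_objective [NeZero n] (hc : c.Valid) (hag : ∀ i, (ag i).Regular c) :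
    BddAbove (Set.range (objective ag c.γ)) :=
  ⟨(1 - c.γ)⁻¹ * c.rmax, by
    rintro _ ⟨θ, rfl⟩
    exact (le_abs_self _).trans (abs_average_le fun i => (hag i).abs_value_le hc θ)⟩

theorem objective_sub_le_gap [NeZero n] (hc : c.Valid) (hag : ∀ i, (ag i).Regular c)
    (θ₀ θ : Par d) : objective ag c.γ θ - objective ag c.γ θ₀ ≤ gap ag c.γ θ₀ :=
  sub_le_sub_right (le_ciSup (bddAbove_objective hc hag) θ) _

theorem gap_nonneg [NeZero n] (hc : c.Valid) (hag : ∀ i, (ag i).Regular c) (θ₀ : Par d) :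
    0 ≤ gap ag c.γ θ₀ := by
  simpa using objective_sub_le_gap hc hag θ₀ θ₀

/-- Progress of one normalized step. -/
theorem norm_objGrad_le_of_step [NeZero n] (hc : c.Valid) (hag : ∀ i, (ag i).Regular c)
    (θ g : Par d) {α : ℝ} (hα : 0 < α) :
    α * ‖objGrad ag c.γ θ‖ ≤ objective ag c.γ (θ + α • (‖g‖⁻¹ • g)) - objective ag c.γ θ +
      2 * α * ‖g - objGrad ag c.γ θ‖ + c.Lg / 2 * α ^ 2 := by
  have hL := Lg_pos hc
  set G := objGrad ag c.γ θ
  set w := α • (‖g‖⁻¹ • g) with hw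
  have hw1 : ‖w‖ ≤ α := by
    rw [hw, norm_smul, norm_smul, norm_inv, norm_norm, Real.norm_of_nonneg hα.le]
    exact mul_le_of_le_one_right hα.le inv_mul_le_one
  have h1 := (abs_le.1 (abs_objective_taylor_le hc hag θ w)).1
  have h2 : c.Lg / 2 * ‖w‖ ^ 2 ≤ c.Lg / 2 * α ^ 2 := by gcongr
  have h3 : inner ℝ g w = α * ‖g‖ := by
    rw [hw, real_inner_smul_right, real_inner_smul_right, real_inner_self_eq_norm_sq]
    rcases eq_or_ne ‖g‖ 0 with h | h
    · simp [h]
    · field_simp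
  have h4 : inner ℝ (g - G) w ≤ ‖g - G‖ * α :=
    (real_inner_le_norm _ _).trans (mul_le_mul_of_nonneg_left hw1 (norm_nonneg _))
  rw [inner_sub_left, h3] at h4
  -- The direction error is paid twice: once when `G` is replaced by `g` in the inner product, once
  -- when `‖g‖` is compared with `‖G‖`.
  have h5 : ‖G‖ ≤ ‖g‖ + ‖g - G‖ := by
    have := norm_sub_le g (g - G)
    simpa using this
  have h6 := mul_le_mul_of_nonneg_left h5 hα.le
  linarith

/-- Small gaps force small gradients. -/
theorem norm_objGrad_sq_le [NeZero n] (hc : c.Valid) (hag : ∀ i, (ag i).Regular c) (θ : Par d) :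
    ‖objGrad ag c.γ θ‖ ^ 2 ≤ 2 * c.Lg * gap ag c.γ θ := by
  have hL := Lg_pos hc
  set G := objGrad ag c.γ θ with hG
  -- A gradient step of length `1 / L_g` gains at least `‖G‖² / (2 L_g)`, and no step can gain more
  -- than the gap.
  have h1 := (abs_le.1 (abs_objective_taylor_le hc hag θ ((1 / c.Lg) • G))).1
  have h2 := objective_sub_le_gap hc hag θ (θ + (1 / c.Lg) • G)
  rw [← hG, real_inner_smul_right, real_inner_self_eq_norm_sq, norm_smul, mul_pow,
    Real.norm_of_nonneg (by positivity)] at h1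
  have h3 : c.Lg / 2 * ((1 / c.Lg) ^ 2 * ‖G‖ ^ 2) = ‖G‖ ^ 2 / (2 * c.Lg) := by field_simp
  have h4 : 1 / c.Lg * ‖G‖ ^ 2 = 2 * (‖G‖ ^ 2 / (2 * c.Lg)) := by field_simp
  have h5 : ‖G‖ ^ 2 / (2 * c.Lg) ≤ gap ag c.γ θ := by linarith
  rw [div_le_iff₀ (by positivity)] at h5
  linarith

end Hetero

/-! ### The aggregated gradient: variance and measurability. -/

section Hetero

variable {n d : ℕ} {S A : Fin n → Type*} [∀ i, MeasurableSpace (S i)] [∀ i, MeasurableSpace (A i)]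
  {ag : ∀ i, Agent d (S i) (A i)} {c : Consts}

variable (ag) in
/-- Centred stochastic gradient of one trajectory. -/
def centredGrad (γ : ℝ) (H : ℕ) (θ : Par d) (p : (_ : Fin n) × ℕ) (τ : Trajs S A H) : Par d :=
  (ag p.1).stochGrad γ H (τ (p.1, p.2)) θ - (ag p.1).truncGrad γ H θ

theorem measurable_centredGrad (hag : ∀ i, (ag i).Regular c) (γ : ℝ) (H : ℕ) (θ : Par d)
    (p : (_ : Fin n) × ℕ) : Measurable (centredGrad ag γ H θ p) :=
  (((hag p.1).measurable_stochGrad_left γ H θ).comp (measurable_pi_apply (p.1, p.2))).sub_const _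

theorem norm_truncGrad_le_bound {S A : Type*} [MeasurableSpace S] [MeasurableSpace A]
    {a : Agent d S A} (hc : c.Valid) (ha : a.Regular c) (H : ℕ) (θ : Par d) :
    ‖a.truncGrad c.γ H θ‖ ≤ H * (H * c.rmax * c.Mg) := by
  rw [← ha.integral_stochGrad]
  simpa using norm_integral_le_of_norm_le_const (μ := a.trajLaw H θ)
    (f := fun τ => a.stochGrad c.γ H τ θ)
    (Filter.Eventually.of_forall fun τ => ha.norm_stochGrad_le hc H τ θ)

theorem norm_centredGrad_le (hc : c.Valid) (hag : ∀ i, (ag i).Regular c) (H : ℕ) (θ : Par d)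
    (p : (_ : Fin n) × ℕ) (τ : Trajs S A H) :
    ‖centredGrad ag c.γ H θ p τ‖ ≤ H * (H * c.rmax * c.Mg) + H * (H * c.rmax * c.Mg) :=
  (norm_sub_le _ _).trans (add_le_add ((hag p.1).norm_stochGrad_le hc H _ θ)
    (norm_truncGrad_le_bound hc (hag p.1) H θ))

theorem integral_trajsLaw_eval {E : Type*} [NormedAddCommGroup E] [NormedSpace ℝ E] (H : ℕ)
    (θ : Par d) (p : Fin n × ℕ) {f : (Fin H → S p.1 × A p.1) → E} (hf : StronglyMeasurable f) :
    ∫ τ, f (τ p) ∂(trajsLaw ag H θ) = ∫ τ, f τ ∂((ag p.1).trajLaw H θ) := by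
  have h := Measure.infinitePi_map_eval (fun p : Fin n × ℕ => (ag p.1).trajLaw H θ) p
  rw [← h, integral_map (measurable_pi_apply p).aemeasurable hf.aestronglyMeasurable]
  rfl

theorem integrable_stochGrad {S A : Type*} [MeasurableSpace S] [MeasurableSpace A]
    {a : Agent d S A} (hc : c.Valid) (ha : a.Regular c) (H : ℕ) (θ : Par d) :
    Integrable (fun τ => a.stochGrad c.γ H τ θ) (a.trajLaw H θ) :=
  Integrable.of_bound (ha.measurable_stochGrad_left c.γ H θ).aestronglyMeasurable _
    (Filter.Eventually.of_forall fun τ => ha.norm_stochGrad_le hc H τ θ)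

theorem integral_centredGrad (hc : c.Valid) (hag : ∀ i, (ag i).Regular c) (H : ℕ) (θ : Par d)
    (p : (_ : Fin n) × ℕ) : ∫ τ, centredGrad ag c.γ H θ p τ ∂(trajsLaw ag H θ) = 0 := by
  have h := integral_trajsLaw_eval (ag := ag) H θ (p.1, p.2)
    (f := fun τ => (ag p.1).stochGrad c.γ H τ θ - (ag p.1).truncGrad c.γ H θ)
    (((hag p.1).measurable_stochGrad_left c.γ H θ).sub_const _).stronglyMeasurable
  refine h.trans ?_
  rw [integral_sub (integrable_stochGrad hc (hag p.1) H θ) (integrable_const _),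
    (hag p.1).integral_stochGrad]
  simp

/-- Two distinct trajectories have a product law, so Fubini reduces the correlation to the mean of
one centred factor. -/
theorem integral_inner_centredGrad (hc : c.Valid) (hag : ∀ i, (ag i).Regular c) (H : ℕ)
    (θ : Par d) {p q : (_ : Fin n) × ℕ} (hpq : p ≠ q) :
    ∫ τ, inner ℝ (centredGrad ag c.γ H θ p τ) (centredGrad ag c.γ H θ q τ)
      ∂(trajsLaw ag H θ) = 0 := by
  have hne : ((p.1, p.2) : Fin n × ℕ) ≠ (q.1, q.2) := by
    rintro h
    obtain ⟨h1, h2⟩ := Prod.mk.injEq .. ▸ h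
    exact hpq (Sigma.ext h1 (heq_of_eq h2))
  have hmap := Measure.infinitePi_map_eval_prod
    (P := fun p : Fin n × ℕ => (ag p.1).trajLaw H θ) hne
  let f : (Fin H → S p.1 × A p.1) → Par d := fun τ =>
    (ag p.1).stochGrad c.γ H τ θ - (ag p.1).truncGrad c.γ H θ
  let g : (Fin H → S q.1 × A q.1) → Par d := fun τ =>
    (ag q.1).stochGrad c.γ H τ θ - (ag q.1).truncGrad c.γ H θ
  have hf : Measurable f := ((hag p.1).measurable_stochGrad_left c.γ H θ).sub_const _
  have hg : Measurable g := ((hag q.1).measurable_stochGrad_left c.γ H θ).sub_const _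
  have ig : Integrable g ((ag q.1).trajLaw H θ) :=
    (integrable_stochGrad hc (hag q.1) H θ).sub (integrable_const _)
  have g0 : ∫ τ, g τ ∂((ag q.1).trajLaw H θ) = 0 := by
    simp only [g]
    rw [integral_sub (integrable_stochGrad hc (hag q.1) H θ) (integrable_const _),
      (hag q.1).integral_stochGrad]
    simp
  have hfg : Measurable fun z : (Fin H → S p.1 × A p.1) × (Fin H → S q.1 × A q.1) =>
      inner ℝ (f z.1) (g z.2) := (hf.comp measurable_fst).inner (hg.comp measurable_snd)
  have hb : Integrable (fun z : (Fin H → S p.1 × A p.1) × (Fin H → S q.1 × A q.1) =>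
      inner ℝ (f z.1) (g z.2)) (((ag p.1).trajLaw H θ).prod ((ag q.1).trajLaw H θ)) := by
    refine Integrable.of_bound hfg.aestronglyMeasurable
      ((H * (H * c.rmax * c.Mg) + H * (H * c.rmax * c.Mg)) *
        (H * (H * c.rmax * c.Mg) + H * (H * c.rmax * c.Mg)))
      (Filter.Eventually.of_forall fun z => (norm_inner_le_norm _ _).trans ?_)
    have b1 : ‖f z.1‖ ≤ H * (H * c.rmax * c.Mg) + H * (H * c.rmax * c.Mg) :=
      (norm_sub_le _ _).trans (add_le_add ((hag p.1).norm_stochGrad_le hc H _ θ)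
        (norm_truncGrad_le_bound hc (hag p.1) H θ))
    have b2 : ‖g z.2‖ ≤ H * (H * c.rmax * c.Mg) + H * (H * c.rmax * c.Mg) :=
      (norm_sub_le _ _).trans (add_le_add ((hag q.1).norm_stochGrad_le hc H _ θ)
        (norm_truncGrad_le_bound hc (hag q.1) H θ))
    exact mul_le_mul b1 b2 (norm_nonneg _) ((norm_nonneg _).trans b1)
  have e : ∫ τ, inner ℝ (centredGrad ag c.γ H θ p τ) (centredGrad ag c.γ H θ q τ)
      ∂(trajsLaw ag H θ) = ∫ z, inner ℝ (f z.1) (g z.2)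
        ∂(((ag p.1).trajLaw H θ).prod ((ag q.1).trajLaw H θ)) := by
    rw [← hmap, integral_map _ hfg.aestronglyMeasurable]
    · rfl
    · exact ((measurable_pi_apply _).prodMk (measurable_pi_apply _)).aemeasurable
  rw [e, integral_prod _ hb]
  simp only [integral_inner ig, g0, inner_zero_right, integral_zero]

/-- Centring only lowers the second moment: the orthogonal decomposition is applied to a single
trajectory, with its mean as the constant part. -/
theorem integral_norm_centredGrad_sq_le (hc : c.Valid) (hag : ∀ i, (ag i).Regular c) (H : ℕ)
    (θ : Par d) (p : (_ : Fin n) × ℕ) :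
    ∫ τ, ‖centredGrad ag c.γ H θ p τ‖ ^ 2 ∂(trajsLaw ag H θ) ≤ c.sigmaSq := by
  have h1 := integral_norm_add_sum_sq (μ := trajsLaw ag H θ)
    (measurable_centredGrad hag c.γ H θ) (norm_centredGrad_le hc hag H θ)
    (integral_centredGrad hc hag H θ) (fun p q => integral_inner_centredGrad hc hag H θ)
    (fun _ => 1) ((ag p.1).truncGrad c.γ H θ) {p}
  have h2 := integral_trajsLaw_eval (ag := ag) H θ (p.1, p.2)
    (f := fun τ => ‖(ag p.1).stochGrad c.γ H τ θ‖ ^ 2)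
    (((hag p.1).measurable_stochGrad_left c.γ H θ).norm.pow_const 2).stronglyMeasurable
  have h3 := (hag p.1).integral_norm_stochGrad_sq_le hc H θ
  have e : ∀ τ, ‖(ag p.1).truncGrad c.γ H θ + ∑ q ∈ {p}, (1 : ℝ) • centredGrad ag c.γ H θ q τ‖ ^ 2 =
      ‖(ag p.1).stochGrad c.γ H (τ (p.1, p.2)) θ‖ ^ 2 := fun τ => by
    rw [Finset.sum_singleton, one_smul, centredGrad, add_sub_cancel]
  rw [integral_congr_ae (Filter.Eventually.of_forall e), h2, Finset.sum_singleton] at h1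
  nlinarith [sq_nonneg ‖(ag p.1).truncGrad c.γ H θ‖]

/-- Writing the error as one sum over pairs (agent, sample) prepares for orthogonality. Every agent
must have delivered, since otherwise its empty average would not centre its mean. -/
theorem aggregate_sub_truncObjGrad (γ : ℝ) (H M : ℕ) (w : ℕ → Fin n) (τ : Trajs S A H) (θ : Par d)
    (hw : ∀ i, 0 < received w (passes M w) i) :
    aggregate ag γ H M w τ θ - truncObjGrad ag γ H θ =
      ∑ p ∈ Finset.univ.sigma (fun i : Fin n => Finset.range (received w (passes M w) i)),
        ((1 / n : ℝ) * (1 / (received w (passes M w) p.1 : ℝ))) • centredGrad ag γ H θ p τ := by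
  rw [Finset.sum_sigma, aggregate, truncObjGrad, ← smul_sub, ← Finset.sum_sub_distrib,
    Finset.smul_sum]
  refine Finset.sum_congr rfl fun i _ => ?_
  have h : (received w (passes M w) i : ℝ) ≠ 0 := Nat.cast_ne_zero.2 (hw i).ne'
  simp only [mul_smul, centredGrad, ← Finset.smul_sum, Finset.sum_sub_distrib, smul_sub]
  congr 2
  change (ag i).truncGrad γ H θ = (1 / (received w (passes M w) i : ℝ)) •
    ∑ _x ∈ Finset.range (received w (passes M w) i), (ag i).truncGrad γ H θ
  rw [Finset.sum_const, Finset.card_range, ← Nat.cast_smul_eq_nsmul ℝ, smul_smul,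
    one_div_mul_cancel h, one_smul]

/-- Variance of the aggregated gradient. -/
theorem integral_norm_add_aggregate_sq_le [NeZero n] (hc : c.Valid)
    (hag : ∀ i, (ag i).Regular c) (H : ℕ) {M : ℕ} (hM : 0 < M) (w : ℕ → Fin n)
    (hw : LoopDone M (received w (passes M w))) (θ x : Par d) (η : ℝ) :
    ∫ τ, ‖x + η • (aggregate ag c.γ H M w τ θ - truncObjGrad ag c.γ H θ)‖ ^ 2
      ∂(trajsLaw ag H θ) ≤ ‖x‖ ^ 2 + η ^ 2 * (c.sigmaSq / M) := by
  have hn : (0 : ℝ) < n := Nat.cast_pos.2 (NeZero.pos n)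
  set m := received w (passes M w) with hm
  have hm0 : ∀ i, (0 : ℝ) < m i := fun i => Nat.cast_pos.2 (hw.1 i)
  simp only [aggregate_sub_truncObjGrad c.γ H M w _ θ hw.1, Finset.smul_sum, smul_smul]
  rw [integral_norm_add_sum_sq (measurable_centredGrad hag c.γ H θ)
    (norm_centredGrad_le hc hag H θ) (integral_centredGrad hc hag H θ)
    (fun p q => integral_inner_centredGrad hc hag H θ)]
  refine add_le_add_right ?_ _
  have hσ : 0 ≤ c.sigmaSq := by
    have h4 : 0 < 1 - c.γ := by linarith [hc.γ_lt_one]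
    rw [Consts.sigmaSq]; positivity
  have e1 : ∑ p ∈ Finset.univ.sigma (fun i : Fin n => Finset.range (m i)),
      (η * ((1 / n : ℝ) * (1 / (m p.1 : ℝ)))) ^ 2 *
        ∫ τ, ‖centredGrad ag c.γ H θ p τ‖ ^ 2 ∂(trajsLaw ag H θ) ≤
      ∑ p ∈ Finset.univ.sigma (fun i : Fin n => Finset.range (m i)),
      (η * ((1 / n : ℝ) * (1 / (m p.1 : ℝ)))) ^ 2 * c.sigmaSq :=
    Finset.sum_le_sum fun p _ => mul_le_mul_of_nonneg_left
      (integral_norm_centredGrad_sq_le hc hag H θ p) (sq_nonneg _)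
  refine e1.trans ?_
  -- Agent `i` contributes `m i` samples of squared weight `1 / (n * m i)²`, so the total is
  -- governed by the mean of the `1 / m i`, the quantity in the stopping rule.
  have e2 : ∑ p ∈ Finset.univ.sigma (fun i : Fin n => Finset.range (m i)),
      (η * ((1 / n : ℝ) * (1 / (m p.1 : ℝ)))) ^ 2 * c.sigmaSq =
      η ^ 2 * c.sigmaSq * (1 / n) * ((1 / n : ℝ) * ∑ i, 1 / (m i : ℝ)) := by
    rw [Finset.sum_sigma, Finset.mul_sum, Finset.mul_sum]
    refine Finset.sum_congr rfl fun i _ => ?_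
    have := (hm0 i).ne'
    simp only [Finset.sum_const, Finset.card_range, nsmul_eq_mul]
    field_simp
  have hsum : 0 < (1 / n : ℝ) * ∑ i, 1 / (m i : ℝ) :=
    mul_pos (by positivity) (Finset.sum_pos (fun i _ => one_div_pos.2 (hm0 i))
      ⟨⟨0, NeZero.pos n⟩, Finset.mem_univ _⟩)
  have hMr : (0 : ℝ) < M := Nat.cast_pos.2 hM
  have e3 : (1 / n : ℝ) * ∑ i, 1 / (m i : ℝ) ≤ n / M := by
    have h := hw.2
    rw [le_inv_comm₀ (by positivity) hsum, inv_div] at h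
    exact h
  rw [e2]
  refine (mul_le_mul_of_nonneg_left e3 (by positivity)).trans (le_of_eq ?_)
  field_simp

theorem measurable_received (l : ℕ) (i : Fin n) :
    Measurable fun w : ℕ → Fin n => received w l i := by
  have : (fun w : ℕ → Fin n => received w l i) = fun w =>
      ∑ l' ∈ Finset.range l, if w l' = i then 1 else 0 := by
    funext w; rw [received, Finset.card_filter]
  rw [this]
  exact Finset.measurable_sum _ fun l' _ =>
    (measurable_of_countable (fun j : Fin n => if j = i then 1 else 0)).comp (measurable_pi_apply l')

theorem measurableSet_loopDone (M l : ℕ) :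
    MeasurableSet {w : ℕ → Fin n | LoopDone M (received w l)} := by
  have : Measurable fun w : ℕ → Fin n => received w l :=
    measurable_pi_iff.2 fun i => measurable_received l i
  exact this (MeasurableSet.of_discrete (s := {m : Fin n → ℕ | LoopDone M m}))

/-- Each level set is a countable combination of events of finitely many passes. The level `0` also
contains the orders for which the loop never stops, because of the default value of `sInf`. -/
theorem measurable_passes (M : ℕ) : Measurable fun w : ℕ → Fin n => passes M w := by
  classical
  have e : ∀ w : ℕ → Fin n, ∀ m, passes M w = m ↔
      ((LoopDone M (received w m) ∧ ∀ l < m, ¬ LoopDone M (received w l)) ∨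
        (m = 0 ∧ ∀ l, ¬ LoopDone M (received w l))) := by
    intro w m
    by_cases h : ∃ l, LoopDone M (received w l)
    · have h1 : passes M w = Nat.find h := Nat.sInf_def h
      rw [h1, Nat.find_eq_iff]
      constructor
      · exact fun h2 => .inl h2
      · rintro (h2 | ⟨_, h2⟩)
        · exact h2
        · exact absurd h.choose_spec (h2 _)
    · push Not at h
      have h1 : passes M w = 0 := by
        rw [passes, Nat.sInf_eq_zero]
        exact .inr (Set.eq_empty_iff_forall_notMem.2 h)
      rw [h1]
      constructor
      · rintro rfl
        exact .inr ⟨rfl, h⟩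
      · rintro (h2 | h2)
        · exact absurd h2.1 (h _)
        · exact h2.1.symm
  refine measurable_to_countable' fun m => ?_
  have e' : (fun w : ℕ → Fin n => passes M w) ⁻¹' {m} =
      {w | (LoopDone M (received w m) ∧ ∀ l < m, ¬ LoopDone M (received w l)) ∨
        (m = 0 ∧ ∀ l, ¬ LoopDone M (received w l))} := by
    ext w; exact e w m
  rw [e']
  have hL := fun l => measurableSet_loopDone (n := n) M l
  refine MeasurableSet.union (MeasurableSet.inter (hL m) ?_) (MeasurableSet.inter (.const _) ?_)
  · have : {w : ℕ → Fin n | ∀ l < m, ¬ LoopDone M (received w l)} =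
        ⋂ l, ⋂ (_ : l < m), {w : ℕ → Fin n | LoopDone M (received w l)}ᶜ := by
      ext w; simp
    change MeasurableSet {w : ℕ → Fin n | ∀ l < m, ¬ LoopDone M (received w l)}
    rw [this]
    exact MeasurableSet.iInter fun l => MeasurableSet.iInter fun _ => (hL l).compl
  · have : {w : ℕ → Fin n | ∀ l, ¬ LoopDone M (received w l)} =
        ⋂ l, {w : ℕ → Fin n | LoopDone M (received w l)}ᶜ := by
      ext w; simp
    change MeasurableSet {w : ℕ → Fin n | ∀ l, ¬ LoopDone M (received w l)}
    rw [this]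
    exact MeasurableSet.iInter fun l => (hL l).compl

/-- The counts take countably many values, so joint measurability may be checked with a count
frozen. -/
theorem measurable_aggregate (hag : ∀ i, (ag i).Regular c) (γ : ℝ) (H M : ℕ) :
    Measurable fun p : (ℕ → Fin n) × Trajs S A H × Par d =>
      aggregate ag γ H M p.1 p.2.1 p.2.2 := by
  have hN : ∀ i, Measurable fun w : ℕ → Fin n => received w (passes M w) i := fun i =>
    (measurable_from_prod_countable_right (f := fun p : ℕ × (ℕ → Fin n) => received p.2 p.1 i)
      fun l => measurable_received l i).comp (f := fun w : ℕ → Fin n => (passes M w, w))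
      ((measurable_passes M).prodMk measurable_id)
  have hG : ∀ i, Measurable fun p : ℕ × (Trajs S A H × Par d) => (1 / (p.1 : ℝ)) •
      ∑ j ∈ Finset.range p.1, (ag i).stochGrad γ H (p.2.1 (i, j)) p.2.2 := fun i => by
    refine measurable_from_prod_countable_right fun N => ?_
    have : Measurable fun q : Trajs S A H × Par d =>
        ∑ j ∈ Finset.range N, (ag i).stochGrad γ H (q.1 (i, j)) q.2 :=
      Finset.measurable_sum _ fun j _ => ((hag i).measurable_stochGrad γ H).comp
        (f := fun q : Trajs S A H × Par d => (q.1 (i, j), q.2))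
        (((measurable_pi_apply (i, j)).comp measurable_fst).prodMk measurable_snd)
    exact this.const_smul (1 / (N : ℝ))
  have : Measurable fun p : (ℕ → Fin n) × Trajs S A H × Par d =>
      ∑ i, (1 / (received p.1 (passes M p.1) i : ℝ)) •
        ∑ j ∈ Finset.range (received p.1 (passes M p.1) i),
          (ag i).stochGrad γ H (p.2.1 (i, j)) p.2.2 :=
    Finset.measurable_sum _ fun i _ => (hG i).comp
      (f := fun p : (ℕ → Fin n) × Trajs S A H × Par d => (received p.1 (passes M p.1) i, p.2))
      (((hN i).comp measurable_fst).prodMk measurable_snd)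
  exact this.const_smul (1 / n : ℝ)

end Hetero

/-! ### Measurability of a run and conditioning on the past. -/

section Hetero

variable {n d : ℕ} {S A : Fin n → Type*} [∀ i, MeasurableSpace (S i)] [∀ i, MeasurableSpace (A i)]
  {ag : ∀ i, Agent d (S i) (A i)} {c : Consts}

namespace Run

variable {γ η α : ℝ} {θ₀ : Par d} {Minit M H : ℕ}
  {Ω : Type*} [mΩ : MeasurableSpace Ω] {P : Measure Ω}

/-- The batch size of call `k`. -/
def batchOf (Minit M k : ℕ) : ℕ := if k = 0 then Minit else M

/-- The vector returned by call `k`. -/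
def output (R : Run ag γ η α θ₀ Minit M H P) (k : ℕ) (ω : Ω) : Par d :=
  aggregate ag γ H (batchOf Minit M k) (fun l => R.who k l ω) (R.traj k ω) (R.query k ω)

variable (R : Run ag γ η α θ₀ Minit M H P)

theorem measurable_who (k : ℕ) : Measurable[R.hist k] fun ω l => R.who k l ω :=
  @measurable_pi_iff _ _ _ (R.hist k) _ _ |>.2 fun l => R.who_measurable k l

theorem measurable_aggregate_comp {X : Type*} [MeasurableSpace X] (hag : ∀ i, (ag i).Regular c)
    (γ : ℝ) (H M : ℕ) {w : X → ℕ → Fin n} {τ : X → Trajs S A H} {θ : X → Par d}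
    (hw : Measurable w) (hτ : Measurable τ) (hθ : Measurable θ) :
    Measurable fun x => aggregate ag γ H M (w x) (τ x) (θ x) := by
  exact Measurable.comp (g := fun p : (ℕ → Fin n) × Trajs S A H × Par d =>
    aggregate ag γ H M p.1 p.2.1 p.2.2) (f := fun x => (w x, τ x, θ x))
    (measurable_aggregate hag γ H M) (hw.prodMk (hτ.prodMk hθ))

theorem measurable_output_of (hag : ∀ i, (ag i).Regular c) (k : ℕ)
    (hq : Measurable[R.hist k] (R.query k)) : Measurable[R.hist (k + 1)] (R.output k) := by
  have hle := R.hist.mono (Nat.le_succ k)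
  have h1 : Measurable[R.hist (k + 1)] fun ω l => R.who k l ω :=
    (R.measurable_who k).mono hle le_rfl
  have h2 : Measurable[R.hist (k + 1)] (R.query k) := hq.mono hle le_rfl
  exact @measurable_aggregate_comp n d S A _ _ ag c Ω (R.hist (k + 1)) hag γ H (batchOf Minit M k)
    _ _ _ h1 (R.traj_measurable k) h2

/-- Iterates and query points are known when a call starts, the momentum vector only when it ends;
the shift in the filtration index allows the trajectories to be integrated out. -/
theorem measurable_state (hag : ∀ i, (ag i).Regular c) (t : ℕ) :
    Measurable[R.hist t] (R.iter t) ∧ Measurable[R.hist t] (R.query t) ∧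
      Measurable[R.hist (t + 1)] (R.dir t) := by
  induction t with
  | zero =>
    have h1 : R.iter 0 = fun _ => θ₀ := funext R.iter_zero
    have h2 : R.query 0 = fun _ => θ₀ := funext R.query_zero
    have hq : Measurable[R.hist 0] (R.query 0) := h2 ▸ measurable_const
    have h3 : R.dir 0 = R.output 0 := funext R.dir_zero
    exact ⟨h1 ▸ measurable_const, hq, h3 ▸ R.measurable_output_of hag 0 hq⟩
  | succ t ih =>
    obtain ⟨hi, _, hd⟩ := ih
    have hi' := hi.mono (R.hist.mono (Nat.le_succ t)) le_rfl
    have h1 : R.iter (t + 1) = fun ω => R.iter t ω + α • (‖R.dir t ω‖⁻¹ • R.dir t ω) :=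
      funext (R.iter_succ t)
    have hi1 : Measurable[R.hist (t + 1)] (R.iter (t + 1)) := by
      rw [h1]
      have h : Measurable fun x : Par d => α • (‖x‖⁻¹ • x) :=
        (measurable_norm.inv.smul measurable_id).const_smul α
      exact hi'.add (h.comp hd)
    have h2 : R.query (t + 1) = fun ω =>
        R.iter (t + 1) ω + ((1 - η) / η) • (R.iter (t + 1) ω - R.iter t ω) :=
      funext (R.query_succ t)
    have hq : Measurable[R.hist (t + 1)] (R.query (t + 1)) := by
      rw [h2]
      exact hi1.add ((hi1.sub hi').const_smul ((1 - η) / η))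
    have h3 : R.dir (t + 1) = fun ω => (1 - η) • R.dir t ω + η • R.output (t + 1) ω :=
      funext (R.dir_succ t)
    refine ⟨hi1, hq, ?_⟩
    rw [h3]
    exact ((hd.mono (R.hist.mono (Nat.le_succ _)) le_rfl).const_smul (1 - η)).add
      ((R.measurable_output_of hag (t + 1) hq).const_smul η)

theorem measurable_iter (hag : ∀ i, (ag i).Regular c) (t : ℕ) : Measurable (R.iter t) :=
  (R.measurable_state hag t).1.mono (R.hist.le t) le_rfl

/-- The trajectories of call `k` can be integrated out given the past. -/
theorem lintegral_traj [IsProbabilityMeasure P] (k : ℕ) {E : Type*} [MeasurableSpace E] {Y : Ω → E}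
    (hY : Measurable[R.hist k] Y) (κ : Kernel E (Trajs S A H)) [IsMarkovKernel κ]
    (hκ : ∀ ω, κ (Y ω) = trajsLaw ag H (R.query k ω)) {F : E × Trajs S A H → ℝ≥0∞}
    (hF : Measurable F) :
    ∫⁻ ω, F (Y ω, R.traj k ω) ∂P = ∫⁻ ω, ∫⁻ τ, F (Y ω, τ) ∂(trajsLaw ag H (R.query k ω)) ∂P := by
  have hle := R.hist.le k
  have hY' : Measurable Y := hY.mono hle le_rfl
  have hT : Measurable (R.traj k) := (R.traj_measurable k).mono (R.hist.le _) le_rfl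
  have : IsProbabilityMeasure (P.map Y) := Measure.isProbabilityMeasure_map hY'.aemeasurable
  -- The conditional law is given set by set. On rectangles the defining property of conditional
  -- expectation yields the joint law as a composition with a kernel, and rectangles determine it.
  have key : P.map (fun ω => (Y ω, R.traj k ω)) = P.map Y ⊗ₘ κ := by
    have : IsProbabilityMeasure (P.map fun ω => (Y ω, R.traj k ω)) :=
      Measure.isProbabilityMeasure_map (hY'.prodMk hT).aemeasurable
    refine Measure.ext_prod fun {s t} hs ht => ?_
    rw [Measure.map_apply (hY'.prodMk hT) (hs.prod ht), Measure.compProd_apply_prod hs ht,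
      setLIntegral_map hs (κ.measurable_coe ht) hY']
    have hset : (fun ω => (Y ω, R.traj k ω)) ⁻¹' s ×ˢ t = R.traj k ⁻¹' t ∩ Y ⁻¹' s := by
      ext ω; simp [and_comm]
    have hi : Integrable ((R.traj k ⁻¹' t).indicator fun _ => (1 : ℝ)) P :=
      (integrable_const 1).indicator (hT ht)
    have h1 := setIntegral_condExp (μ := P) hle hi (hY hs)
    rw [setIntegral_congr_ae (hle _ (hY hs)) ((R.traj_law k t ht).mono fun ω h _ => h),
      integral_indicator_const (1 : ℝ) (hT ht)] at h1
    have h2 : ∫ ω in Y ⁻¹' s, (trajsLaw ag H (R.query k ω)).real t ∂P =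
        (∫⁻ ω in Y ⁻¹' s, κ (Y ω) t ∂P).toReal := by
      simp only [measureReal_def, ← hκ]
      refine integral_toReal ((κ.measurable_coe ht).comp hY').aemeasurable
        (Filter.Eventually.of_forall fun ω => ?_)
      exact measure_lt_top _ _
    rw [h2, smul_eq_mul, mul_one, measureReal_def, Measure.restrict_apply (hT ht)] at h1
    rw [hset]
    have hfin : ∫⁻ ω in Y ⁻¹' s, κ (Y ω) t ∂P ≠ ∞ := by
      refine ne_top_of_le_ne_top ENNReal.one_ne_top ?_
      calc ∫⁻ ω in Y ⁻¹' s, κ (Y ω) t ∂P ≤ ∫⁻ _ in Y ⁻¹' s, 1 ∂P :=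
            lintegral_mono fun ω => prob_le_one
        _ ≤ 1 := by simpa using prob_le_one
    exact ((ENNReal.toReal_eq_toReal_iff' hfin (measure_ne_top _ _)).1 h1).symm
  rw [← lintegral_map (f := F) hF (hY'.prodMk hT), key, Measure.lintegral_compProd hF,
    lintegral_map hF.lintegral_kernel_prod_right' hY']
  simp only [hκ]

/-- Noise of call `k`. -/
def noise (k : ℕ) (ω : Ω) : Par d := R.output k ω - truncObjGrad ag γ H (R.query k ω)

end Run

namespace Run

variable {η α : ℝ} {θ₀ : Par d} {Minit M H : ℕ}
  {Ω : Type*} [mΩ : MeasurableSpace Ω] {P : Measure Ω} (R : Run ag c.γ η α θ₀ Minit M H P)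

theorem measurable_noise (hc : c.Valid) (hag : ∀ i, (ag i).Regular c) (k : ℕ) :
    Measurable[R.hist (k + 1)] (R.noise k) := by
  have hq := (R.measurable_state hag k).2.1
  exact (R.measurable_output_of hag k hq).sub ((continuous_truncObjGrad hc hag H).measurable.comp
    (hq.mono (R.hist.mono (Nat.le_succ k)) le_rfl))

theorem aggregate_norm_le [NeZero n] (hc : c.Valid) (hag : ∀ i, (ag i).Regular c) (H M : ℕ)
    (w : ℕ → Fin n) (τ : Trajs S A H) (θ : Par d) :
    ‖aggregate ag c.γ H M w τ θ‖ ≤ H * (H * c.rmax * c.Mg) := by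
  have h1 := hc.Mg_pos
  have h2 := hc.rmax_pos
  refine norm_average_le fun i => ?_
  set m := received w (passes M w) i
  rw [norm_smul, Real.norm_of_nonneg (by positivity)]
  refine (mul_le_mul_of_nonneg_left (norm_sum_le_of_le _ fun j _ =>
    (hag i).norm_stochGrad_le hc H _ θ) (by positivity)).trans ?_
  rw [Finset.sum_const, Finset.card_range, nsmul_eq_mul, ← mul_assoc]
  refine mul_le_of_le_one_left (by positivity) ?_
  rw [one_div]
  exact inv_mul_le_one

/-- One step of the noise recursion. -/
theorem lintegral_norm_add_noise_sq_le [NeZero n] [IsProbabilityMeasure P] (hc : c.Valid)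
    (hag : ∀ i, (ag i).Regular c) (k : ℕ) (hM : 0 < batchOf Minit M k)
    (hw : ∀ ω, LoopDone (batchOf Minit M k) (received (fun l => R.who k l ω)
      (passes (batchOf Minit M k) fun l => R.who k l ω)))
    {x : Ω → Par d} (hx : Measurable[R.hist k] x) (e : ℝ) :
    ∫⁻ ω, ENNReal.ofReal (‖x ω + e • R.noise k ω‖ ^ 2) ∂P ≤
      ∫⁻ ω, ENNReal.ofReal (‖x ω‖ ^ 2) ∂P +
        ENNReal.ofReal (e ^ 2 * (c.sigmaSq / batchOf Minit M k)) := by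
  have hq := (R.measurable_state hag k).2.1
  set Mk := batchOf Minit M k
  -- The past enters through `x`, the query point and the entire order of arrival. With these
  -- frozen, the variance bound for a deterministic order applies pointwise.
  let κ : Kernel (Par d × Par d × (ℕ → Fin n)) (Trajs S A H) :=
    ⟨fun p => trajsLaw ag H p.2.1, (measurable_trajsLaw hag H).comp
      (measurable_fst.comp measurable_snd)⟩
  have : IsMarkovKernel κ := ⟨fun p => trajsLaw_prob H p.2.1⟩
  have hY : Measurable[R.hist k] fun ω => (x ω, R.query k ω, fun l => R.who k l ω) :=
    hx.prodMk (hq.prodMk (R.measurable_who k))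
  have hG : Measurable fun p : (Par d × Par d × (ℕ → Fin n)) × Trajs S A H =>
      p.1.1 + e • (aggregate ag c.γ H Mk p.1.2.2 p.2 p.1.2.1 - truncObjGrad ag c.γ H p.1.2.1) := by
    have m1 : Measurable fun p : (Par d × Par d × (ℕ → Fin n)) × Trajs S A H => p.1.2.1 :=
      measurable_fst.comp (measurable_snd.comp measurable_fst)
    have m2 : Measurable fun p : (Par d × Par d × (ℕ → Fin n)) × Trajs S A H => p.1.2.2 :=
      measurable_snd.comp (measurable_snd.comp measurable_fst)
    have m3 : Measurable fun p : (Par d × Par d × (ℕ → Fin n)) × Trajs S A H =>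
        aggregate ag c.γ H Mk p.1.2.2 p.2 p.1.2.1 :=
      measurable_aggregate_comp hag c.γ H Mk m2 measurable_snd m1
    have m4 : Measurable fun p : (Par d × Par d × (ℕ → Fin n)) × Trajs S A H => p.1.1 :=
      measurable_fst.comp measurable_fst
    exact m4.add ((m3.sub ((continuous_truncObjGrad hc hag H).measurable.comp m1)).const_smul e)
  have h := R.lintegral_traj k hY κ (fun ω => rfl) (hG.norm.pow_const 2).ennreal_ofReal
  refine (le_of_eq h).trans ?_
  have hs : 0 ≤ c.sigmaSq := by
    have h1 : 0 < 1 - c.γ := by linarith [hc.γ_lt_one]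
    unfold Consts.sigmaSq
    positivity
  calc _ ≤ ∫⁻ ω, (ENNReal.ofReal (‖x ω‖ ^ 2) +
        ENNReal.ofReal (e ^ 2 * (c.sigmaSq / Mk))) ∂P := lintegral_mono fun ω => ?_
    _ = _ := by rw [lintegral_add_right _ measurable_const, lintegral_const, measure_univ, mul_one]
  have hb : Integrable (fun τ => ‖x ω + e • (aggregate ag c.γ H Mk (fun l => R.who k l ω) τ
      (R.query k ω) - truncObjGrad ag c.γ H (R.query k ω))‖ ^ 2)
      (trajsLaw ag H (R.query k ω)) := by
    have := trajsLaw_prob (ag := ag) H (R.query k ω)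
    have hm : Measurable fun τ => x ω + e • (aggregate ag c.γ H Mk (fun l => R.who k l ω) τ
        (R.query k ω) - truncObjGrad ag c.γ H (R.query k ω)) :=
      hG.comp (measurable_const.prodMk measurable_id : Measurable fun τ : Trajs S A H =>
        ((x ω, R.query k ω, fun l => R.who k l ω), τ))
    refine Integrable.of_bound (hm.norm.pow_const 2).aestronglyMeasurable
      ((‖x ω‖ + |e| * (H * (H * c.rmax * c.Mg) + ‖truncObjGrad ag c.γ H (R.query k ω)‖)) ^ 2)
      (Filter.Eventually.of_forall fun τ => ?_)
    rw [norm_pow, norm_norm]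
    refine pow_le_pow_left₀ (norm_nonneg _) ((norm_add_le _ _).trans ?_) 2
    rw [norm_smul, Real.norm_eq_abs]
    gcongr
    refine (norm_sub_le _ _).trans ?_
    gcongr
    exact aggregate_norm_le hc hag H Mk _ τ _
  change ∫⁻ τ, ENNReal.ofReal (‖x ω + e • (aggregate ag c.γ H Mk (fun l => R.who k l ω) τ
      (R.query k ω) - truncObjGrad ag c.γ H (R.query k ω))‖ ^ 2) ∂_ ≤ _
  rw [← ofReal_integral_eq_lintegral_ofReal hb (Filter.Eventually.of_forall fun _ => by positivity),
    ← ENNReal.ofReal_add (by positivity) (by positivity)]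
  exact ENNReal.ofReal_le_ofReal
    (integral_norm_add_aggregate_sq_le hc hag H hM _ (hw ω) _ _ e)

end Run

end Hetero

/-! ### Error of the momentum and convergence of the iterates. -/

section Hetero

variable {n d : ℕ} {S A : Fin n → Type*} [∀ i, MeasurableSpace (S i)] [∀ i, MeasurableSpace (A i)]
  {ag : ∀ i, Agent d (S i) (A i)} {c : Consts}

namespace Run

variable {η α : ℝ} {θ₀ : Par d} {Minit M H : ℕ}
  {Ω : Type*} [mΩ : MeasurableSpace Ω] {P : Measure Ω} (R : Run ag c.γ η α θ₀ Minit M H P)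

/-- Accumulated noise in the momentum. -/
def noiseSum : ℕ → Ω → Par d
  | 0 => R.noise 0
  | t + 1 => fun ω => (1 - η) • noiseSum t ω + η • R.noise (t + 1) ω

theorem noiseSum_succ (t : ℕ) (ω : Ω) :
    R.noiseSum (t + 1) ω = (1 - η) • R.noiseSum t ω + η • R.noise (t + 1) ω := rfl

/-- Bias of the momentum. -/
def drift (t : ℕ) (ω : Ω) : Par d := R.dir t ω - R.noiseSum t ω - objGrad ag c.γ (R.iter t ω)

theorem measurable_noiseSum (hc : c.Valid) (hag : ∀ i, (ag i).Regular c) (t : ℕ) :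
    Measurable[R.hist (t + 1)] (R.noiseSum t) := by
  induction t with
  | zero => exact R.measurable_noise hc hag 0
  | succ t ih =>
    exact ((ih.mono (R.hist.mono (Nat.le_succ _)) le_rfl).const_smul (1 - η)).add
      ((R.measurable_noise hc hag (t + 1)).const_smul η)

theorem dir_zero_eq (ω : Ω) : R.dir 0 ω = R.output 0 ω := R.dir_zero ω

theorem dir_succ_eq (t : ℕ) (ω : Ω) :
    R.dir (t + 1) ω = (1 - η) • R.dir t ω + η • R.output (t + 1) ω := R.dir_succ t ω

theorem norm_iter_succ_sub_le (hα : 0 ≤ α) (t : ℕ) (ω : Ω) :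
    ‖R.iter (t + 1) ω - R.iter t ω‖ ≤ α := by
  rw [R.iter_succ, add_sub_cancel_left, norm_smul, norm_smul, norm_inv, norm_norm,
    Real.norm_of_nonneg hα]
  exact mul_le_of_le_one_right hα inv_mul_le_one

/-- The new drift is `1 - η` times the old one, plus `η` times the truncation bias, plus an
extrapolation error without linear term. The stated bound is preserved by this recursion, which
explains the division by `η` a second time. -/
theorem norm_drift_le [NeZero n] (hc : c.Valid) (hag : ∀ i, (ag i).Regular c) (hη : 0 < η)
    (hη1 : η ≤ 1) (hα : 0 ≤ α) (hL : 0 ≤ c.Lh) (t : ℕ) (ω : Ω) :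
    ‖R.drift t ω‖ ≤ c.γ ^ H * c.Dg H + 7 * c.Lh * α ^ 2 * (1 - η) / (2 * η ^ 2) := by
  have h1η : 0 ≤ 1 - η := by linarith
  induction t with
  | zero =>
    have e : R.drift 0 ω = truncObjGrad ag c.γ H (R.iter 0 ω) - objGrad ag c.γ (R.iter 0 ω) := by
      rw [drift, noiseSum, noise, dir_zero_eq, R.query_zero, R.iter_zero]
      abel
    rw [e]
    refine (norm_truncObjGrad_sub_le hc hag H _).trans (le_add_of_nonneg_right ?_)
    positivity
  | succ t ih =>
    set w := R.iter (t + 1) ω - R.iter t ω with hw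
    have hq : R.query (t + 1) ω = R.iter (t + 1) ω + ((1 - η) / η) • w := R.query_succ t ω
    have hi : R.iter t ω = R.iter (t + 1) ω - w := by rw [hw]; abel
    have e : R.drift (t + 1) ω = (1 - η) • R.drift t ω +
        η • (truncObjGrad ag c.γ H (R.query (t + 1) ω) - objGrad ag c.γ (R.query (t + 1) ω)) +
        ((1 - η) • (objGrad ag c.γ (R.iter (t + 1) ω - w) - objGrad ag c.γ (R.iter (t + 1) ω)) +
          η • (objGrad ag c.γ (R.iter (t + 1) ω + ((1 - η) / η) • w) -
            objGrad ag c.γ (R.iter (t + 1) ω))) := by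
      rw [← hi, ← hq, drift, drift, noiseSum_succ, noise, dir_succ_eq]
      module
    have hwα : ‖w‖ ≤ α := R.norm_iter_succ_sub_le hα t ω
    rw [e]
    have h1 : ‖(1 - η) • R.drift t ω‖ ≤ (1 - η) * (c.γ ^ H * c.Dg H +
        7 * c.Lh * α ^ 2 * (1 - η) / (2 * η ^ 2)) := by
      rw [norm_smul, Real.norm_of_nonneg h1η]
      gcongr
    have h2 : ‖η • (truncObjGrad ag c.γ H (R.query (t + 1) ω) -
        objGrad ag c.γ (R.query (t + 1) ω))‖ ≤ η * (c.γ ^ H * c.Dg H) := by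
      rw [norm_smul, Real.norm_of_nonneg hη.le]
      gcongr
      exact norm_truncObjGrad_sub_le hc hag H _
    have h3 := norm_objGrad_comb_le hc hag (R.iter (t + 1) ω) w hη hη1
    have h4 : 7 * c.Lh * ‖w‖ ^ 2 * ((1 - η) / (2 * η)) ≤
        η * (7 * c.Lh * α ^ 2 * (1 - η) / (2 * η ^ 2)) := by
      calc _ ≤ 7 * c.Lh * α ^ 2 * ((1 - η) / (2 * η)) := by gcongr
        _ = _ := by field_simp
    refine (norm_add₃_le).trans ?_
    linarith

/-- Noise of a call is centred given the past, so second moments obey `V' ≤ (1 - η)² V + η² σ² / M`.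
Since `(1 - η)² η + η² ≤ η`, the stationary part `η σ² / M` is preserved. -/
theorem lintegral_norm_noiseSum_sq_le [NeZero n] [IsProbabilityMeasure P] (hc : c.Valid)
    (hag : ∀ i, (ag i).Regular c) (hMi : 0 < Minit) (hM : 0 < M)
    (hw : ∀ k ω, LoopDone (batchOf Minit M k) (received (fun l => R.who k l ω)
      (passes (batchOf Minit M k) fun l => R.who k l ω))) (hη : 0 < η) (hη1 : η ≤ 1) (t : ℕ) :
    ∫⁻ ω, ENNReal.ofReal (‖R.noiseSum t ω‖ ^ 2) ∂P ≤ ENNReal.ofReal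
      ((1 - η) ^ (2 * t) * (c.sigmaSq / Minit) + η * (c.sigmaSq / M)) := by
  have hσ : 0 ≤ c.sigmaSq := by
    have h1 : 0 < 1 - c.γ := by linarith [hc.γ_lt_one]
    unfold Consts.sigmaSq
    positivity
  have h1η : 0 ≤ 1 - η := by linarith
  induction t with
  | zero =>
    have h := R.lintegral_norm_add_noise_sq_le hc hag 0 hMi (hw 0) (x := fun _ => 0)
      measurable_const 1
    simp only [zero_add, one_smul, norm_zero, ne_eq, OfNat.ofNat_ne_zero, not_false_eq_true,
      zero_pow, ENNReal.ofReal_zero, lintegral_zero, one_pow, one_mul] at h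
    refine h.trans (ENNReal.ofReal_le_ofReal ?_)
    rw [mul_zero, pow_zero, one_mul]
    exact le_add_of_nonneg_right (by positivity)
  | succ t ih =>
    have h := R.lintegral_norm_add_noise_sq_le hc hag (t + 1) hM (hw (t + 1))
      (x := fun ω => (1 - η) • R.noiseSum t ω)
      ((R.measurable_noiseSum hc hag t).const_smul (1 - η)) η
    refine h.trans ?_
    have e : ∀ ω, ENNReal.ofReal (‖(1 - η) • R.noiseSum t ω‖ ^ 2) =
        ENNReal.ofReal ((1 - η) ^ 2) * ENNReal.ofReal (‖R.noiseSum t ω‖ ^ 2) := fun ω => by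
      rw [norm_smul, mul_pow, Real.norm_of_nonneg h1η, ENNReal.ofReal_mul (by positivity)]
    simp only [e]
    rw [lintegral_const_mul' _ _ ENNReal.ofReal_ne_top]
    refine (add_le_add_left (mul_le_mul_right ih _) _).trans ?_
    rw [← ENNReal.ofReal_mul (by positivity), ← ENNReal.ofReal_add (by positivity) (by positivity)]
    refine ENNReal.ofReal_le_ofReal ?_
    have hb : batchOf Minit M (t + 1) = M := rfl
    rw [hb]
    have h5 : 0 ≤ c.sigmaSq / M := by positivity
    have h6 : η ^ 2 ≤ η := by nlinarith
    have h7 : ((1 - η) ^ 2 * η + η ^ 2) * (c.sigmaSq / M) ≤ η * (c.sigmaSq / M) := by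
      gcongr
      nlinarith
    calc _ = (1 - η) ^ (2 * (t + 1)) * (c.sigmaSq / Minit) +
          ((1 - η) ^ 2 * η + η ^ 2) * (c.sigmaSq / M) := by ring
      _ ≤ _ := by linarith

/-- Passing from second to first moment uses `x ≤ s / 2 + x² / (2 s)`, the tangent of the square
root at `s²`. -/
theorem integral_norm_noiseSum_le [NeZero n] [IsProbabilityMeasure P] (hc : c.Valid)
    (hag : ∀ i, (ag i).Regular c) (hMi : 0 < Minit) (hM : 0 < M)
    (hw : ∀ k ω, LoopDone (batchOf Minit M k) (received (fun l => R.who k l ω)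
      (passes (batchOf Minit M k) fun l => R.who k l ω))) (hη : 0 < η) (hη1 : η ≤ 1)
    {u v : ℝ} (hu : 0 < u) (hv : 0 < v) (hi : c.sigmaSq / Minit ≤ u ^ 2)
    (h : η * (c.sigmaSq / M) ≤ v ^ 2) (t : ℕ) :
    Integrable (fun ω => ‖R.noiseSum t ω‖) P ∧
      ∫ ω, ‖R.noiseSum t ω‖ ∂P ≤ (1 - η) ^ t * u + v := by
  have h1η : 0 ≤ 1 - η := by linarith
  have hm : Measurable (R.noiseSum t) := (R.measurable_noiseSum hc hag t).mono (R.hist.le _) le_rfl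
  set s := (1 - η) ^ t * u + v with hs
  have hs0 : 0 < s := by positivity
  have hl := R.lintegral_norm_noiseSum_sq_le hc hag hMi hM hw hη hη1 t
  have hsq : Integrable (fun ω => ‖R.noiseSum t ω‖ ^ 2) P := by
    refine ⟨(hm.norm.pow_const 2).aestronglyMeasurable, ?_⟩
    rw [hasFiniteIntegral_iff_ofReal (Filter.Eventually.of_forall fun _ => by positivity)]
    exact hl.trans_lt ENNReal.ofReal_lt_top
  have hσ : 0 ≤ c.sigmaSq := by
    have h1 : 0 < 1 - c.γ := by linarith [hc.γ_lt_one]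
    unfold Consts.sigmaSq
    positivity
  have h2 : ∫ ω, ‖R.noiseSum t ω‖ ^ 2 ∂P ≤ s ^ 2 := by
    rw [← ofReal_integral_eq_lintegral_ofReal hsq
      (Filter.Eventually.of_forall fun _ => by positivity),
      ENNReal.ofReal_le_ofReal_iff (by positivity)] at hl
    refine hl.trans ?_
    have h3 : (1 - η) ^ (2 * t) * (c.sigmaSq / Minit) ≤ (1 - η) ^ (2 * t) * u ^ 2 := by gcongr
    have h4 : 0 ≤ (1 - η) ^ t * u * v := by positivity
    calc _ ≤ (1 - η) ^ (2 * t) * u ^ 2 + v ^ 2 := add_le_add h3 h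
      _ ≤ (1 - η) ^ (2 * t) * u ^ 2 + v ^ 2 + 2 * ((1 - η) ^ t * u * v) := by linarith
      _ = s ^ 2 := by rw [hs]; ring
  have h3 : ∀ ω, ‖R.noiseSum t ω‖ ≤ s / 2 + (2 * s)⁻¹ * ‖R.noiseSum t ω‖ ^ 2 := fun ω => by
    have : 0 ≤ (2 * s)⁻¹ * (‖R.noiseSum t ω‖ - s) ^ 2 := by positivity
    have e : (2 * s)⁻¹ * (‖R.noiseSum t ω‖ - s) ^ 2 =
        (2 * s)⁻¹ * ‖R.noiseSum t ω‖ ^ 2 - ‖R.noiseSum t ω‖ + s / 2 := by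
      field_simp
      ring
    linarith
  have hg : Integrable (fun ω => s / 2 + (2 * s)⁻¹ * ‖R.noiseSum t ω‖ ^ 2) P :=
    (integrable_const _).add (hsq.const_mul _)
  have hint : Integrable (fun ω => ‖R.noiseSum t ω‖) P :=
    hg.mono' hm.norm.aestronglyMeasurable (Filter.Eventually.of_forall fun ω => by
      rw [norm_norm]; exact h3 ω)
  refine ⟨hint, (integral_mono hint hg h3).trans ?_⟩
  rw [integral_add (integrable_const _) (hsq.const_mul _), integral_const_mul, integral_const,
    probReal_univ, one_smul]
  calc _ ≤ s / 2 + (2 * s)⁻¹ * s ^ 2 := by gcongr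
    _ = s := by field_simp; ring

/-- The gains of the normalized steps telescope to at most the gap; the errors accumulate
additively. -/
theorem sum_norm_objGrad_le [NeZero n] (hc : c.Valid) (hag : ∀ i, (ag i).Regular c) (hα : 0 < α)
    {δ : ℝ} (hδ : ∀ t ω, ‖R.drift t ω‖ ≤ δ) (T : ℕ) (ω : Ω) :
    ∑ t ∈ Finset.range T, ‖objGrad ag c.γ (R.iter t ω)‖ ≤ gap ag c.γ θ₀ / α +
      2 * ∑ t ∈ Finset.range T, ‖R.noiseSum t ω‖ + T * (2 * δ + c.Lg / 2 * α) := by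
  have h1 : ∀ t, α * ‖objGrad ag c.γ (R.iter t ω)‖ ≤
      (objective ag c.γ (R.iter (t + 1) ω) - objective ag c.γ (R.iter t ω)) +
        α * (2 * ‖R.noiseSum t ω‖) + α * (2 * δ + c.Lg / 2 * α) := fun t => by
    have h2 := norm_objGrad_le_of_step hc hag (R.iter t ω) (R.dir t ω) hα
    rw [← R.iter_succ t ω] at h2
    have h3 : ‖R.dir t ω - objGrad ag c.γ (R.iter t ω)‖ ≤ ‖R.noiseSum t ω‖ + δ := by
      have : R.dir t ω - objGrad ag c.γ (R.iter t ω) = R.noiseSum t ω + R.drift t ω := by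
        rw [drift]; abel
      rw [this]
      exact (norm_add_le _ _).trans (add_le_add_right (hδ t ω) _)
    have h4 := mul_le_mul_of_nonneg_left h3 hα.le
    linarith
  have h5 := Finset.sum_le_sum fun t (_ : t ∈ Finset.range T) => h1 t
  rw [Finset.sum_add_distrib, Finset.sum_add_distrib, Finset.sum_range_sub
    (fun t => objective ag c.γ (R.iter t ω)), Finset.sum_const, Finset.card_range, nsmul_eq_mul,
    ← Finset.mul_sum, ← Finset.mul_sum, ← Finset.mul_sum, R.iter_zero] at h5
  have h6 := objective_sub_le_gap hc hag θ₀ (R.iter T ω)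
  refine le_of_mul_le_mul_left ?_ hα
  have h7 : α * (gap ag c.γ θ₀ / α) = gap ag c.γ θ₀ := by field_simp
  linarith

theorem integrable_norm_objGrad [NeZero n] [IsFiniteMeasure P] (hc : c.Valid)
    (hag : ∀ i, (ag i).Regular c) (t : ℕ) :
    Integrable (fun ω => ‖objGrad ag c.γ (R.iter t ω)‖) P :=
  Integrable.of_bound (((continuous_objGrad hc hag).measurable.comp
    (R.measurable_iter hag t)).norm).aestronglyMeasurable _
    (Filter.Eventually.of_forall fun ω => by
      rw [norm_norm]; exact norm_objGrad_le hc hag (R.iter t ω))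

/-- Convergence of the method in terms of its parameters. -/
theorem sum_integral_norm_objGrad_le [NeZero n] [IsProbabilityMeasure P] (hc : c.Valid)
    (hag : ∀ i, (ag i).Regular c) (hMi : 0 < Minit) (hM : 0 < M)
    (hw : ∀ k ω, LoopDone (batchOf Minit M k) (received (fun l => R.who k l ω)
      (passes (batchOf Minit M k) fun l => R.who k l ω))) (hη : 0 < η) (hη1 : η ≤ 1) (hα : 0 < α)
    (hL : 0 ≤ c.Lh) {u v : ℝ} (hu : 0 < u) (hv : 0 < v) (hi : c.sigmaSq / Minit ≤ u ^ 2)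
    (h : η * (c.sigmaSq / M) ≤ v ^ 2) (T : ℕ) :
    ∑ t ∈ Finset.range T, ∫ ω, ‖objGrad ag c.γ (R.iter t ω)‖ ∂P ≤
      gap ag c.γ θ₀ / α + 2 * (u / η) + T * (2 * v + 2 * (c.γ ^ H * c.Dg H +
        7 * c.Lh * α ^ 2 * (1 - η) / (2 * η ^ 2)) + c.Lg / 2 * α) := by
  have hN := R.integral_norm_noiseSum_le hc hag hMi hM hw hη hη1 hu hv hi h
  rw [← integral_finsetSum _ fun t _ => R.integrable_norm_objGrad hc hag t]
  have hsum : Integrable (fun ω => ∑ t ∈ Finset.range T, ‖R.noiseSum t ω‖) P :=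
    integrable_finsetSum _ fun t _ => (hN t).1
  refine (integral_mono (integrable_finsetSum _ fun t _ => R.integrable_norm_objGrad hc hag t)
    (((integrable_const _).add (hsum.const_mul 2)).add (integrable_const _))
    (R.sum_norm_objGrad_le hc hag hα (R.norm_drift_le hc hag hη hη1 hα.le hL) T)).trans ?_
  rw [integral_add' ((integrable_const _).add (hsum.const_mul 2)) (integrable_const _),
    integral_add' (integrable_const _) (hsum.const_mul 2), integral_const_mul,
    integral_finsetSum _ fun t _ => (hN t).1]
  simp only [integral_const, probReal_univ, one_smul]
  have h1 : ∑ t ∈ Finset.range T, ∫ ω, ‖R.noiseSum t ω‖ ∂P ≤ u / η + T * v := by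
    refine (Finset.sum_le_sum fun t _ => (hN t).2).trans ?_
    rw [Finset.sum_add_distrib, ← Finset.sum_mul, Finset.sum_const, Finset.card_range,
      nsmul_eq_mul]
    -- The noise of the initial batch is forgotten geometrically, so it costs `u / η` in total and
    -- not `T * u`.
    have h2 : (∑ t ∈ Finset.range T, (1 - η) ^ t) ≤ 1 / η := by
      rw [le_div_iff₀ hη]
      have := geom_sum_mul_neg (1 - η) T
      have h3 : 0 ≤ (1 - η) ^ T := pow_nonneg (by linarith) _
      rw [show 1 - (1 - η) = η by ring] at this
      linarith
    have h4 := mul_le_mul_of_nonneg_right h2 hu.le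
    rw [one_div_mul_eq_div] at h4
    linarith
  linarith

theorem integral_withUniformIndex [IsProbabilityMeasure P] {T : ℕ} (hT : 0 < T)
    {f : ℕ → Ω → ℝ} (hf : ∀ t, Integrable (f t) P) :
    Integrable (fun p : Ω × Fin T => f p.2 p.1) (withUniformIndex P T) ∧
      ∫ p, f p.2 p.1 ∂(withUniformIndex P T) =
        (1 / T : ℝ) * ∑ t ∈ Finset.range T, ∫ ω, f t ω ∂P := by
  have hne : Nonempty (Fin T) := ⟨⟨0, hT⟩⟩
  have hp : IsProbabilityMeasure (uniformOn (Set.univ : Set (Fin T))) :=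
    isProbabilityMeasure_uniformOn Set.finite_univ Set.univ_nonempty
  have hsingle : ∀ t : Fin T, (uniformOn (Set.univ : Set (Fin T))).real {t} = 1 / T := fun t => by
    rw [measureReal_def, uniformOn_univ]
    simp
  have hI : Integrable (fun p : Ω × Fin T => f p.2 p.1) (withUniformIndex P T) := by
    have e : (fun p : Ω × Fin T => f p.2 p.1) = fun p => ∑ t : Fin T,
        f t p.1 * (({t} : Set (Fin T)).indicator (fun _ => (1 : ℝ)) p.2) := by
      ext p
      rw [Finset.sum_eq_single p.2]
      · simp
      · intro t _ ht
        simp [Set.indicator, ht.symm]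
      · simp
    rw [e]
    exact integrable_finsetSum _ fun t _ => (hf t).mul_prod
      (g := ({t} : Set (Fin T)).indicator fun _ => (1 : ℝ))
      ((integrable_const 1).indicator (measurableSet_singleton t))
  refine ⟨hI, ?_⟩
  rw [withUniformIndex] at hI ⊢
  rw [integral_prod_symm _ hI, integral_fintype (Integrable.of_finite), Finset.mul_sum,
    Finset.sum_range]
  exact Finset.sum_congr rfl fun t _ => by rw [hsingle, smul_eq_mul]

end Run

end Hetero

/-! ### Termination of the aggregation loop and the duration of a call. -/

section Received

variable {n : ℕ}

theorem received_zero (w : ℕ → Fin n) (i : Fin n) : received w 0 i = 0 := by simp [received]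

theorem received_succ (w : ℕ → Fin n) (l : ℕ) (i : Fin n) :
    received w (l + 1) i = received w l i + if w l = i then 1 else 0 := by
  rw [received, received, Finset.range_add_one, Finset.filter_insert]
  split_ifs with h
  · rw [Finset.card_insert_of_notMem (by simp)]
  · rfl

theorem sum_received (w : ℕ → Fin n) (l : ℕ) : ∑ i, received w l i = l := by
  induction l with
  | zero => simp [received_zero]
  | succ l ih => simp [received_succ, Finset.sum_add_distrib, ih]

/-- A deliberately wasteful criterion, used only to show that the loop ends. -/
theorem loopDone_of_le [NeZero n] {M : ℕ} {m : Fin n → ℕ} (h : ∀ i, M + 1 ≤ m i) :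
    LoopDone M m := by
  have hn : (1 : ℝ) ≤ n := by exact_mod_cast NeZero.one_le
  have hM : (0 : ℝ) < M + 1 := by positivity
  have hm : ∀ i, (M : ℝ) + 1 ≤ m i := fun i => by exact_mod_cast h i
  have hm0 : ∀ i, (0 : ℝ) < m i := fun i => hM.trans_le (hm i)
  refine ⟨fun i => by have := h i; omega, ?_⟩
  have h1 : (1 / n : ℝ) * ∑ i, 1 / (m i : ℝ) ≤ 1 / (M + 1) := by
    have h2 : ∑ i, 1 / (m i : ℝ) ≤ ∑ _i : Fin n, 1 / ((M : ℝ) + 1) :=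
      Finset.sum_le_sum fun i _ => one_div_le_one_div_of_le hM (hm i)
    rw [Finset.sum_const, Finset.card_univ, Fintype.card_fin, nsmul_eq_mul] at h2
    calc _ ≤ (1 / n : ℝ) * (n * (1 / (M + 1))) := by gcongr
      _ = _ := by field_simp
  have h3 : 0 < (1 / n : ℝ) * ∑ i, 1 / (m i : ℝ) := by
    refine mul_pos (by positivity) (Finset.sum_pos (fun i _ => one_div_pos.2 (hm0 i)) ?_)
    exact Finset.univ_nonempty
  calc (M : ℝ) / n ≤ M := div_le_self (by positivity) hn
    _ ≤ M + 1 := by linarith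
    _ ≤ _ := by
      rw [le_inv_comm₀ hM h3, ← one_div]
      exact h1

/-- If the gradients are received in the order in which they are completed and every agent
completes finitely many in bounded time, then every agent delivers infinitely often. -/
theorem exists_le_received {w : ℕ → Fin n} {start : Fin n → ℝ} {comp : Fin n → ℕ → ℝ}
    (hs : ∀ i, 0 ≤ start i) (hc : ∀ i j, 0 ≤ comp i j)
    (ht : ∀ i, Filter.Tendsto (fun m => ∑ j ∈ Finset.range m, comp i j) Filter.atTop Filter.atTop)
    (ho : ∀ l i, start (w l) + ∑ j ∈ Finset.range (received w l (w l) + 1), comp (w l) j ≤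
      start i + ∑ j ∈ Finset.range (received w l i + 1), comp i j) (N : ℕ) (i : Fin n) :
    ∃ l, N ≤ received w l i := by
  by_contra! hlt
  -- If agent `i` never reaches `N` deliveries, its pending gradient is due by time `X`, so
  -- everything ever received is completed by `X`. Each agent completes boundedly many gradients by
  -- then, whereas the number of passes is unbounded.
  set X := start i + ∑ j ∈ Finset.range N, comp i j
  have hX : ∀ l, ∑ j ∈ Finset.range (received w l (w l) + 1), comp (w l) j ≤ X := fun l => by
    have h1 := ho l i
    have h2 : ∑ j ∈ Finset.range (received w l i + 1), comp i j ≤ ∑ j ∈ Finset.range N, comp i j :=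
      Finset.sum_le_sum_of_subset_of_nonneg (Finset.range_mono (hlt l)) fun j _ _ => hc i j
    have h3 := hs (w l)
    linarith
  have hK : ∀ i', ∃ K, ∀ m, K ≤ m → X < ∑ j ∈ Finset.range m, comp i' j := fun i' =>
    Filter.eventually_atTop.1 ((ht i').eventually_gt_atTop X)
  choose K hK using hK
  have hle : ∀ l i', received w l i' ≤ K i' := fun l => by
    induction l with
    | zero => intro i'; simp [received_zero]
    | succ l ih =>
      intro i'
      rw [received_succ]
      split_ifs with h
      · by_contra! hgt
        exact absurd (h ▸ hX l) (not_le.2 (hK i' _ (by omega)))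
      · exact ih i'
  have h1 := sum_received w (∑ i', K i' + 1)
  have h2 := Finset.sum_le_sum fun i' (_ : i' ∈ Finset.univ) => hle (∑ i', K i' + 1) i'
  omega

theorem received_mono (w : ℕ → Fin n) (i : Fin n) : Monotone fun l => received w l i :=
  monotone_nat_of_le_succ fun l => by rw [received_succ]; omega

/-- The loop is left after finitely many passes. -/
theorem loopDone_passes [NeZero n] {w : ℕ → Fin n} (h : ∀ N i, ∃ l, N ≤ received w l i) (M : ℕ) :
    LoopDone M (received w (passes M w)) := by
  choose l hl using h (M + 1)
  refine Nat.sInf_mem (s := {l : ℕ | LoopDone M (received w l)}) ⟨∑ i, l i, ?_⟩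
  exact loopDone_of_le fun i => (hl i).trans (received_mono w i
    (Finset.single_le_sum (fun _ _ => Nat.zero_le _) (Finset.mem_univ i)))

/-- Harmonic mean estimate for an unfinished loop. -/
theorem le_of_not_loopDone [NeZero n] {M : ℕ} {m : Fin n → ℕ} (h : ¬ LoopDone M m) {x : ℝ}
    {b : Fin n → ℝ} {b' : ℝ} (hb : ∀ i, 0 ≤ b i) (hb' : ∀ i, b i ≤ b')
    (hle : ∀ i, x ≤ (m i + 1) * b i) :
    x ≤ b' + 2 * ((1 / n : ℝ) * ∑ i, b i) * (M / n) := by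
  have hn : (0 : ℝ) < n := Nat.cast_pos.2 (NeZero.pos n)
  have hB : 0 ≤ (1 / n : ℝ) * ∑ i, b i :=
    mul_nonneg (by positivity) (Finset.sum_nonneg fun i _ => hb i)
  by_cases h0 : ∀ i, 0 < m i
  · have h1 : ((1 / n : ℝ) * ∑ i, 1 / (m i : ℝ))⁻¹ < (M : ℝ) / n := by
      by_contra! hge
      exact h ⟨h0, hge⟩
    have hm : ∀ i, (1 : ℝ) ≤ m i := fun i => by exact_mod_cast h0 i
    have hq : 0 < (1 / n : ℝ) * ∑ i, 1 / (m i : ℝ) := by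
      refine mul_pos (by positivity) (Finset.sum_pos (fun i _ => ?_) Finset.univ_nonempty)
      exact one_div_pos.2 (by linarith [hm i])
    -- As `m i ≥ 1`, one has `m i + 1 ≤ 2 * m i`, hence `x / m i ≤ 2 * b i`; averaging over the
    -- agents brings in the harmonic mean.
    have h2 : x * ((1 / n : ℝ) * ∑ i, 1 / (m i : ℝ)) ≤ 2 * ((1 / n : ℝ) * ∑ i, b i) := by
      have h3 : ∑ i, x * (1 / (m i : ℝ)) ≤ ∑ i, 2 * b i := Finset.sum_le_sum fun i _ => by
        rw [mul_one_div, div_le_iff₀ (by linarith [hm i])]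
        refine (hle i).trans ?_
        nlinarith [hm i, hb i]
      rw [← Finset.mul_sum, ← Finset.mul_sum] at h3
      calc _ = (1 / n : ℝ) * (x * ∑ i, 1 / (m i : ℝ)) := by ring
        _ ≤ (1 / n : ℝ) * (2 * ∑ i, b i) := by gcongr
        _ = _ := by ring
    have h4 : x ≤ 2 * ((1 / n : ℝ) * ∑ i, b i) * ((1 / n : ℝ) * ∑ i, 1 / (m i : ℝ))⁻¹ := by
      rw [← div_eq_mul_inv, le_div_iff₀ hq]
      exact h2
    have h5 : 0 ≤ b' := (hb 0).trans (hb' 0)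
    have h6 := mul_le_mul_of_nonneg_left h1.le (by linarith : 0 ≤ 2 * ((1 / n : ℝ) * ∑ i, b i))
    linarith
  -- An agent that has delivered nothing gives `x ≤ b i` at once; this is where the slowest agent
  -- enters.
  · push Not at h0
    obtain ⟨i, hi⟩ := h0
    have h1 := hle i
    rw [Nat.le_zero.1 hi, Nat.cast_zero, zero_add, one_mul] at h1
    have : 0 ≤ 2 * ((1 / n : ℝ) * ∑ i, b i) * (M / n) := by positivity
    linarith [hb' i]

end Received

section Hetero

variable {n d : ℕ} {S A : Fin n → Type*} [∀ i, MeasurableSpace (S i)] [∀ i, MeasurableSpace (A i)]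
  {ag : ∀ i, Agent d (S i) (A i)}

namespace Run

namespace Timing

variable {γ η α : ℝ} {θ₀ : Par d} {Minit M H : ℕ}
  {Ω : Type*} [mΩ : MeasurableSpace Ω] {P : Measure Ω}
  {R : Run ag γ η α θ₀ Minit M H P} {κ : ℝ} {hdot : Fin n → ℝ}

theorem loopDone [NeZero n] (𝒯 : R.Timing κ hdot) (k : ℕ) (ω : Ω) : LoopDone (batchOf Minit M k)
    (received (fun l => R.who k l ω) (passes (batchOf Minit M k) fun l => R.who k l ω)) :=
  loopDone_passes (exists_le_received (start := fun i => 𝒯.recv k i ω)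
    (comp := fun i j => 𝒯.comp k i j ω) (fun i => (𝒯.recv_mem k i ω).1)
    (fun i j => (𝒯.comp_mem k i j ω).1) (fun i => 𝒯.comp_tendsto k i ω)
    fun l i => 𝒯.order k l ω i) _

theorem mul_nonneg_of_mem (𝒯 : R.Timing κ hdot) (i : Fin n) (ω : Ω) : 0 ≤ hdot i * H :=
  (𝒯.comp_mem 0 i 0 ω).1.trans (𝒯.comp_mem 0 i 0 ω).2

/-- The last gradient received is completed no later than the next pending gradient of any agent
`i`, which takes at most `m i + 1` computations. The two `κ` are for broadcasting and returning. -/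
theorem callTime_le [NeZero n] (𝒯 : R.Timing κ hdot) (hh : Monotone hdot) (k : ℕ) (ω : Ω) :
    𝒯.callTime k ω ≤ 2 * κ + H * (hdot ⊤ +
      2 * ((1 / n : ℝ) * ∑ i, hdot i) * (batchOf Minit M k / n)) := by
  set w := fun l => R.who k l ω with hw
  set p := passes (batchOf Minit M k) w with hp
  have hdone := 𝒯.loopDone k ω
  have hp0 : p ≠ 0 := fun h0 => by
    have := hdone.1 0
    rw [← hw, ← hp, h0, received_zero] at this
    exact lt_irrefl _ this
  obtain ⟨l, hl⟩ := Nat.exists_eq_succ_of_ne_zero hp0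
  -- The counts before the last pass are used: at that moment the stopping rule still fails.
  have hnot : ¬ LoopDone (batchOf Minit M k) (received w l) :=
    Nat.notMem_of_lt_sInf (s := {l : ℕ | LoopDone (batchOf Minit M k) (received w l)})
      (show l < p by omega)
  have hb := fun i => 𝒯.mul_nonneg_of_mem i ω
  have hbt : ∀ i, hdot i * H ≤ hdot ⊤ * H := fun i =>
    mul_le_mul_of_nonneg_right (hh le_top) (Nat.cast_nonneg H)
  have hle : ∀ i, 𝒯.clock k ω (l + 1) - κ ≤ (received w l i + 1) * (hdot i * H) := fun i => by
    have h1 : 𝒯.clock k ω (l + 1) ≤ _ := 𝒯.order k l ω i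
    have h2 : ∑ j ∈ Finset.range (received w l i + 1), 𝒯.comp k i j ω ≤
        (received w l i + 1) * (hdot i * H) := by
      refine (Finset.sum_le_sum fun j _ => (𝒯.comp_mem k i j ω).2).trans (le_of_eq ?_)
      rw [Finset.sum_const, Finset.card_range, nsmul_eq_mul]
      push_cast
      ring
    have h3 := (𝒯.recv_mem k i ω).2
    linarith
  have hsum : ∑ i, hdot i * H = H * ∑ i, hdot i := by rw [← Finset.sum_mul, mul_comm]
  have hmain : 𝒯.clock k ω (l + 1) - κ ≤ hdot ⊤ * H +
      2 * ((1 / n : ℝ) * ∑ i, hdot i * H) * (batchOf Minit M k / n) := by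
    exact le_of_not_loopDone hnot hb hbt hle
  rw [hsum] at hmain
  have hret := (𝒯.ret_mem k ω).2
  have e : 𝒯.callTime k ω = 𝒯.clock k ω (l + 1) + 𝒯.ret k ω := by
    change 𝒯.clock k ω p + _ = _
    rw [hl]
  rw [e]
  calc _ ≤ 2 * κ + (hdot ⊤ * H + 2 * ((1 / n : ℝ) * (H * ∑ i, hdot i)) *
        (batchOf Minit M k / n)) := by linarith
    _ = _ := by ring

theorem elapsed_le [NeZero n] (𝒯 : R.Timing κ hdot) (hh : Monotone hdot) (T : ℕ) (ω : Ω) :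
    𝒯.elapsed (T + 1) ω ≤ T * (2 * κ + H * hdot ⊤) +
      2 * (H * ((1 / n : ℝ) * ∑ i, hdot i)) * ((Minit + T * M) / n) := by
  have hm : 0 ≤ H * ((1 / n : ℝ) * ∑ i, hdot i) := by
    have := Finset.sum_nonneg fun i (_ : i ∈ Finset.univ) => 𝒯.mul_nonneg_of_mem i ω
    rw [← Finset.sum_mul] at this
    have h2 : (H : ℝ) * ((1 / n : ℝ) * ∑ i, hdot i) = (1 / n : ℝ) * ((∑ i, hdot i) * H) := by ring
    rw [h2]
    positivity
  rw [elapsed, Nat.add_sub_cancel]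
  refine (Finset.sum_le_sum fun k _ => 𝒯.callTime_le hh k ω).trans ?_
  have hk : ∀ k, 2 * κ + H * (hdot ⊤ + 2 * ((1 / n : ℝ) * ∑ i, hdot i) * (batchOf Minit M k / n)) =
      (2 * κ + H * hdot ⊤) +
        2 * (H * ((1 / n : ℝ) * ∑ i, hdot i)) * ((1 / n) * batchOf Minit M k) := fun k => by ring
  have hsum : ∑ k ∈ Finset.range T, (batchOf Minit M k : ℝ) ≤ Minit + T * M := by
    calc _ ≤ ∑ k ∈ Finset.range T, ((if k = 0 then (Minit : ℝ) else 0) + M) :=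
          Finset.sum_le_sum fun k _ => by
            unfold batchOf
            split_ifs
            · exact le_add_of_nonneg_right (by positivity)
            · rw [zero_add]
      _ ≤ _ := by
        rw [Finset.sum_add_distrib, Finset.sum_const, Finset.card_range, nsmul_eq_mul]
        gcongr
        rw [Finset.sum_ite_eq']
        split_ifs
        · exact le_rfl
        · positivity
  simp only [hk]
  rw [Finset.sum_add_distrib, Finset.sum_const, Finset.card_range, nsmul_eq_mul, ← Finset.mul_sum,
    ← Finset.mul_sum]
  refine add_le_add le_rfl (mul_le_mul_of_nonneg_left ?_ (mul_nonneg zero_le_two hm))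
  rw [one_div_mul_eq_div]
  gcongr

end Timing

end Run

end Hetero

/-! ### Consequences of the choice of batch sizes, momentum, step size and horizon. -/

namespace Consts

variable {c : Consts} {ε Δ : ℝ}

theorem sigmaSq_pos (hc : c.Valid) : 0 < c.sigmaSq := by
  have h1 := hc.Mg_pos
  have h2 := hc.rmax_pos
  have h4 : 0 < 1 - c.γ := by linarith [hc.γ_lt_one]
  rw [sigmaSq]; positivity

theorem Lh_pos (hc : c.Valid) : 0 < c.Lh := by
  have h0 := hc.γ_pos
  have h1 := hc.Mg_pos
  have h2 := hc.rmax_pos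
  have h3 := hc.Mh_pos
  have h4 : 0 < 1 - c.γ := by linarith [hc.γ_lt_one]
  rw [Lh]
  have h5 := h3.trans_le (le_max_left c.Mh (max (c.γ * c.Mg ^ 2 / (1 - c.γ))
    (max (c.l2 / ((1 - c.γ) * c.Mg)) (max (c.Mh * c.γ / (1 - c.γ))
      ((c.Mg * (1 + c.γ) + c.Mh * c.γ * (1 - c.γ)) / (1 - c.γ ^ 2))))))
  positivity

theorem one_le_batch (ε Δ : ℝ) : (1 : ℝ) ≤ c.batch ε Δ := by
  exact_mod_cast le_max_right _ _

theorem momentum_pos (hc : c.Valid) (hε : 0 < ε) : 0 < c.momentum ε Δ := by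
  have h1 := sigmaSq_pos hc
  have h2 := zero_lt_one.trans_le (c.one_le_batch ε Δ)
  exact lt_min (by positivity) (by norm_num)

theorem momentum_le_half (ε Δ : ℝ) : c.momentum ε Δ ≤ 1 / 2 := min_le_right _ _

/-- The 64 in the momentum serves to make the stationary noise at most `ε / 8` in root mean square.
-/
theorem momentum_mul_le (hc : c.Valid) (ε Δ : ℝ) :
    c.momentum ε Δ * (c.sigmaSq / c.batch ε Δ) ≤ (ε / 8) ^ 2 := by
  have h1 := sigmaSq_pos hc
  have h2 := zero_lt_one.trans_le (c.one_le_batch ε Δ)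
  calc _ ≤ (c.batch ε Δ * ε ^ 2 / (64 * c.sigmaSq)) * (c.sigmaSq / c.batch ε Δ) := by
        gcongr
        exact min_le_left _ _
    _ = _ := by field_simp; norm_num

theorem inv_momentum_le (hc : c.Valid) (hε : 0 < ε) :
    1 / c.momentum ε Δ ≤ 2 + 64 * (c.sigmaSq / (c.batch ε Δ * ε ^ 2)) := by
  have h1 := sigmaSq_pos hc
  have h2 := zero_lt_one.trans_le (c.one_le_batch ε Δ)
  rw [momentum]
  rcases min_choice (c.batch ε Δ * ε ^ 2 / (64 * c.sigmaSq)) (1 / 2) with h | h <;> rw [h]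
  · rw [one_div_div, mul_div_assoc]
    linarith
  · have : 0 ≤ c.sigmaSq / (c.batch ε Δ * ε ^ 2) := by positivity
    norm_num
    linarith

theorem inv_momentum_le_of_one_le (hc : c.Valid) (hε : 0 < ε) :
    1 / c.momentum ε Δ ≤ 2 + 64 * (c.sigmaSq / ε ^ 2) := by
  have h1 := sigmaSq_pos hc
  refine (inv_momentum_le hc hε).trans ?_
  gcongr
  exact le_mul_of_one_le_left (by positivity) (c.one_le_batch ε Δ)

theorem sigmaSq_div_batchInit_le (hε : 0 < ε) : c.sigmaSq / c.batchInit ε ≤ ε ^ 2 := by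
  have h1 : c.sigmaSq / ε ^ 2 ≤ c.batchInit ε :=
    (Nat.le_ceil _).trans (by exact_mod_cast le_max_left _ _)
  have h2 : (0 : ℝ) < c.batchInit ε := by exact_mod_cast zero_lt_one.trans_le (le_max_right _ _)
  rw [div_le_iff₀ (by positivity)] at h1
  rw [div_le_iff₀ h2]
  linarith

theorem stepSize_pos (hc : c.Valid) (hε : 0 < ε) : 0 < c.stepSize ε Δ := by
  have h1 := Lg_pos hc
  have h2 := Lh_pos hc
  have h3 := momentum_pos (Δ := Δ) hc hε
  exact lt_min (by positivity) (by positivity)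

theorem stepSize_le (ε Δ : ℝ) : c.stepSize ε Δ ≤ ε / (8 * c.Lg) := min_le_left _ _

theorem Lg_mul_stepSize_le (hc : c.Valid) (ε Δ : ℝ) : c.Lg / 2 * c.stepSize ε Δ ≤ ε / 16 := by
  have h1 := Lg_pos hc
  calc _ ≤ c.Lg / 2 * (ε / (8 * c.Lg)) := by
        gcongr
        exact stepSize_le ε Δ
    _ = _ := by field_simp; ring

/-- The second entry of the step size cancels `L_h / η²`, leaving `7 / (16 * 2)` of `ε`. -/
theorem Lh_mul_stepSize_sq_le (hc : c.Valid) (hε : 0 < ε) :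
    7 * c.Lh * c.stepSize ε Δ ^ 2 * (1 - c.momentum ε Δ) / (2 * c.momentum ε Δ ^ 2) ≤
      7 / 32 * ε := by
  have h2 := Lh_pos hc
  have h3 := momentum_pos (Δ := Δ) hc hε
  have h4 := (stepSize_pos (Δ := Δ) hc hε).le
  have h5 : c.stepSize ε Δ ^ 2 ≤ c.momentum ε Δ ^ 2 * ε / (16 * c.Lh) := by
    calc c.stepSize ε Δ ^ 2 ≤ (c.momentum ε Δ * √ε / (4 * √c.Lh)) ^ 2 := by
          gcongr
          exact min_le_right _ _
      _ = _ := by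
        rw [div_pow, mul_pow, mul_pow, Real.sq_sqrt hε.le, Real.sq_sqrt h2.le]
        norm_num
  have h6 : 0 ≤ 1 - c.momentum ε Δ := by linarith [c.momentum_le_half ε Δ]
  calc _ ≤ 7 * c.Lh * (c.momentum ε Δ ^ 2 * ε / (16 * c.Lh)) * 1 / (2 * c.momentum ε Δ ^ 2) := by
        gcongr
        linarith
    _ = _ := by field_simp; norm_num

theorem rpow_three_halves (hε : 0 < ε) : ε ^ (3 / 2 : ℝ) = ε * √ε := by
  rw [Real.sqrt_eq_rpow, show (3 / 2 : ℝ) = 1 + 1 / 2 by norm_num, Real.rpow_add hε, Real.rpow_one]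

theorem rpow_seven_halves (hε : 0 < ε) : ε ^ (7 / 2 : ℝ) = ε ^ 2 * ε ^ (3 / 2 : ℝ) := by
  rw [show (7 / 2 : ℝ) = 2 + 3 / 2 by norm_num, Real.rpow_add hε, Real.rpow_two]

theorem noiseTerm_eq (hε : 0 < ε) : c.noiseTerm ε Δ =
    c.sigmaSq / ε ^ 2 * (1 + √c.Lh * Δ / ε ^ (3 / 2 : ℝ)) := by
  rw [noiseTerm, rpow_seven_halves hε]
  field_simp

/-- The batch size is at least `noiseTerm / iterTerm`, and `noiseTerm` is `σ² / ε²` times `1 + x`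
with `x = √L_h Δ / ε^(3/2)`. So the large part of `1 / η`, times `1 + x`, is at most `64 *
iterTerm`. -/
theorem inv_momentum_mul_le (hc : c.Valid) (hε : 0 < ε) (hΔ : 0 < Δ) :
    1 / c.momentum ε Δ * (1 + √c.Lh * Δ / ε ^ (3 / 2 : ℝ)) ≤
      2 * (1 + √c.Lh * Δ / ε ^ (3 / 2 : ℝ)) + 64 * c.iterTerm ε Δ := by
  have h1 := sigmaSq_pos hc
  have h2 := Lh_pos hc
  have h3 := Lg_pos hc
  have hA : 0 < c.iterTerm ε Δ := by rw [iterTerm]; positivity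
  set x := √c.Lh * Δ / ε ^ (3 / 2 : ℝ) with hx
  have hx0 : 0 < x := by positivity
  have hM := zero_lt_one.trans_le (c.one_le_batch ε Δ)
  have hM' : c.noiseTerm ε Δ / c.iterTerm ε Δ ≤ c.batch ε Δ :=
    (Nat.le_ceil _).trans (by exact_mod_cast le_max_left _ _)
  rw [noiseTerm_eq hε, ← hx, div_le_iff₀ hA] at hM'
  have h4 : c.sigmaSq / (c.batch ε Δ * ε ^ 2) * (1 + x) ≤ c.iterTerm ε Δ := by
    rw [mul_comm (c.batch ε Δ : ℝ), ← div_div, div_mul_eq_mul_div, div_le_iff₀ hM]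
    linarith
  have h5 := mul_le_mul_of_nonneg_right (inv_momentum_le (Δ := Δ) hc hε) (by linarith : 0 ≤ 1 + x)
  linarith

theorem inv_stepSize_le (hc : c.Valid) (hε : 0 < ε) (hΔ : 0 ≤ Δ) :
    Δ / c.stepSize ε Δ ≤ ε * (8 * (c.Lg * Δ / ε ^ 2) +
      4 * (1 / c.momentum ε Δ * (√c.Lh * Δ / ε ^ (3 / 2 : ℝ)))) := by
  have h2 := Lh_pos hc
  have h3 := Lg_pos hc
  have h4 := momentum_pos (Δ := Δ) hc hε
  have e1 : Δ / (ε / (8 * c.Lg)) = ε * (8 * (c.Lg * Δ / ε ^ 2)) := by field_simp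
  have e2 : Δ / (c.momentum ε Δ * √ε / (4 * √c.Lh)) =
      ε * (4 * (1 / c.momentum ε Δ * (√c.Lh * Δ / ε ^ (3 / 2 : ℝ)))) := by
    rw [rpow_three_halves hε]
    field_simp
  have p1 : 0 ≤ ε * (8 * (c.Lg * Δ / ε ^ 2)) := by positivity
  have p2 : 0 ≤ ε * (4 * (1 / c.momentum ε Δ * (√c.Lh * Δ / ε ^ (3 / 2 : ℝ)))) := by positivity
  rw [stepSize, mul_add]
  rcases min_choice (ε / (8 * c.Lg)) (c.momentum ε Δ * √ε / (4 * √c.Lh)) with h | h <;> rw [h]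
  · rw [e1]; linarith
  · rw [e2]; linarith

/-- Number of iterations sufficient for accuracy `ε`, up to a constant. -/
theorem inv_stepSize_add_inv_momentum_le (hc : c.Valid) (hε : 0 < ε) (hΔ : 0 < Δ)
    (hA : 1 / 2 ≤ c.iterTerm ε Δ) :
    Δ / c.stepSize ε Δ + 2 * (ε / c.momentum ε Δ) ≤ 400 * c.iterTerm ε Δ * ε := by
  have h1 := inv_momentum_mul_le hc hε hΔ
  have h2 := inv_stepSize_le hc hε hΔ.le
  have h3 := Lh_pos hc
  have h4 := Lg_pos hc
  have hη := momentum_pos (Δ := Δ) hc hε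
  have hA' : c.iterTerm ε Δ = c.Lg * Δ / ε ^ 2 + √c.Lh * Δ / ε ^ (3 / 2 : ℝ) := rfl
  set x := √c.Lh * Δ / ε ^ (3 / 2 : ℝ)
  set y := c.Lg * Δ / ε ^ 2
  have hx : 0 < x := by positivity
  have hy : 0 < y := by positivity
  have hi : 0 < 1 / c.momentum ε Δ := by positivity
  have h5 : 0 < 1 / c.momentum ε Δ * x := by positivity
  -- Here `iterTerm = x + y`, and `1 ≤ 2 * iterTerm` absorbs the constant term; the true factor is
  -- 280.
  have h6 : 8 * y + 4 * (1 / c.momentum ε Δ * x) + 2 * (1 / c.momentum ε Δ) ≤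
      400 * c.iterTerm ε Δ := by linarith
  have h7 := mul_le_mul_of_nonneg_left h6 hε.le
  have h8 : ε / c.momentum ε Δ = ε * (1 / c.momentum ε Δ) := by ring
  rw [h8]
  linarith

/-! ### The horizon -/

theorem Dg_pos (hc : c.Valid) (H : ℕ) : 0 < c.Dg H := by
  have h1 := hc.Mg_pos
  have h2 := hc.rmax_pos
  have h4 : 0 < 1 - c.γ := by linarith [hc.γ_lt_one]
  rw [Dg]; positivity

/-- The base of the logarithm is below one, so the inequality is reversed and becomes a condition on
`γ ^ H`. -/
theorem horizon_cond_iff (hc : c.Valid) (hε : 0 < ε) (H : ℕ) :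
    max (Real.logb c.γ (ε * c.momentum ε Δ / (64 * max (c.Dg H) (c.stepSize ε Δ * c.Dh H)))) 1 ≤
      (H : ℝ) ↔ c.γ ^ H * (64 * max (c.Dg H) (c.stepSize ε Δ * c.Dh H)) ≤ ε * c.momentum ε Δ ∧
        1 ≤ H := by
  have hD : 0 < max (c.Dg H) (c.stepSize ε Δ * c.Dh H) := lt_max_of_lt_left (Dg_pos hc H)
  have hη := momentum_pos (Δ := Δ) hc hε
  rw [max_le_iff, Real.logb_le_iff_le_rpow_of_base_lt_one hc.γ_pos hc.γ_lt_one (by positivity),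
    Real.rpow_natCast, le_div_iff₀ (by positivity), Nat.one_le_cast]

theorem logFactor_ge_one (hc : c.Valid) (hε : 0 < ε) : 1 ≤ c.logFactor ε := by
  have h1 := hc.Mg_pos
  have h2 := hc.rmax_pos
  have h4 : 0 < 1 - c.γ := by linarith [hc.γ_lt_one]
  have h5 : 1 ≤ 1 / (1 - c.γ) := by
    rw [le_div_iff₀ h4]; linarith [hc.γ_pos]
  have h6 : 0 < c.rmax * c.Mg / ε := by positivity
  rw [logFactor, Real.le_log_iff_exp_le (by positivity)]
  linarith [Real.exp_one_lt_d9]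

/-- Length of the horizon after which the discount beats polynomial factors. -/
theorem pow_mul_le_one {γ a b : ℝ} (h0 : 0 ≤ γ) (hγ : γ ≤ Real.exp (-(1 / a))) (ha1 : 1 ≤ a)
    (hb0 : 0 < b) {N : ℕ} (hNl : 34 * a * Real.log (2 + b + a) ≤ N) :
    γ ^ N * (64 * ((b * a + 1) * (a + N))) * (66 * (2 + b + a) ^ 5) ≤ 1 := by
  set Q := 2 + b + a with hQ
  have hQ3 : 3 ≤ Q := by linarith
  -- The decay `exp (-N / a)` is split into two equal factors. One beats `Q ^ 17`, which is why `34
  -- = 2 * 17` appears; the other absorbs the linear growth in `N`. A power `Q ^ 9 ≥ 3 ^ 9` is left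
  -- to beat the numerical constants.
  have hexp : Real.exp (-(N / (2 * a))) ≤ (Q ^ 17)⁻¹ := by
    rw [Real.exp_neg]
    gcongr
    calc Q ^ 17 = Real.exp (17 * Real.log Q) := by
          rw [mul_comm, Real.exp_mul, Real.exp_log (by linarith)]
          norm_cast
      _ ≤ _ := by
        gcongr
        rw [le_div_iff₀ (by positivity)]
        linarith
  have hpow : γ ^ N ≤ Real.exp (-(N / (2 * a))) * Real.exp (-(N / (2 * a))) := by
    calc γ ^ N ≤ Real.exp (-(1 / a)) ^ N := by gcongr
      _ = _ := by
        rw [← Real.exp_nat_mul, ← Real.exp_add]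
        congr 1
        field_simp
        ring
  have hlin : Real.exp (-(N / (2 * a))) * (a + N) ≤ 3 * Q := by
    have h5 : (N : ℝ) / (2 * a) ≤ Real.exp (N / (2 * a)) := by
      linarith [Real.add_one_le_exp ((N : ℝ) / (2 * a))]
    have h6 : Real.exp (-(N / (2 * a))) ≤ 1 := Real.exp_le_one_iff.2 (by
      have : (0 : ℝ) ≤ N / (2 * a) := by positivity
      linarith)
    have h7 : Real.exp (-(N / (2 * a))) * N ≤ 2 * a := by
      rw [Real.exp_neg, inv_mul_le_iff₀ (Real.exp_pos _)]
      rw [div_le_iff₀ (by positivity)] at h5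
      linarith
    have h8 := mul_le_mul_of_nonneg_right h6 (by linarith : 0 ≤ a)
    linarith
  have hQ1 : b * a + 1 ≤ Q ^ 2 := by
    have : 0 < b * a := by positivity
    calc b * a + 1 ≤ 4 + b ^ 2 + a ^ 2 + 4 * b + 4 * a + 2 * (b * a) := by
          linarith [sq_nonneg b, sq_nonneg a]
      _ = Q ^ 2 := by rw [hQ]; ring
  calc _ ≤ (Real.exp (-(N / (2 * a))) * Real.exp (-(N / (2 * a)))) *
          (64 * (Q ^ 2 * (a + N))) * (66 * Q ^ 5) := by gcongr
    _ = 4224 * Q ^ 7 * Real.exp (-(N / (2 * a))) * (Real.exp (-(N / (2 * a))) * (a + N)) := by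
      ring
    _ ≤ 4224 * Q ^ 7 * (Q ^ 17)⁻¹ * (3 * Q) := by gcongr
    _ = 12672 / Q ^ 9 := by field_simp; norm_num
    _ ≤ 1 := by
      rw [div_le_one (by positivity)]
      calc (12672 : ℝ) ≤ 3 ^ 9 := by norm_num
        _ ≤ Q ^ 9 := by gcongr

/-- Although `D_g` and `D_h` grow with the horizon, they do so polynomially; a horizon of order `log
Q / (1 - γ)` wins against them and against `1 / η`. -/
theorem exists_horizon (hc : c.Valid) (hε : 0 < ε) : ∃ N : ℕ,
    max (Real.logb c.γ (ε * c.momentum ε Δ / (64 * max (c.Dg N) (c.stepSize ε Δ * c.Dh N)))) 1 ≤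
      (N : ℝ) ∧ (N : ℝ) ≤ 35 * (1 / (1 - c.γ)) * c.logFactor ε := by
  have h1 := hc.Mg_pos
  have h2 := hc.rmax_pos
  have h3 := hc.Mh_pos
  have hγ := hc.γ_pos
  have h4 : 0 < 1 - c.γ := by linarith [hc.γ_lt_one]
  have hη := momentum_pos (Δ := Δ) hc hε
  have hΛ := logFactor_ge_one hc hε
  have hσ : c.sigmaSq / ε ^ 2 = (c.rmax * c.Mg / ε) ^ 2 * (1 / (1 - c.γ)) ^ 3 := by
    rw [sigmaSq]; field_simp
  have hinv := inv_momentum_le_of_one_le (Δ := Δ) hc hε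
  rw [hσ] at hinv
  have hDg : ∀ N, c.Dg N = ε * (c.rmax * c.Mg / ε) * (1 / (1 - c.γ)) *
      √(1 / (1 - c.γ) + N) := fun N => by rw [Dg]; field_simp
  -- The bound `α ≤ ε / (8 L_g)` cancels the factor `M_h + M_g²`, so neither Hessian constant enters
  -- the logarithm.
  have hDh : ∀ N : ℕ, c.stepSize ε Δ * c.Dh N ≤ ε * (1 / (1 - c.γ) + N) := fun N => by
    have hL := Lg_pos hc
    have : 0 < c.Dh N := by rw [Dh]; positivity
    calc _ ≤ ε / (8 * c.Lg) * c.Dh N := by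
          gcongr
          exact stepSize_le ε Δ
      _ = ε * (1 / (1 - c.γ) + N) * ((1 - c.γ) / 8) := by
          rw [Dh, Lg, add_comm c.Mh]; field_simp
      _ ≤ _ := mul_le_of_le_one_right (by positivity) (by linarith)
  have hγe : c.γ ≤ Real.exp (-(1 / (1 / (1 - c.γ)))) := by
    rw [one_div_one_div]
    linarith [Real.add_one_le_exp (-(1 - c.γ))]
  set a := 1 / (1 - c.γ) with ha
  set b := c.rmax * c.Mg / ε with hb
  have ha1 : 1 ≤ a := by rw [ha, le_div_iff₀ h4]; linarith
  have hb0 : 0 < b := by positivity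
  set Q := 2 + b + a with hQ
  have hQ3 : 3 ≤ Q := by linarith
  have hΛQ : c.logFactor ε = Real.log Q := rfl
  rw [hΛQ] at hΛ ⊢
  set N := ⌈34 * a * Real.log Q⌉₊ with hN
  have hNl : 34 * a * Real.log Q ≤ N := Nat.le_ceil _
  have haΛ : 1 ≤ a * Real.log Q := one_le_mul_of_one_le_of_one_le ha1 hΛ
  have hN1 : (1 : ℝ) ≤ N := by linarith
  refine ⟨N, (horizon_cond_iff hc hε N).2 ⟨?_, by exact_mod_cast hN1⟩, ?_⟩
  · have hmax : max (c.Dg N) (c.stepSize ε Δ * c.Dh N) ≤ ε * (b * a + 1) * (a + N) := by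
      have h5 : √(a + N) ≤ a + N := Real.sqrt_le_iff.2 ⟨by linarith, by nlinarith⟩
      refine max_le ?_ ((hDh N).trans ?_)
      · rw [hDg N]
        calc _ ≤ ε * b * a * (a + N) := by gcongr
          _ ≤ _ := by nlinarith [mul_pos hε (by linarith : 0 < a + N)]
      · have : 0 ≤ ε * (b * a) * (a + N) := by positivity
        linarith
    have hfin := pow_mul_le_one hγ.le hγe ha1 hb0 hNl
    rw [← hQ] at hfin
    have hQ2 : 2 + 64 * (b ^ 2 * a ^ 3) ≤ 66 * Q ^ 5 := by
      have h5 : b ^ 2 * a ^ 3 ≤ Q ^ 2 * Q ^ 3 := by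
        gcongr <;> linarith
      have h6 : 1 ≤ Q ^ 5 := one_le_pow₀ (by linarith)
      linarith [show Q ^ 2 * Q ^ 3 = Q ^ 5 by ring]
    have hη' : 1 / (66 * Q ^ 5) ≤ c.momentum ε Δ := by
      rw [one_div_le (by positivity) hη]
      exact hinv.trans hQ2
    calc _ ≤ c.γ ^ N * (64 * (ε * (b * a + 1) * (a + N))) := by gcongr
      _ = ε * (c.γ ^ N * (64 * ((b * a + 1) * (a + N)))) := by ring
      _ ≤ ε * (1 / (66 * Q ^ 5)) := by
        gcongr
        rw [le_div_iff₀ (by positivity)]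
        exact hfin
      _ ≤ _ := by gcongr
  · have := Nat.ceil_lt_add_one (by positivity : 0 ≤ 34 * a * Real.log Q)
    linarith

/-- The witness above makes the defining set nonempty, so its infimum belongs to it. The 128 is `64
* 2`, from `η ≤ 1 / 2`. -/
theorem horizon_spec (hc : c.Valid) (hε : 0 < ε) :
    c.γ ^ c.horizon ε Δ * c.Dg (c.horizon ε Δ) ≤ ε / 128 ∧ 1 ≤ c.horizon ε Δ ∧
      (c.horizon ε Δ : ℝ) ≤ 35 * (1 / (1 - c.γ)) * c.logFactor ε := by
  obtain ⟨N, hN, hle⟩ := exists_horizon (Δ := Δ) hc hε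
  obtain ⟨h1, h2⟩ := (horizon_cond_iff hc hε _).1 (Nat.sInf_mem ⟨N, hN⟩ : c.horizon ε Δ ∈ _)
  refine ⟨?_, h2, le_trans (Nat.cast_le.2 (Nat.sInf_le hN)) hle⟩
  have h3 : c.γ ^ c.horizon ε Δ * c.Dg (c.horizon ε Δ) ≤ c.γ ^ c.horizon ε Δ *
      max (c.Dg (c.horizon ε Δ)) (c.stepSize ε Δ * c.Dh (c.horizon ε Δ)) :=
    mul_le_mul_of_nonneg_left (le_max_left _ _) (pow_nonneg hc.γ_pos.le _)
  have h4 := mul_le_mul_of_nonneg_left (c.momentum_le_half ε Δ) hε.le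
  change c.γ ^ c.horizon ε Δ * (64 * max (c.Dg (c.horizon ε Δ))
    (c.stepSize ε Δ * c.Dh (c.horizon ε Δ))) ≤ _ at h1
  linarith

theorem batchInit_le (hc : c.Valid) (hε : 0 < ε) : (c.batchInit ε : ℝ) ≤ c.sigmaSq / ε ^ 2 + 1 := by
  have h1 := sigmaSq_pos hc
  have h2 : 0 ≤ c.sigmaSq / ε ^ 2 := by positivity
  rw [batchInit, Nat.cast_max, Nat.cast_one]
  exact max_le (Nat.ceil_lt_add_one h2).le (by linarith)

theorem batch_le (h : 0 ≤ c.noiseTerm ε Δ / c.iterTerm ε Δ) :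
    (c.batch ε Δ : ℝ) ≤ c.noiseTerm ε Δ / c.iterTerm ε Δ + 1 := by
  rw [batch, Nat.cast_max, Nat.cast_one]
  exact max_le (Nat.ceil_lt_add_one h).le (by linarith)

end Consts

/-! ### Assembly: accuracy and total time. -/

/-- Number of updates after which the method is stopped. -/
def Consts.numSteps (c : Consts) (ε Δ : ℝ) : ℕ :=
  -- In the first case `‖∇J(θ₀)‖² ≤ 2 L_g Δ ≤ ε²`, so `θ₀` alone suffices and no call is made. In
  -- the second, `iterTerm ≥ 1 / 2` absorbs all roundings.
  if c.Lg * Δ / ε ^ 2 ≤ 1 / 2 then 0 else ⌈1800 * c.iterTerm ε Δ⌉₊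

section Hetero

variable {n d : ℕ} {S A : Fin n → Type*} [∀ i, MeasurableSpace (S i)] [∀ i, MeasurableSpace (A i)]
  {ag : ∀ i, Agent d (S i) (A i)} {c : Consts} {ε Δ : ℝ} {θ₀ : Par d}

namespace Run

variable {Ω : Type*} [mΩ : MeasurableSpace Ω] {P : Measure Ω}

theorem average_norm_objGrad_le [NeZero n] [IsProbabilityMeasure P] (hc : c.Valid)
    (hag : ∀ i, (ag i).Regular c) (hε : 0 < ε) (hΔ : Δ = gap ag c.γ θ₀)
    (R : Run ag c.γ (c.momentum ε Δ) (c.stepSize ε Δ) θ₀ (c.batchInit ε) (c.batch ε Δ)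
      (c.horizon ε Δ) P)
    (hw : ∀ k ω, LoopDone (batchOf (c.batchInit ε) (c.batch ε Δ) k) (received (fun l => R.who k l ω)
      (passes (batchOf (c.batchInit ε) (c.batch ε Δ) k) fun l => R.who k l ω))) :
    (1 / ((c.numSteps ε Δ + 1 : ℕ) : ℝ)) * ∑ t ∈ Finset.range (c.numSteps ε Δ + 1),
      ∫ ω, ‖objGrad ag c.γ (R.iter t ω)‖ ∂P ≤ ε := by
  have hLg := Lg_pos hc
  have hLh := Consts.Lh_pos hc
  have hΔ0 : 0 ≤ Δ := hΔ ▸ gap_nonneg hc hag θ₀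
  by_cases hy : c.Lg * Δ / ε ^ 2 ≤ 1 / 2
  · have e : c.numSteps ε Δ = 0 := if_pos hy
    rw [e]
    simp only [R.iter_zero, zero_add, Finset.range_one, Finset.sum_singleton, integral_const,
      probReal_univ, one_smul, Nat.cast_one, div_one, one_mul]
    have h := norm_objGrad_sq_le hc hag θ₀
    rw [← hΔ] at h
    rw [div_le_iff₀ (by positivity)] at hy
    exact abs_le_of_sq_le_sq' (by linarith) hε.le |>.2
  · have e : c.numSteps ε Δ = ⌈1800 * c.iterTerm ε Δ⌉₊ := if_neg hy
    rw [not_le] at hy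
    have hΔ1 : 0 < Δ := by
      refine lt_of_le_of_ne hΔ0 fun h => ?_
      rw [← h] at hy
      norm_num at hy
    have hA : 1 / 2 ≤ c.iterTerm ε Δ := by
      rw [Consts.iterTerm]
      exact hy.le.trans (le_add_of_nonneg_right (by positivity))
    have hη := Consts.momentum_pos (Δ := Δ) hc hε
    have hη2 := c.momentum_le_half ε Δ
    -- Noise levels: `ε` for the initial batch, whose noise decays, and `ε / 8` for the stationary
    -- part.
    have h1 := R.sum_integral_norm_objGrad_le hc hag
      (zero_lt_one.trans_le (le_max_right _ _)) (zero_lt_one.trans_le (le_max_right _ _)) hw hη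
      (by linarith) (Consts.stepSize_pos hc hε) hLh.le hε (by positivity : 0 < ε / 8)
      (Consts.sigmaSq_div_batchInit_le hε) (Consts.momentum_mul_le hc ε Δ) (c.numSteps ε Δ + 1)
    rw [← hΔ] at h1
    have h2 := Consts.inv_stepSize_add_inv_momentum_le hc hε hΔ1 hA
    have h3 := (Consts.horizon_spec (Δ := Δ) hc hε).1
    have h4 := Consts.Lg_mul_stepSize_le hc ε Δ
    have h5 := Consts.Lh_mul_stepSize_sq_le (Δ := Δ) hc hε
    have hT : 1800 * c.iterTerm ε Δ ≤ c.numSteps ε Δ := e ▸ Nat.le_ceil _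
    push_cast at h1 ⊢
    have hT1 : (0 : ℝ) < c.numSteps ε Δ + 1 := by positivity
    rw [one_div_mul_eq_div, div_le_iff₀ hT1]
    -- In units of `ε / 64`: noise 16, truncation 1, curvature 28, smoothness 4. The remaining 15
    -- exceed the share `400 / 1800` of the transient terms.
    have h6 : (c.numSteps ε Δ + 1 : ℝ) * (2 * (ε / 8) + 2 * (c.γ ^ c.horizon ε Δ *
        c.Dg (c.horizon ε Δ) + 7 * c.Lh * c.stepSize ε Δ ^ 2 * (1 - c.momentum ε Δ) /
          (2 * c.momentum ε Δ ^ 2)) + c.Lg / 2 * c.stepSize ε Δ) ≤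
        (c.numSteps ε Δ + 1) * (49 / 64 * ε) := by
      gcongr
      linarith
    have h7 : 400 * c.iterTerm ε Δ * ε ≤ 400 / 1800 * (c.numSteps ε Δ + 1) * ε := by
      calc 400 * c.iterTerm ε Δ * ε = 400 / 1800 * (1800 * c.iterTerm ε Δ) * ε := by ring
        _ ≤ _ := by gcongr; linarith
    have h8 : 0 < ε * (c.numSteps ε Δ + 1) := by positivity
    linarith

namespace Timing

variable {R : Run ag c.γ (c.momentum ε Δ) (c.stepSize ε Δ) θ₀ (c.batchInit ε) (c.batch ε Δ)
  (c.horizon ε Δ) P} {κ : ℝ} {hdot : Fin n → ℝ}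

theorem elapsed_numSteps_le [NeZero n] (hc : c.Valid) (hε : 0 < ε) (hΔ : 0 ≤ Δ)
    (𝒯 : R.Timing κ hdot) (hκ : 0 ≤ κ) (hh : Monotone hdot) (ω : Ω) :
    𝒯.elapsed (c.numSteps ε Δ + 1) ω ≤ 200000 * c.logFactor ε *
      (κ * c.iterTerm ε Δ + 1 / (1 - c.γ) * (hdot ⊤ * c.iterTerm ε Δ +
        ((1 / n : ℝ) * ∑ i, hdot i) * (c.noiseTerm ε Δ / n))) := by
  have hLg := Lg_pos hc
  have hLh := Consts.Lh_pos hc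
  have hσ := Consts.sigmaSq_pos hc
  have h1γ : 0 < 1 - c.γ := by linarith [hc.γ_lt_one]
  have hn : (1 : ℝ) ≤ n := by exact_mod_cast NeZero.one_le
  have hn0 : (0 : ℝ) < n := by linarith
  obtain ⟨-, hH1, hH⟩ := Consts.horizon_spec (Δ := Δ) hc hε
  have hH0 : (0 : ℝ) < c.horizon ε Δ := Nat.cast_pos.2 hH1
  have hh0 : ∀ i, 0 ≤ hdot i := fun i =>
    nonneg_of_mul_nonneg_left (𝒯.mul_nonneg_of_mem i ω) hH0
  have hΛ := Consts.logFactor_ge_one hc hε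
  have hA0 : 0 ≤ c.iterTerm ε Δ := by rw [Consts.iterTerm]; positivity
  have hBσ : c.sigmaSq / ε ^ 2 ≤ c.noiseTerm ε Δ := by
    rw [Consts.noiseTerm]; exact le_add_of_nonneg_right (by positivity)
  have hB0 : 0 ≤ c.noiseTerm ε Δ := le_trans (by positivity) hBσ
  have ha0 : 0 < 1 / (1 - c.γ) := by positivity
  have hm0 : 0 ≤ (1 / n : ℝ) * ∑ i, hdot i :=
    mul_nonneg (by positivity) (Finset.sum_nonneg fun i _ => hh0 i)
  have hmt : (1 / n : ℝ) * ∑ i, hdot i ≤ hdot ⊤ := by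
    have := Finset.sum_le_sum fun i (_ : i ∈ Finset.univ) => hh (le_top (a := i))
    rw [Finset.sum_const, Finset.card_univ, Fintype.card_fin, nsmul_eq_mul] at this
    calc _ ≤ (1 / n : ℝ) * (n * hdot ⊤) := by gcongr
      _ = _ := by field_simp
  have ht0 := hh0 ⊤
  have hel := 𝒯.elapsed_le hh (c.numSteps ε Δ) ω
  set a := 1 / (1 - c.γ)
  set A := c.iterTerm ε Δ with hA
  set B := c.noiseTerm ε Δ with hB
  set Λ := c.logFactor ε
  set m := (1 / n : ℝ) * ∑ i, hdot i
  set h := hdot ⊤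
  have hΛ0 : 0 ≤ Λ := by linarith
  by_cases hy : c.Lg * Δ / ε ^ 2 ≤ 1 / 2
  · have e : c.numSteps ε Δ = 0 := if_pos hy
    rw [e, elapsed, zero_add, Nat.sub_self, Finset.sum_range_zero]
    positivity
  have e : c.numSteps ε Δ = ⌈1800 * A⌉₊ := if_neg hy
  rw [not_le] at hy
  have hA1 : 1 / 2 ≤ A := by
    rw [hA, Consts.iterTerm]
    exact hy.le.trans (le_add_of_nonneg_right (by positivity))
  have hT : (c.numSteps ε Δ : ℝ) ≤ 1802 * A := by
    have := (Nat.ceil_lt_add_one (by positivity : 0 ≤ 1800 * A)).le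
    rw [e]
    linarith
  set T := c.numSteps ε Δ
  set H := c.horizon ε Δ
  have hM : (c.batch ε Δ : ℝ) ≤ B / A + 1 := Consts.batch_le (by positivity)
  have hMi : (c.batchInit ε : ℝ) ≤ B + 2 * A := by
    have := Consts.batchInit_le hc hε
    linarith
  -- Rounding the batch size up costs one extra sample per step, so the total is of order `A + B`
  -- and not just `B`.
  have hbatch : (c.batchInit ε + T * c.batch ε Δ : ℝ) ≤ 1803 * B + 1804 * A := by
    have h1 : (T * c.batch ε Δ : ℝ) ≤ 1802 * A * (B / A + 1) := by gcongr
    have h2 : 1802 * A * (B / A + 1) = 1802 * B + 1802 * A := by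
      have : A ≠ 0 := by linarith
      field_simp
    linarith
  have hp1 : 0 ≤ κ * A := by positivity
  have hp2 : 0 ≤ a * (h * A) := by positivity
  have hp3 : 0 ≤ a * (m * (B / n)) := by positivity
  have k1 : (T : ℝ) * (2 * κ + H * h) ≤ 1802 * A * (2 * κ + 35 * a * Λ * h) := by gcongr
  have k2 : 2 * (H * m) * ((c.batchInit ε + T * c.batch ε Δ) / n) ≤
      2 * (35 * a * Λ * m) * ((1803 * B + 1804 * A) / n) := by gcongr
  -- The cost of that rounding is absorbed by the slowest agent's term, as the mean time is at most
  -- the largest.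
  have k3 : m * (A / n) ≤ h * A := by
    gcongr
    exact div_le_self hA0 hn
  have k4 := mul_le_mul_of_nonneg_left k3 (by positivity : 0 ≤ a * Λ)
  have k5 : κ * A ≤ Λ * (κ * A) := le_mul_of_one_le_left hp1 hΛ
  have e1 : 2 * (35 * a * Λ * m) * ((1803 * B + 1804 * A) / n) =
      126210 * (Λ * (a * (m * (B / n)))) + 126280 * (a * Λ * (m * (A / n))) := by ring
  have q1 := mul_nonneg hΛ0 hp1
  have q2 := mul_nonneg hΛ0 hp2
  have q3 := mul_nonneg hΛ0 hp3
  rw [e1] at k2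
  linarith

end Timing

end Run

end Hetero

end MaleniaNIGT

end

theorem mainTheorem2 :
    ∃ C : ℝ, 0 < C ∧
      ∀ (n d : ℕ) [NeZero n] (S : Fin n → Type u) (A : Fin n → Type v)
        [∀ i, MeasurableSpace (S i)] [∀ i, MeasurableSpace (A i)]
        (ag : ∀ i, Agent d (S i) (A i)) (c : Consts) (θ₀ : Par d) (ε Δ : ℝ),
        c.Valid → (∀ i, (ag i).Regular c) → 0 < ε → Δ = gap ag c.γ θ₀ →
        Differentiable ℝ (objective ag c.γ) ∧
        ∃ T : ℕ, 1 ≤ T ∧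
          ∀ (κ : ℝ) (hdot : Fin n → ℝ), 0 ≤ κ → Monotone hdot →
          ∀ (Ω : Type w) [MeasurableSpace Ω] (P : Measure Ω) [IsProbabilityMeasure P]
            (R : Run ag c.γ (c.momentum ε Δ) (c.stepSize ε Δ) θ₀ (c.batchInit ε) (c.batch ε Δ)
              (c.horizon ε Δ) P)
            (𝒯 : R.Timing κ hdot),
            Integrable (fun p => ‖gradient (objective ag c.γ) (R.iter p.2 p.1)‖)
              (Run.withUniformIndex P T) ∧
            ∫ p, ‖gradient (objective ag c.γ) (R.iter p.2 p.1)‖ ∂(Run.withUniformIndex P T) ≤ ε ∧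
            ∀ ω, 𝒯.elapsed T ω ≤ C * c.logFactor ε *
              (κ * (c.Lg * Δ / ε ^ 2 + √c.Lh * Δ / ε ^ (3 / 2 : ℝ)) +
                1 / (1 - c.γ) *
                  (hdot ⊤ * (c.Lg * Δ / ε ^ 2 + √c.Lh * Δ / ε ^ (3 / 2 : ℝ)) +
                    ((1 / n : ℝ) * ∑ i, hdot i) *
                      (c.sigmaSq / (n * ε ^ 2) +
                        c.sigmaSq * √c.Lh * Δ / (n * ε ^ (7 / 2 : ℝ))))) := by
  refine ⟨200000, by norm_num, ?_⟩
  intro n d _ S A _ _ ag c θ₀ ε Δ hc hag hε hΔ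
  refine ⟨fun θ => (hasGradientAt_objective hc hag θ).differentiableAt, c.numSteps ε Δ + 1,
    by omega, ?_⟩
  intro κ hdot hκ hh Ω _ P _ R 𝒯
  rw [gradient_objective hc hag]
  obtain ⟨hI, he⟩ := Run.integral_withUniformIndex (P := P) (Nat.succ_pos (c.numSteps ε Δ))
    fun t => R.integrable_norm_objGrad hc hag t
  refine ⟨hI, he.trans_le (R.average_norm_objGrad_le hc hag hε hΔ 𝒯.loopDone), fun ω => ?_⟩
  have hΔ0 : 0 ≤ Δ := hΔ ▸ gap_nonneg hc hag θ₀
  have e : c.noiseTerm ε Δ / n = c.sigmaSq / (n * ε ^ 2) +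
      c.sigmaSq * √c.Lh * Δ / (n * ε ^ (7 / 2 : ℝ)) := by
    rw [Consts.noiseTerm, add_div, div_div, div_div, mul_comm (ε ^ 2), mul_comm (ε ^ (7 / 2 : ℝ))]
  rw [← e]
  exact 𝒯.elapsed_numSteps_le hc hε hΔ0 hκ hh ω
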